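/- **Setting.** Let $N$ source–destination pairs share an interference channel, with channel gains $A^{j,i}>0$ (from source $j$ to destination $i$), noise variances $\sigma_i^2>0$, weights $\beta_i>0$ and maximal powers $\mathcal P_i>0$. Let $G=\{p\in\mathbb R^N:\ 0\le p^i\le\mathcal P_i,\ i=1,\dots,N\}$, let $Q(x)=(2\pi)^{-1/2}\int_x^\infty e^{-t^2/2}\,dt$, and let $$P_{e,i}(p)=Q\!\left(\sqrt{\frac{A^{i,i}p^i}{\sigma_i^2+\sum_{j\ne i}A^{j,i}p^j}}\right),\qquad F(p)=\sum_{i=1}^N\beta_iP_{e,i}(p).$$ The set $\mathcal L$ of KKT points of the (non-convex) problem $\min_{p\in G}F(p)$ is the set of all $p\in G$ at which $F$ is differentiable and $-\nabla F(p)\in\mathcal N_G(p)$, where $\mathcal N_G(p)=\{v\in\mathbb R^N:\ v^T(p-p')\ge 0\ \ \forall p'\in G\}$. **Algorithm.** Let $P_G$ be the Euclidean projection onto $G$, let $(\gamma_n)_{n\ge1}$ be deterministic step sizes, and let $W_n=(w_n(i,j))_{1\le i,j\le N}$, $n\ge1$, be random $N\times N$ matrices. Starting from (possibly random) $\theta_{0,1},\dots,\theta_{0,N}\in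 G$, put for $n\ge1$ and $i=1,\dots,N$ $$\tilde\theta_{n,i}=P_G\big[\theta_{n-1,i}-\gamma_n\beta_i\nabla P_{e,i}(\theta_{n-1,i})\big],\qquad \theta_{n,i}=\sum_{j=1}^N w_n(i,j)\,\tilde\theta_{n,j},\qquad \langle\theta_n\rangle=\frac1N\sum_{i=1}^N\theta_{n,i}.$$ **Assumptions.** Let $\mathbf 1=(1,\dots,1)^T\in\mathbb R^N$. 1. Almost surely $W_n$ has non-negative entries and $W_n\mathbf 1=\mathbf 1$, and $\mathbf 1^T\mathbb E(W_n)=\mathbf 1^T$, for every $n\ge1$. For every $n\ge1$, $W_{n+1}$ is independent of $(\theta_0,W_1,\dots,W_n)$, where $\theta_0=(\theta_{0,1},\dots,\theta_{0,N})$. 2. The spectral norm $\rho_n$ of $\mathbb E\big(W_n^T(I_N-\mathbf 1\mathbf 1^T/N)W_n\big)$ satisfies $\lim_{n\to\infty}n(1-\rho_n)=+\infty$. 3. $\gamma_n>0$ for all $n\ge1$, $\sum_n\gamma_n=\infty$, and there is $\alpha>1/2$ with $\lim_{n\to\infty}n^\alpha\gamma_n=0$ and $\liminf_{n\to\infty}\frac{1-\rho_n}{n^\alpha\gamma_n}>0$.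 **Corollary (power allocation).** For almost every realization along which the algorithm is well defined, i.e. all the gradients $\nabla P_{e,i}(\theta_{n,i})$, $n\ge0$, $1\le i\le N$, exist (equivalently, the $i$-th coordinate of $\theta_{n,i}$ is never $0$), the average estimate converges to the set of KKT points: $$\lim_{n\to\infty}\ \inf_{p\in\mathcal L}\big|\langle\theta_n\rangle-p\big|=0 .$$ -/

import Mathlib

open Filter Topology MeasureTheory ProbabilityTheory
open scoped Matrix

noncomputable section

namespace PowerAllocation

/-- Vectors of `N` transmit powers, with the Euclidean norm. -/
abbrev Powers (N : ℕ) := EuclideanSpace ℝ (Fin N)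

/-- The Gaussian tail function `Q(x) = (2π)^{-1/2} ∫_x^∞ e^{-t²/2} dt`. -/
def gaussQ (x : ℝ) : ℝ :=
  (Real.sqrt (2 * Real.pi))⁻¹ * ∫ t in Set.Ioi x, Real.exp (-t ^ 2 / 2)

/-- Signal to interference-plus-noise ratio at destination `i`; `A j i` is the channel gain from
source `j` to destination `i`, and `σ i ^ 2` is the noise variance at destination `i`. -/
def sinr {N : ℕ} (A : Fin N → Fin N → ℝ) (σ : Fin N → ℝ) (i : Fin N) (p : Powers N) : ℝ :=
  A i i * p i / (σ i ^ 2 + ∑ j ∈ Finset.univ.erase i, A j i * p j)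

/-- The 4-QAM error probability at destination `i`. -/
def errProb {N : ℕ} (A : Fin N → Fin N → ℝ) (σ : Fin N → ℝ) (i : Fin N) (p : Powers N) : ℝ :=
  gaussQ (Real.sqrt (sinr A σ i p))

/-- The objective: the weighted sum of the error probabilities. -/
def objective {N : ℕ} (A : Fin N → Fin N → ℝ) (σ β : Fin N → ℝ) (p : Powers N) : ℝ :=
  ∑ i, β i * errProb A σ i p

/-- The constraint set: the box of all power vectors with `0 ≤ p i ≤ P i`. -/
def powerBox {N : ℕ} (P : Fin N → ℝ) : Set (Powers N) :=
  {p | ∀ i, 0 ≤ p i ∧ p i ≤ P i}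

/-- Euclidean projection onto a set: a nearest point of the set (it exists and is unique when the
set is nonempty, closed and convex). -/
def proj {N : ℕ} (G : Set (Powers N)) (x : Powers N) : Powers N :=
  Classical.epsilon fun y => y ∈ G ∧ ∀ z ∈ G, ‖x - y‖ ≤ ‖x - z‖

/-- The normal cone of `G` at `x`. -/
def normalCone {N : ℕ} (G : Set (Powers N)) (x : Powers N) : Set (Powers N) :=
  {v | ∀ y ∈ G, 0 ≤ inner ℝ v (x - y)}

/-- The KKT points of `f` on `G`: the points of `G` at which `f` has a gradient whose opposite lies
in the normal cone. -/
def kktSet {N : ℕ} (G : Set (Powers N)) (f : Powers N → ℝ) : Set (Powers N) :=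
  {x | x ∈ G ∧ ∃ g : Powers N, HasGradientAt f g x ∧ -g ∈ normalCone G x}

/-- Local step of agent `i` with step size `c`, applied to its own estimate `x`. -/
def localStep {N : ℕ} (A : Fin N → Fin N → ℝ) (σ β P : Fin N → ℝ) (c : ℝ) (i : Fin N)
    (x : Powers N) : Powers N :=
  proj (powerBox P) (x + c • (-(β i • gradient (errProb A σ i) x)))

/-- The distributed projected gradient algorithm along one realization `w` of the gossip matrices:
`iterates … n i` is the estimate (of the whole power vector) held by agent `i` after `n`
iterations. Only `γ n` and `w n` with `n ≥ 1` are used. -/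
def iterates {N : ℕ} (A : Fin N → Fin N → ℝ) (σ β P : Fin N → ℝ) (γ : ℕ → ℝ)
    (w : ℕ → Matrix (Fin N) (Fin N) ℝ) (x₀ : Fin N → Powers N) : ℕ → Fin N → Powers N
  | 0 => x₀
  | n + 1 => fun i =>
      ∑ j, w (n + 1) i j • localStep A σ β P (γ (n + 1)) j (iterates A σ β P γ w x₀ n j)

/-- The average of the `N` estimates. -/
def average {N : ℕ} (x : Fin N → Powers N) : Powers N := (N : ℝ)⁻¹ • ∑ i, x i

variable {Ω : Type*} [MeasurableSpace Ω]

/-- Entrywise expectation of a random matrix. -/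
def expect {N : ℕ} (μ : Measure Ω) (M : Ω → Matrix (Fin N) (Fin N) ℝ) :
    Matrix (Fin N) (Fin N) ℝ :=
  Matrix.of fun i j => ∫ ω, M ω i j ∂μ

/-- The projection matrix `I - 1 1ᵀ / N`. -/
def centering (N : ℕ) : Matrix (Fin N) (Fin N) ℝ :=
  1 - (N : ℝ)⁻¹ • Matrix.of fun _ _ => 1

/-- Spectral norm of `𝔼(Wᵀ (I - 1 1ᵀ / N) W)`. -/
def gossipNorm {N : ℕ} (μ : Measure Ω) (M : Ω → Matrix (Fin N) (Fin N) ℝ) : ℝ :=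
  ‖Matrix.toEuclideanCLM (𝕜 := ℝ) (n := Fin N)
    (expect μ fun ω => (M ω)ᵀ * centering N * M ω)‖

/-- The σ-field generated by the random initial estimates and by `W 1, …, W n`. -/
@[reducible] def past {N : ℕ} (W : ℕ → Ω → Matrix (Fin N) (Fin N) ℝ) (θ₀ : Ω → Fin N → Powers N) (n : ℕ) :
    MeasurableSpace Ω :=
  MeasurableSpace.comap θ₀ inferInstance ⊔
    ⨆ k ∈ Finset.Icc 1 n,
      MeasurableSpace.comap (fun ω (i j : Fin N) => W k ω i j) inferInstance

/-- Assumptions on the random gossip matrices `W 1, W 2, …`. -/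
structure GossipAssumptions {N : ℕ} (μ : Measure Ω) (W : ℕ → Ω → Matrix (Fin N) (Fin N) ℝ)
    (θ₀ : Ω → Fin N → Powers N) : Prop where
  measurable : ∀ n, 1 ≤ n → ∀ i j, Measurable fun ω => W n ω i j
  nonneg : ∀ n, 1 ≤ n → ∀ᵐ ω ∂μ, ∀ i j, 0 ≤ W n ω i j
  row_stochastic : ∀ n, 1 ≤ n → ∀ᵐ ω ∂μ, ∀ i, ∑ j, W n ω i j = 1
  column_stochastic_mean : ∀ n, 1 ≤ n → ∀ j, ∑ i, expect μ (W n) i j = 1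
  indep : ∀ n, 1 ≤ n → Indep
    (MeasurableSpace.comap (fun ω (i j : Fin N) => W (n + 1) ω i j) inferInstance)
    (past W θ₀ n) μ
  connectivity : Tendsto (fun n : ℕ => (n : ℝ) * (1 - gossipNorm μ (W n))) atTop atTop

/-- Assumptions on the step sizes `γ 1, γ 2, …`, relative to the spectral norms `ρ 1, ρ 2, …`. The
lower limit is taken in the extended reals, since the ratio may tend to infinity. -/
structure StepAssumptions (γ ρ : ℕ → ℝ) : Prop where
  pos : ∀ n, 1 ≤ n → 0 < γ n
  sum_infinite : Tendsto (fun n : ℕ => ∑ k ∈ Finset.Icc 1 n, γ k) atTop atTop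
  decay : ∃ α : ℝ, 1 / 2 < α ∧
    Tendsto (fun n : ℕ => (n : ℝ) ^ α * γ n) atTop (𝓝 0) ∧
    0 < liminf (fun n : ℕ => (((1 - ρ n) / ((n : ℝ) ^ α * γ n) : ℝ) : EReal)) atTop

end PowerAllocation

end

/-! The obstacle is that the own partial derivative of `errProb A σ i` tends to minus infinity as
the `i`-th power vanishes, so the objective is not even Lipschitz on the box. Two facts compensate.
The other partial derivatives are non-negative and bounded, and the singular one has a favourable
sign: a local step pushes a small own coordinate upwards. `StepBounds` isolates what is needed of
the steps, and `exists_stepBounds` verifies it.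

By Jensen and the mean column sums, a gossip step does not increase in mean a sum of one convex
function over the agents (`GossipLaw.integral_sum_convex_le`). This is used for three Lyapunov
functions. The `barrier` controls the total `push` of small coordinates: below the level `r` an
agent lifts its own coordinate faster than all other agents together lower theirs, up to the
disagreement between agents. Coupled with the contraction of the square root of `dispersion` and
weighted by `n ^ (-α)`, this makes both the pushes and the disagreement times the step size summable
in mean (`summable_of_barrier_recursion`). The `potential`, a Moreau envelope over common points
`y`, then decreases by a multiple of the step size times `gap`, up to summable errors. Finally, the
decrease of `dispersion` pays for the mean square of the `noise` that gossip adds to the average;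
the noise has zero conditional mean, so its sum converges almost surely.

Thus the average moves at speed of order `γ`, up to summable and convergent perturbations, while the
`γ`-weighted sum of its gaps is finite. Since the step sizes are not summable, every cluster point
has gap zero (`eq_zero_of_mapClusterPt`). Such a point minimises the objective plus a quadratic
centred at it. The steepness at zero forces all its coordinates to be positive, so the objective is
differentiable there and the first-order condition is the KKT condition
(`mem_kktSet_of_gap_eq_zero`). Compactness of the box turns this into convergence of the distance.
-/

noncomputable section

namespace PowerAllocation

/-! ### Gossip steps -/

section
variable {Ω : Type*} [MeasurableSpace Ω] {N : ℕ}

/-- The gossip step: agent `i` replaces its estimate by a weighted mean of all estimates. -/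
def mix (w : Fin N → Fin N → ℝ) (t : Fin N → Powers N) : Fin N → Powers N :=
  fun i => ∑ j, w i j • t j

/-- The sum of the squared distances of the estimates to their average. -/
def dispersion (t : Fin N → Powers N) : ℝ := ∑ i, ‖t i - average t‖ ^ 2

/-- Nonnegative entries and unit row sums. -/
def IsStochastic (w : Fin N → Fin N → ℝ) : Prop :=
  (∀ i j, 0 ≤ w i j) ∧ ∀ i, ∑ j, w i j = 1

lemma IsStochastic.le_one {w : Fin N → Fin N → ℝ} (h : IsStochastic w) (i j : Fin N) :
    w i j ≤ 1 := by
  rw [← h.2 i]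
  exact Finset.single_le_sum (fun k _ => h.1 i k) (Finset.mem_univ j)

/-- A random stochastic matrix whose mean is doubly stochastic. -/
structure GossipLaw (μ : Measure Ω) (w : Ω → Fin N → Fin N → ℝ) : Prop where
  measurable : Measurable w
  stochastic : ∀ᵐ ω ∂μ, IsStochastic (w ω)
  column : ∀ j, ∑ i, ∫ ω, w ω i j ∂μ = 1

lemma average_sub_const [NeZero N] (t : Fin N → Powers N) (y : Powers N) :
    average (fun i => t i - y) = average t - y := by
  have hN : (N : ℝ) ≠ 0 := Nat.cast_ne_zero.mpr (NeZero.ne N)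
  simp only [average, Finset.sum_sub_distrib, smul_sub, Finset.sum_const, Finset.card_univ,
    Fintype.card_fin]
  rw [← Nat.cast_smul_eq_nsmul ℝ, smul_smul, inv_mul_cancel₀ hN, one_smul]

lemma sum_sub_average [NeZero N] (t : Fin N → Powers N) : ∑ i, (t i - average t) = 0 := by
  have hN : (N : ℝ) ≠ 0 := Nat.cast_ne_zero.mpr (NeZero.ne N)
  have h := average_sub_const t (average t)
  rw [sub_self, average, smul_eq_zero] at h
  exact h.resolve_left (inv_ne_zero hN)

/-- The parallel axis identity. With `y` minimised out it produces the closed form of `potential`;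
with `y` the old average it separates the noise of a gossip step from the new dispersion. -/
lemma sum_norm_sub_sq [NeZero N] (t : Fin N → Powers N) (y : Powers N) :
    ∑ i, ‖t i - y‖ ^ 2 = N * ‖average t - y‖ ^ 2 + dispersion t := by
  have h : ∀ i, ‖t i - y‖ ^ 2 = ‖t i - average t‖ ^ 2
      + 2 * inner ℝ (t i - average t) (average t - y) + ‖average t - y‖ ^ 2 := by
    intro i
    rw [← norm_add_sq_real]
    congr 2
    abel
  simp only [h, Finset.sum_add_distrib, ← Finset.mul_sum, ← sum_inner, sum_sub_average,
    inner_zero_left, dispersion, Finset.sum_const, Finset.card_univ, Fintype.card_fin,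
    nsmul_eq_mul]
  ring

lemma dispersion_nonneg (t : Fin N → Powers N) : 0 ≤ dispersion t :=
  Finset.sum_nonneg fun _ _ => sq_nonneg _

lemma dispersion_le_sum_norm_sub_sq [NeZero N] (t : Fin N → Powers N) (y : Powers N) :
    dispersion t ≤ ∑ i, ‖t i - y‖ ^ 2 := by
  rw [sum_norm_sub_sq]
  have : (0 : ℝ) ≤ N * ‖average t - y‖ ^ 2 := by positivity
  linarith

lemma continuous_average : Continuous (average : (Fin N → Powers N) → Powers N) := by
  unfold average
  fun_prop

lemma continuous_dispersion : Continuous (dispersion : (Fin N → Powers N) → ℝ) := by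
  unfold dispersion
  have := continuous_average (N := N)
  fun_prop

lemma continuous_mix :
    Continuous fun x : (Fin N → Fin N → ℝ) × (Fin N → Powers N) => mix x.1 x.2 := by
  unfold mix
  fun_prop

lemma sqrt_dispersion_eq (t : Fin N → Powers N) :
    √(dispersion t) = ‖WithLp.toLp 2 (fun i => t i - average t)‖ := by
  rw [PiLp.norm_eq_of_L2]
  rfl

lemma sqrt_sum_sq_le_sum (a : Fin N → ℝ) (ha : ∀ i, 0 ≤ a i) : √(∑ i, a i ^ 2) ≤ ∑ i, a i := by
  rw [Real.sqrt_le_left (Finset.sum_nonneg fun i _ => ha i)]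
  exact Finset.sum_sq_le_sq_sum_of_nonneg fun i _ => ha i

/-- The square root of the dispersion is a seminorm, namely the Euclidean norm of the centred
family, so local displacements enter it linearly. -/
lemma sqrt_dispersion_le_add [NeZero N] (s t : Fin N → Powers N) :
    √(dispersion s) ≤ √(dispersion t) + ∑ i, ‖s i - t i‖ := by
  have h1 : √(dispersion (fun i => s i - t i)) ≤ ∑ i, ‖s i - t i‖ := by
    refine le_trans (Real.sqrt_le_sqrt (dispersion_le_sum_norm_sub_sq _ 0)) ?_
    simp only [sub_zero]
    exact sqrt_sum_sq_le_sum _ fun i => norm_nonneg _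
  have h2 : WithLp.toLp 2 (fun i => s i - average s) = WithLp.toLp 2 (fun i => t i - average t)
      + WithLp.toLp 2 (fun i => (s i - t i) - average (fun i => s i - t i)) := by
    have : average (fun i => s i - t i) = average s - average t := by
      simp [average, Finset.sum_sub_distrib, smul_sub]
    rw [this, ← WithLp.toLp_add]
    congr 1
    funext i
    simp only [Pi.add_apply]
    abel
  rw [sqrt_dispersion_eq s, h2]
  refine (norm_add_le _ _).trans ?_
  rw [← sqrt_dispersion_eq, ← sqrt_dispersion_eq (fun i => s i - t i)]
  linarith

lemma norm_sub_average_le (t : Fin N → Powers N) (i : Fin N) :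
    ‖t i - average t‖ ≤ √(dispersion t) := by
  apply Real.le_sqrt_of_sq_le
  exact Finset.single_le_sum (f := fun i => ‖t i - average t‖ ^ 2) (fun _ _ => sq_nonneg _)
    (Finset.mem_univ i)

lemma norm_average_sub_le [NeZero N] (s t : Fin N → Powers N) :
    ‖average s - average t‖ ≤ ∑ i, ‖s i - t i‖ := by
  have hN : (1 : ℝ) ≤ N := by exact_mod_cast NeZero.one_le
  have : average s - average t = (N : ℝ)⁻¹ • ∑ i, (s i - t i) := by
    simp [average, Finset.sum_sub_distrib, smul_sub]
  rw [this, norm_smul, norm_inv, Real.norm_natCast]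
  calc (N : ℝ)⁻¹ * ‖∑ i, (s i - t i)‖ ≤ 1 * ∑ i, ‖s i - t i‖ := by
        gcongr
        · exact inv_le_one_of_one_le₀ hN
        · exact norm_sum_le _ _
    _ = _ := one_mul _

lemma GossipLaw.integrable_entry {μ : Measure Ω} [IsProbabilityMeasure μ]
    {w : Ω → Fin N → Fin N → ℝ} (h : GossipLaw μ w) (i j : Fin N) :
    Integrable (fun ω => w ω i j) μ := by
  have hm : Measurable fun ω => w ω i j := (measurable_pi_apply j).comp
    ((measurable_pi_apply i).comp h.measurable)
  refine Integrable.of_bound hm.aestronglyMeasurable 1 ?_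
  filter_upwards [h.stochastic] with ω hω
  rw [Real.norm_of_nonneg (hω.1 i j)]
  exact hω.le_one i j

/-- A gossip step does not increase, in mean, a sum of convex functions of the estimates. -/
lemma GossipLaw.integral_sum_convex_le {μ : Measure Ω} [IsProbabilityMeasure μ]
    {w : Ω → Fin N → Fin N → ℝ} (h : GossipLaw μ w) {ψ : Powers N → ℝ}
    (hψ : ConvexOn ℝ Set.univ ψ) (hψ0 : ∀ x, 0 ≤ ψ x) (t : Fin N → Powers N) :
    ∫ ω, ∑ i, ψ (mix (w ω) t i) ∂μ ≤ ∑ j, ψ (t j) := by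
  -- Jensen uses the unit row sums for almost every matrix. The column sums are needed only in mean,
  -- because the resulting bound is linear in the entries.
  have hint : ∀ i j, Integrable (fun ω => w ω i j * ψ (t j)) μ := fun i j =>
    (h.integrable_entry i j).mul_const _
  have h2 : ∫ ω, ∑ i, ∑ j, w ω i j * ψ (t j) ∂μ = ∑ j, ψ (t j) := by
    rw [integral_finsetSum _ fun i _ => integrable_finsetSum _ fun j _ => hint i j]
    simp_rw [integral_finsetSum _ fun j _ => hint _ j, integral_mul_const]
    rw [Finset.sum_comm]
    refine Finset.sum_congr rfl fun j _ => ?_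
    rw [← Finset.sum_mul, h.column, one_mul]
  rw [← h2]
  refine integral_mono_of_nonneg (ae_of_all _ fun ω => Finset.sum_nonneg fun i _ => hψ0 _)
    (integrable_finsetSum _ fun i _ => integrable_finsetSum _ fun j _ => hint i j) ?_
  filter_upwards [h.stochastic] with ω hω
  refine Finset.sum_le_sum fun i _ => ?_
  have := hψ.map_sum_le (t := Finset.univ) (w := fun j => w ω i j) (p := t)
    (fun j _ => hω.1 i j) (hω.2 i) (fun _ _ => Set.mem_univ _)
  simpa [mix, smul_eq_mul] using this

lemma convexOn_norm_sub_sq (y : Powers N) :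
    ConvexOn ℝ Set.univ fun x : Powers N => ‖x - y‖ ^ 2 := by
  have h1 : ConvexOn ℝ Set.univ fun x : Powers N => ‖x - y‖ := by
    simpa [dist_eq_norm] using convexOn_univ_dist y
  exact h1.pow (fun _ _ => norm_nonneg _) 2

/-- The dispersion lost in a gossip step dominates the mean square displacement of the average. -/
lemma GossipLaw.integral_dispersion_add_le [NeZero N] {μ : Measure Ω} [IsProbabilityMeasure μ]
    {w : Ω → Fin N → Fin N → ℝ} (h : GossipLaw μ w) (t : Fin N → Powers N) :
    ∫ ω, (N * ‖average (mix (w ω) t) - average t‖ ^ 2 + dispersion (mix (w ω) t)) ∂μ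
      ≤ dispersion t := by
  simp_rw [← sum_norm_sub_sq]
  exact h.integral_sum_convex_le (convexOn_norm_sub_sq (average t)) (fun _ => sq_nonneg _) t

/-! ### Contraction of the dispersion under gossip. -/

lemma mix_sub_average_mix [NeZero N] {w : Fin N → Fin N → ℝ} (hw : IsStochastic w)
    (t : Fin N → Powers N) (y : Powers N) (i : Fin N) :
    mix w t i - average (mix w t)
      = mix w (fun j => t j - y) i - average (mix w (fun j => t j - y)) := by
  have : mix w (fun j => t j - y) = fun i => mix w t i - y := by
    funext i
    simp [mix, smul_sub, Finset.sum_sub_distrib, ← Finset.sum_smul, hw.2 i]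
  rw [this, average_sub_const, sub_sub_sub_cancel_right]

/-- The centering matrix is an orthogonal projection, so its quadratic form is the squared norm of
the centred vector. -/
lemma sum_sub_mean_sq [NeZero N] (v : Fin N → ℝ) :
    ∑ i, (v i - (N : ℝ)⁻¹ * ∑ j, v j) ^ 2 = v ⬝ᵥ (centering N *ᵥ v) := by
  have hN : (N : ℝ) ≠ 0 := Nat.cast_ne_zero.mpr (NeZero.ne N)
  have hc : centering N *ᵥ v = fun i => v i - (N : ℝ)⁻¹ * ∑ j, v j := by
    funext i
    simp [centering, Matrix.mulVec, dotProduct, sub_mul, Finset.sum_sub_distrib, Matrix.one_apply,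
      Finset.mul_sum]
  rw [hc]
  set m := (N : ℝ)⁻¹ * ∑ j, v j with hm
  have hs : ∑ i, (v i - m) = 0 := by
    rw [Finset.sum_sub_distrib, Finset.sum_const, Finset.card_univ, Fintype.card_fin,
      nsmul_eq_mul, hm]
    field_simp
    ring
  calc ∑ i, (v i - m) ^ 2 = ∑ i, (v i * (v i - m) - m * (v i - m)) :=
        Finset.sum_congr rfl fun i _ => by ring
    _ = _ := by
        rw [Finset.sum_sub_distrib, ← Finset.mul_sum, hs]
        simp [dotProduct]

/-- Unit row sums make the left side invariant under translating `t`, so `t` may be centred first;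
the coordinates `k` then decouple into copies of one quadratic form. Being linear in the random
matrix, this form allows the expectation to be taken inside. -/
lemma dispersion_mix_eq [NeZero N] {w : Fin N → Fin N → ℝ} (hw : IsStochastic w)
    (t : Fin N → Powers N) :
    dispersion (mix w t) = ∑ k, ∑ a, ∑ b, (t a - average t) k *
      ((Matrix.of w)ᵀ * centering N * Matrix.of w) a b * (t b - average t) k := by
  set d : Fin N → Powers N := fun j => t j - average t with hd
  have h1 : dispersion (mix w t) = ∑ k, ∑ i, (mix w d i - average (mix w d)) k ^ 2 := by
    rw [dispersion, Finset.sum_comm]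
    refine Finset.sum_congr rfl fun i _ => ?_
    rw [mix_sub_average_mix hw t (average t) i, EuclideanSpace.norm_sq_eq]
    simp [hd]
  rw [h1]
  refine Finset.sum_congr rfl fun k _ => ?_
  have h2 : ∀ i, (mix w d i - average (mix w d)) k
      = (Matrix.of w *ᵥ fun j => d j k) i - (N : ℝ)⁻¹ * ∑ j, (Matrix.of w *ᵥ fun j => d j k) j := by
    intro i
    simp [mix, average, Matrix.mulVec, dotProduct]
  simp_rw [h2]
  rw [sum_sub_mean_sq, Matrix.mulVec_mulVec, ← Matrix.vecMul_transpose, ← Matrix.dotProduct_mulVec,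
    Matrix.mulVec_mulVec, ← Matrix.mul_assoc]
  simp only [dotProduct, Matrix.mulVec, Finset.mul_sum, mul_assoc, hd]

lemma sum_mul_mul_le_norm (E : Matrix (Fin N) (Fin N) ℝ) (u : Fin N → ℝ) :
    ∑ a, ∑ b, u a * E a b * u b
      ≤ ‖Matrix.toEuclideanCLM (𝕜 := ℝ) (n := Fin N) E‖ * ∑ a, u a ^ 2 := by
  have h1 : ∑ a, ∑ b, u a * E a b * u b
      = inner ℝ (WithLp.toLp 2 u) (Matrix.toEuclideanCLM (𝕜 := ℝ) E (WithLp.toLp 2 u)) := by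
    simp only [Matrix.toEuclideanCLM_toLp, PiLp.inner_apply, Matrix.mulVec, dotProduct,
      RCLike.inner_apply, conj_trivial, Finset.sum_mul]
    refine Finset.sum_congr rfl fun a _ => Finset.sum_congr rfl fun b _ => by ring
  have h2 : ∑ a, u a ^ 2 = ‖WithLp.toLp 2 u‖ * ‖WithLp.toLp 2 u‖ := by
    rw [← sq, EuclideanSpace.norm_sq_eq]
    simp
  rw [h1, h2, ← mul_assoc]
  refine (real_inner_le_norm _ _).trans ?_
  rw [mul_comm]
  gcongr
  exact ContinuousLinearMap.le_opNorm _ _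

/-- A gossip step contracts the mean dispersion by the factor `gossipNorm`. -/
lemma GossipLaw.integral_dispersion_le [NeZero N] {μ : Measure Ω} [IsProbabilityMeasure μ]
    {w : Ω → Fin N → Fin N → ℝ} (h : GossipLaw μ w) (t : Fin N → Powers N) :
    ∫ ω, dispersion (mix (w ω) t) ∂μ
      ≤ gossipNorm μ (fun ω => Matrix.of (w ω)) * dispersion t := by
  set M : Ω → Matrix (Fin N) (Fin N) ℝ :=
    fun ω => (Matrix.of (w ω))ᵀ * centering N * Matrix.of (w ω) with hM
  have hmeas : ∀ i j, Measurable fun ω => w ω i j := fun i j => (measurable_pi_apply j).comp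
    ((measurable_pi_apply i).comp h.measurable)
  have hint : ∀ a b, Integrable (fun ω => M ω a b) μ := by
    intro a b
    simp only [hM, Matrix.mul_apply, Matrix.transpose_apply, Matrix.of_apply]
    refine integrable_finsetSum _ fun c _ => ?_
    simp only [Finset.sum_mul]
    refine integrable_finsetSum _ fun e _ => ?_
    refine Integrable.of_bound (C := |centering N e c|) (by fun_prop) ?_
    filter_upwards [h.stochastic] with ω hω
    rw [norm_mul, norm_mul, Real.norm_of_nonneg (hω.1 _ _), Real.norm_of_nonneg (hω.1 _ _),
      Real.norm_eq_abs]
    have h1 := hω.le_one e a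
    have h2 := hω.le_one c b
    have h3 := hω.1 e a
    have h4 := hω.1 c b
    calc w ω e a * |centering N e c| * w ω c b ≤ 1 * |centering N e c| * 1 := by gcongr
      _ = _ := by ring
  have h1 : ∫ ω, dispersion (mix (w ω) t) ∂μ = ∑ k, ∑ a, ∑ b, (t a - average t) k *
      expect μ M a b * (t b - average t) k := by
    have : ∀ᵐ ω ∂μ, dispersion (mix (w ω) t) = ∑ k, ∑ a, ∑ b, (t a - average t) k *
        M ω a b * (t b - average t) k := by
      filter_upwards [h.stochastic] with ω hω
      exact dispersion_mix_eq hω t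
    rw [integral_congr_ae this]
    have hi : ∀ k a b, Integrable (fun ω => (t a - average t) k * M ω a b * (t b - average t) k) μ :=
      fun k a b => ((hint a b).const_mul _).mul_const _
    rw [integral_finsetSum _ fun k _ => integrable_finsetSum _ fun a _ =>
      integrable_finsetSum _ fun b _ => hi k a b]
    refine Finset.sum_congr rfl fun k _ => ?_
    rw [integral_finsetSum _ fun a _ => integrable_finsetSum _ fun b _ => hi k a b]
    refine Finset.sum_congr rfl fun a _ => ?_
    rw [integral_finsetSum _ fun b _ => hi k a b]
    refine Finset.sum_congr rfl fun b _ => ?_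
    rw [integral_mul_const, integral_const_mul]
    rfl
  rw [h1]
  have h2 : dispersion t = ∑ k, ∑ a, (t a - average t) k ^ 2 := by
    rw [dispersion, Finset.sum_comm]
    refine Finset.sum_congr rfl fun i _ => ?_
    rw [EuclideanSpace.norm_sq_eq]
    simp
  rw [h2, Finset.mul_sum]
  exact Finset.sum_le_sum fun k _ => sum_mul_mul_le_norm (expect μ M) fun a => (t a - average t) k

lemma gossipNorm_nonneg (μ : Measure Ω) (M : Ω → Matrix (Fin N) (Fin N) ℝ) :
    0 ≤ gossipNorm μ M := norm_nonneg _

/-- Square-root version of `GossipLaw.integral_dispersion_le`. -/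
lemma GossipLaw.integral_sqrt_dispersion_le [NeZero N] {μ : Measure Ω} [IsProbabilityMeasure μ]
    {w : Ω → Fin N → Fin N → ℝ} (h : GossipLaw μ w) (t : Fin N → Powers N)
    (hint : Integrable (fun ω => dispersion (mix (w ω) t)) μ) :
    ∫ ω, √(dispersion (mix (w ω) t)) ∂μ
      ≤ (1 + gossipNorm μ (fun ω => Matrix.of (w ω))) / 2 * √(dispersion t) := by
  set ρ := gossipNorm μ (fun ω => Matrix.of (w ω)) with hρ
  have hρ0 : 0 ≤ ρ := gossipNorm_nonneg _ _
  rcases eq_or_ne (dispersion t) 0 with h0 | h0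
  · have h1 := h.integral_dispersion_le t
    rw [h0, mul_zero] at h1
    have h2 : ∫ ω, dispersion (mix (w ω) t) ∂μ = 0 :=
      le_antisymm h1 (integral_nonneg fun ω => dispersion_nonneg _)
    rw [integral_eq_zero_iff_of_nonneg (fun ω => dispersion_nonneg _) hint] at h2
    have h3 : (fun ω => √(dispersion (mix (w ω) t))) =ᵐ[μ] 0 := by
      filter_upwards [h2] with ω hω
      simp only [Pi.zero_apply] at hω ⊢
      rw [hω, Real.sqrt_zero]
    rw [integral_congr_ae h3, h0]
    simp
  · have hp : 0 < √(dispersion t) := Real.sqrt_pos.mpr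
      (lt_of_le_of_ne (dispersion_nonneg t) (Ne.symm h0))
    set p := √(dispersion t) with hpdef
    have hp2 : p ^ 2 = dispersion t := Real.sq_sqrt (dispersion_nonneg t)
    -- The concave square root lies below its tangent at `p ^ 2`. This yields the factor `(1 + ρ) /
    -- 2`, which exceeds the square root of `ρ` but keeps a contraction rate proportional to `1 -
    -- ρ`.
    have hb : ∀ ω, √(dispersion (mix (w ω) t)) ≤ (dispersion (mix (w ω) t)) / (2 * p) + p / 2 := by
      intro ω
      have hs := Real.sq_sqrt (dispersion_nonneg (mix (w ω) t))
      rw [← sub_nonneg]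
      have : dispersion (mix (w ω) t) / (2 * p) + p / 2 - √(dispersion (mix (w ω) t))
          = (√(dispersion (mix (w ω) t)) - p) ^ 2 / (2 * p) := by
        rw [sub_sq, hs]
        field_simp
        ring
      rw [this]
      positivity
    calc ∫ ω, √(dispersion (mix (w ω) t)) ∂μ
        ≤ ∫ ω, ((dispersion (mix (w ω) t)) / (2 * p) + p / 2) ∂μ :=
          integral_mono_of_nonneg (ae_of_all _ fun ω => Real.sqrt_nonneg _)
            ((hint.div_const _).add (integrable_const _)) (ae_of_all _ hb)
      _ = (∫ ω, dispersion (mix (w ω) t) ∂μ) / (2 * p) + p / 2 := by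
          rw [integral_add (hint.div_const _) (integrable_const _), integral_div]
          simp
      _ ≤ (ρ * p ^ 2) / (2 * p) + p / 2 := by
          gcongr
          rw [hp2]
          exact h.integral_dispersion_le t
      _ = _ := by
          field_simp
          ring

end

/-! ### One round of local steps -/

section
variable {N : ℕ}

lemma norm_le_sum_abs (v : Powers N) : ‖v‖ ≤ ∑ k, |v k| := by
  rw [EuclideanSpace.norm_eq]
  simpa using sqrt_sum_sq_le_sum (fun k => |v k|) fun k => abs_nonneg _

lemma isCompact_powerBox (P : Fin N → ℝ) : IsCompact (powerBox P) := by
  have : powerBox P = (EuclideanSpace.equiv (Fin N) ℝ).toHomeomorph ⁻¹' (Set.Icc 0 P) := by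
    ext x
    simp [powerBox, Pi.le_def, forall_and]
  rw [this, Homeomorph.isCompact_preimage]
  exact isCompact_Icc

lemma convex_powerBox (P : Fin N → ℝ) : Convex ℝ (powerBox P) := by
  intro x hx y hy a b ha hb hab i
  simp only [PiLp.add_apply, PiLp.smul_apply, smul_eq_mul]
  constructor
  · have := (hx i).1
    have := (hy i).1
    positivity
  · calc a * x i + b * y i ≤ a * P i + b * P i := by
          gcongr
          · exact (hx i).2
          · exact (hy i).2
      _ = P i := by rw [← add_mul, hab, one_mul]

lemma mix_mem_powerBox {P : Fin N → ℝ} {w : Fin N → Fin N → ℝ} (hw : IsStochastic w)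
    {t : Fin N → Powers N} (ht : ∀ i, t i ∈ powerBox P) (i : Fin N) : mix w t i ∈ powerBox P :=
  (convex_powerBox P).sum_mem (fun j _ => hw.1 i j) (hw.2 i) fun j _ => ht j

lemma average_mem_powerBox [NeZero N] {P : Fin N → ℝ} {t : Fin N → Powers N}
    (ht : ∀ i, t i ∈ powerBox P) : average t ∈ powerBox P := by
  have hN : (N : ℝ) ≠ 0 := Nat.cast_ne_zero.mpr (NeZero.ne N)
  rw [average, Finset.smul_sum]
  refine (convex_powerBox P).sum_mem (fun _ _ => by positivity) ?_ fun j _ => ht j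
  simp [hN]

lemma exists_norm_sub_le_of_powerBox (P : Fin N → ℝ) :
    ∃ R, 0 ≤ R ∧ ∀ x ∈ powerBox P, ∀ y ∈ powerBox P, ‖x - y‖ ≤ R := by
  obtain ⟨R, hR⟩ := (isCompact_powerBox P).isBounded.exists_norm_le
  refine ⟨|R| + |R|, by positivity, fun x hx y hy => (norm_sub_le _ _).trans ?_⟩
  exact add_le_add ((hR x hx).trans (le_abs_self R)) ((hR y hy).trans (le_abs_self R))

/-- All agents perform their local step. -/
def stepAll (step : ℝ → Fin N → Powers N → Powers N) (c : ℝ) (t : Fin N → Powers N) :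
    Fin N → Powers N := fun i => step c i (t i)

/-- Total displacement of the own coordinates of those agents whose own coordinate is small. -/
def push (step : ℝ → Fin N → Powers N → Powers N) (r c : ℝ) (t : Fin N → Powers N) : ℝ :=
  ∑ i, if t i i ≤ r / 2 then step c i (t i) i - t i i else 0

/-- A convex penalty for coordinates below the level `r`. -/
def barrier (r : ℝ) (t : Fin N → Powers N) : ℝ := ∑ i, ∑ j, max (r - t j i) 0 ^ 2

/-- Properties of local steps that push the own coordinate of an agent upwards, at a rate at least
`M` below the level `r`, move the other coordinates at a rate at most `C`, and behave like projected
gradient steps for `f i` above the level `r / 2`. -/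
structure StepBounds (P : Fin N → ℝ) (f : Fin N → Powers N → ℝ)
    (step : ℝ → Fin N → Powers N → Powers N) (r M C L κ : ℝ) : Prop where
  r_pos : 0 < r
  r_le : ∀ i, r ≤ P i
  C_nonneg : 0 ≤ C
  M_pos : 0 < M
  M_ge : 4 * N * C ≤ M
  L_nonneg : 0 ≤ L
  κ_pos : 0 < κ
  f_nonneg : ∀ i x, 0 ≤ f i x
  f_cont : ∀ i, ContinuousOn (f i) (powerBox P)
  mem : ∀ c i x, x ∈ powerBox P → step c i x ∈ powerBox P
  other_ge : ∀ c i x k, 0 < c → x ∈ powerBox P → k ≠ i → x k - c * C ≤ step c i x k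
  other_le : ∀ c i x k, 0 < c → x ∈ powerBox P → k ≠ i → step c i x k ≤ x k
  own_ge : ∀ c i x, 0 < c → x ∈ powerBox P → x i ≤ step c i x i
  own_push : ∀ c i x, 0 < c → x ∈ powerBox P → x i ≤ r → min r (x i + c * M) ≤ step c i x i
  own_le : ∀ c i x, 0 < c → x ∈ powerBox P → r / 2 ≤ x i → step c i x i ≤ x i + c * L
  descent : ∀ c i x y, 0 < c → x ∈ powerBox P → y ∈ powerBox P → r / 2 ≤ x i →
    ‖step c i x - y‖ ^ 2 ≤ ‖x - y‖ ^ 2 - 2 * c * (f i x - f i y) + 2 * c * κ * ‖x - y‖ ^ 2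
      + c ^ 2 * L
  lipschitz : ∀ i x y, x ∈ powerBox P → y ∈ powerBox P → r / 2 ≤ x i → r / (2 * N) ≤ y i →
    f i y ≤ f i x + L * ‖x - y‖

/-! ### The barrier against small coordinates. -/

lemma barrier_nonneg (r : ℝ) (t : Fin N → Powers N) : 0 ≤ barrier r t :=
  Finset.sum_nonneg fun _ _ => Finset.sum_nonneg fun _ _ => sq_nonneg _

lemma continuous_barrier (r : ℝ) : Continuous (barrier r : (Fin N → Powers N) → ℝ) := by
  unfold barrier
  fun_prop

/-- With deficit `u` and effective rise `τ ≤ u`, the squared deficit drops by at least `u * τ`, as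
`(u - τ) ^ 2 ≤ u ^ 2 - u * τ`. One half of this pays for the downward drift of the copies of the
coordinate held by the other agents (the second term on the left), the other half pays for the push.
-/
lemma own_barrier_le {r B a a' c C M n : ℝ} (hr : 0 < r) (hrB : r ≤ B) (hc : 0 < c) (hC : 0 ≤ C)
    (hn : 0 ≤ n) (hM : 4 * n * C ≤ M) (hM0 : 0 < M) (ha : 0 ≤ a) (ha' : a' ≤ B) (haa : a ≤ a')
    (hpush : a ≤ r → min r (a + c * M) ≤ a') :
    max (r - a') 0 ^ 2 + 2 * n * c * C * max (r - a) 0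
      ≤ max (r - a) 0 ^ 2 - r ^ 2 / (8 * B) * (if a ≤ r / 2 then a' - a else 0)
        + 2 * n * C * M * c ^ 2 := by
  have hK : 0 ≤ 2 * n * C * M * c ^ 2 := by positivity
  rcases lt_or_ge r a with h | h
  · rw [max_eq_right (by linarith), max_eq_right (by linarith), if_neg (by linarith)]
    simpa using hK
  · have hp := hpush h
    rw [max_eq_left (by linarith : 0 ≤ r - a)]
    set u := r - a with hu
    have hu0 : 0 ≤ u := by linarith
    set τ := min (a' - a) u with hτ
    have hτ0 : 0 ≤ τ := le_min (by linarith) hu0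
    have hτu : τ ≤ u := min_le_right _ _
    have h1 : max (r - a') 0 = u - τ := by
      rcases le_total (a' - a) u with h' | h'
      · rw [hτ, min_eq_left h', max_eq_left (by linarith)]
        linarith
      · rw [hτ, min_eq_right h', max_eq_right (by linarith)]
        linarith
    -- Either the step realises a rise of at least `c * M`, which beats the drift because `4 * n * C
    -- ≤ M`, or the deficit is below `c * M` and the drift is of second order in `c`.
    have h2 : 2 * n * c * C * u ≤ u * τ / 2 + 2 * n * C * M * c ^ 2 := by
      rcases le_total (c * M) u with h' | h'
      · have h3 : c * M ≤ τ := by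
          refine le_min ?_ h'
          rw [min_eq_right (by linarith)] at hp
          linarith
        have h4 : u * (c * (4 * n * C)) ≤ u * τ :=
          mul_le_mul_of_nonneg_left ((mul_le_mul_of_nonneg_left hM hc.le).trans h3) hu0
        nlinarith
      · have h3 : 2 * n * c * C * u ≤ 2 * n * c * C * (c * M) := by gcongr
        have h4 : 0 ≤ u * τ := by positivity
        nlinarith
    have hB : 0 < B := by linarith
    -- Below `r / 2` the deficit is at least `r / 2`. The true rise is at most `B`, so truncating it
    -- at `u` loses at most the factor `r / (2 * B)`.
    have h5 : r ^ 2 / (8 * B) * (if a ≤ r / 2 then a' - a else 0) ≤ u * τ / 2 := by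
      split_ifs with h'
      · have hur : r / 2 ≤ u := by linarith
        have hy : 0 ≤ a' - a := by linarith
        have h6 : (a' - a) * (r / (2 * B)) ≤ τ := by
          refine le_min ?_ ?_
          · have : r / (2 * B) ≤ 1 := by
              rw [div_le_one (by positivity)]
              linarith
            nlinarith
          · refine le_trans ?_ hur
            calc (a' - a) * (r / (2 * B)) ≤ B * (r / (2 * B)) := by
                  gcongr
                  linarith
              _ = r / 2 := by field_simp
        calc r ^ 2 / (8 * B) * (a' - a) = (r / 2) * ((a' - a) * (r / (2 * B))) / 2 := by
              field_simp
              ring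
          _ ≤ u * τ / 2 := by gcongr
      · rw [mul_zero]
        positivity
    rw [h1]
    nlinarith [mul_nonneg hτ0 (sub_nonneg.mpr hτu)]

section
variable {P : Fin N → ℝ} {f : Fin N → Powers N → ℝ} {step : ℝ → Fin N → Powers N → Powers N}
  {r M C L κ : ℝ}

lemma StepBounds.push_nonneg (h : StepBounds P f step r M C L κ) {c : ℝ} (hc : 0 < c)
    {t : Fin N → Powers N} (ht : ∀ i, t i ∈ powerBox P) : 0 ≤ push step r c t := by
  refine Finset.sum_nonneg fun i _ => ?_
  split_ifs
  · linarith [h.own_ge c i (t i) hc (ht i)]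
  · exact le_rfl

/-- Every coordinate moves by a multiple of the step size, except the own coordinate of an agent
below `r / 2`, where the gradient is unbounded; `push` records exactly that motion. -/
lemma StepBounds.sum_norm_step_sub_le (h : StepBounds P f step r M C L κ) :
    ∃ D, 0 ≤ D ∧ ∀ c t, 0 < c → (∀ i, t i ∈ powerBox P) →
      ∑ i, ‖stepAll step c t i - t i‖ ≤ D * (c + push step r c t) := by
  refine ⟨1 + ∑ _i : Fin N, ∑ _k : Fin N, (C + L), ?_, fun c t hc ht => ?_⟩
  · have := h.C_nonneg
    have := h.L_nonneg
    positivity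
  have hz := h.push_nonneg hc ht
  have h1 : ∑ i, ‖stepAll step c t i - t i‖
      ≤ ∑ i, ((if t i i ≤ r / 2 then step c i (t i) i - t i i else 0)
        + ∑ _k : Fin N, (C + L) * c) := by
    refine Finset.sum_le_sum fun i _ => (norm_le_sum_abs _).trans ?_
    have hterm : ∀ k, |(stepAll step c t i - t i) k| ≤
        (if k = i then (if t i i ≤ r / 2 then step c i (t i) i - t i i else 0) else 0)
          + (C + L) * c := by
      intro k
      have hCc : 0 ≤ C * c := mul_nonneg h.C_nonneg hc.le
      have hLc : 0 ≤ L * c := mul_nonneg h.L_nonneg hc.le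
      simp only [stepAll, PiLp.sub_apply]
      by_cases hk : k = i
      · subst hk
        have h0 := h.own_ge c k (t k) hc (ht k)
        rw [if_pos rfl, abs_of_nonneg (by linarith)]
        split_ifs with h2
        · linarith
        · have := h.own_le c k (t k) hc (ht k) (by linarith)
          linarith
      · have h0 := h.other_ge c i (t i) k hc (ht i) hk
        have h2 := h.other_le c i (t i) k hc (ht i) hk
        rw [if_neg hk, abs_of_nonpos (by linarith)]
        linarith
    refine (Finset.sum_le_sum fun k _ => hterm k).trans ?_
    rw [Finset.sum_add_distrib, Finset.sum_ite_eq' Finset.univ i]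
    simp
  refine h1.trans ?_
  rw [Finset.sum_add_distrib]
  simp only [← Finset.sum_mul]
  set S := ∑ _i : Fin N, ∑ _k : Fin N, (C + L)
  have hS : 0 ≤ S := by
    have := h.C_nonneg
    have := h.L_nonneg
    positivity
  change push step r c t + S * c ≤ (1 + S) * (c + push step r c t)
  nlinarith [mul_nonneg hS hz]

/-- An agent below `r / 2` rises by at least the smaller of `r / 2` and `c * M`. Hence in a round
with such an agent any error of order `c` can be charged to the push. -/
lemma StepBounds.step_size_le_push (h : StepBounds P f step r M C L κ) :
    ∃ D, 0 ≤ D ∧ ∀ c t, 0 < c → c ≤ 1 → (∀ i, t i ∈ powerBox P) → (∃ i, t i i ≤ r / 2) →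
      c ≤ D * push step r c t := by
  have hr := h.r_pos
  have hM := h.M_pos
  have hm : 0 < min (r / 2) M := lt_min (by linarith) hM
  refine ⟨(min (r / 2) M)⁻¹, by positivity, fun c t hc hc1 ht ⟨i, hi⟩ => ?_⟩
  rw [inv_mul_eq_div, le_div_iff₀ hm]
  have h1 : step c i (t i) i - t i i ≤ push step r c t := by
    have := Finset.single_le_sum (s := Finset.univ)
      (f := fun i => if t i i ≤ r / 2 then step c i (t i) i - t i i else 0) (fun j _ => ?_)
      (Finset.mem_univ i)
    · simp only [hi, if_true] at this
      exact this
    · dsimp only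
      split_ifs
      · linarith [h.own_ge c j (t j) hc (ht j)]
      · exact le_rfl
  refine le_trans ?_ h1
  have h2 := h.own_push c i (t i) hc (ht i) (by linarith)
  have h3 : c * min (r / 2) M ≤ min r (t i i + c * M) - t i i := by
    rw [le_sub_iff_add_le, le_min_iff]
    constructor
    · have : c * min (r / 2) M ≤ 1 * (r / 2) := by
        gcongr
        exact min_le_left _ _
      linarith
    · have : c * min (r / 2) M ≤ c * M := by
        gcongr
        exact min_le_right _ _
      linarith
  linarith

/-- For each coordinate `i`, the gain of its owner outweighs the losses of the other agents. The
owner's deficit stands in for theirs, at the price of twice the square root of the dispersion, which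
is the source of the last error term. -/
lemma StepBounds.barrier_step_le (h : StepBounds P f step r M C L κ) :
    ∃ c₀ D, 0 < c₀ ∧ 0 ≤ D ∧ ∀ c t, 0 < c → (∀ i, t i ∈ powerBox P) →
      barrier r (stepAll step c t) ≤ barrier r t - c₀ * push step r c t
        + D * c ^ 2 + D * (c * √(dispersion t)) := by
  have hr := h.r_pos
  have hC := h.C_nonneg
  have hM := h.M_pos
  obtain ⟨B, hB, hPB⟩ : ∃ B, r ≤ B ∧ ∀ i, P i ≤ B := by
    refine ⟨max r (∑ i, P i), le_max_left _ _, fun i => ?_⟩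
    refine le_trans ?_ (le_max_right _ _)
    exact Finset.single_le_sum (fun j _ => hr.le.trans (h.r_le j)) (Finset.mem_univ i)
  have hB0 : 0 < B := by linarith
  set n : ℝ := (N : ℝ)
  have hn : 0 ≤ n := Nat.cast_nonneg N
  refine ⟨r ^ 2 / (8 * B), n * (n * C ^ 2 + 2 * n * C * M) + 4 * n * n * C, by positivity,
    by positivity, fun c t hc ht => ?_⟩
  set p := √(dispersion t)
  have hp : 0 ≤ p := Real.sqrt_nonneg _
  have key : ∀ i, ∑ j, max (r - stepAll step c t j i) 0 ^ 2
      ≤ ∑ j, max (r - t j i) 0 ^ 2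
        - r ^ 2 / (8 * B) * (if t i i ≤ r / 2 then step c i (t i) i - t i i else 0)
        + (n * C ^ 2 + 2 * n * C * M) * c ^ 2 + 4 * n * C * (c * p) := by
    intro i
    have hown := own_barrier_le (r := r) (B := B) (a := t i i) (a' := step c i (t i) i) (c := c)
      (C := C) (M := M) (n := n) hr hB hc hC hn h.M_ge hM (ht i i).1
      ((h.mem c i (t i) (ht i) i).2.trans (hPB i)) (h.own_ge c i (t i) hc (ht i))
      (h.own_push c i (t i) hc (ht i))
    have hoth : ∀ j ∈ Finset.univ.erase i, max (r - stepAll step c t j i) 0 ^ 2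
        ≤ max (r - t j i) 0 ^ 2 + (2 * c * C * max (r - t i i) 0 + 4 * c * C * p
          + c ^ 2 * C ^ 2) := by
      intro j hj
      have hji : i ≠ j := (Finset.ne_of_mem_erase hj).symm
      have h1 := h.other_ge c j (t j) i hc (ht j) hji
      have hd : |t j i - t i i| ≤ 2 * p := by
        have e1 : |(t j - average t) i| ≤ p := by
          rw [← Real.norm_eq_abs]
          exact (PiLp.norm_apply_le _ i).trans (norm_sub_average_le t j)
        have e2 : |(t i - average t) i| ≤ p := by
          rw [← Real.norm_eq_abs]
          exact (PiLp.norm_apply_le _ i).trans (norm_sub_average_le t i)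
        simp only [PiLp.sub_apply] at e1 e2
        rw [abs_le] at *
        constructor <;> linarith [e1.1, e1.2, e2.1, e2.2]
      have h2 : max (r - t j i) 0 ≤ max (r - t i i) 0 + 2 * p := by
        refine max_le ?_ (by positivity)
        linarith [le_max_left (r - t i i) 0, (abs_le.mp hd).1]
      have hCc : 0 ≤ c * C := by positivity
      have h3 : max (r - stepAll step c t j i) 0 ≤ max (r - t j i) 0 + c * C := by
        refine max_le ?_ (by positivity)
        simp only [stepAll]
        linarith [le_max_left (r - t j i) 0]
      have h4 : max (r - stepAll step c t j i) 0 ^ 2 ≤ (max (r - t j i) 0 + c * C) ^ 2 := by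
        gcongr
      nlinarith [mul_le_mul_of_nonneg_left h2 hCc]
    rw [← Finset.add_sum_erase _ _ (Finset.mem_univ i), ← Finset.add_sum_erase _ _ (Finset.mem_univ i)]
    have hsum := Finset.sum_le_sum hoth
    rw [Finset.sum_add_distrib, Finset.sum_const, nsmul_eq_mul] at hsum
    have hcard : ((Finset.univ.erase i).card : ℝ) ≤ n := by
      have : (Finset.univ.erase i).card ≤ N := by
        simp
      exact Nat.cast_le.mpr this
    have hnn : 0 ≤ 2 * c * C * max (r - t i i) 0 + 4 * c * C * p + c ^ 2 * C ^ 2 := by positivity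
    have := mul_le_mul_of_nonneg_right hcard hnn
    have e : stepAll step c t i i = step c i (t i) i := rfl
    rw [e]
    nlinarith
  have hsum := Finset.sum_le_sum fun i (_ : i ∈ Finset.univ) => key i
  simp only [Finset.sum_add_distrib, Finset.sum_sub_distrib, Finset.sum_const, Finset.card_univ,
    Fintype.card_fin, nsmul_eq_mul, ← Finset.mul_sum] at hsum
  change barrier r (stepAll step c t) ≤ barrier r t - r ^ 2 / (8 * B) * push step r c t
    + n * ((n * C ^ 2 + 2 * n * C * M) * c ^ 2) + n * (4 * n * C * (c * p)) at hsum
  have e1 : 0 ≤ 4 * n * n * C * c ^ 2 := by positivity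
  have e2 : 0 ≤ n * (n * C ^ 2 + 2 * n * C * M) * (c * p) := by positivity
  nlinarith

/-! ### The proximal envelope of the objective -/

/-- The Moreau envelope, over the box, of the sum of the functions `f i`. -/
def envelope (P : Fin N → ℝ) (f : Fin N → Powers N → ℝ) (κ : ℝ) (x : Powers N) : ℝ :=
  sInf ((fun y : powerBox P => ∑ i, f i y + κ * N * ‖x - y‖ ^ 2) '' Set.univ)

/-- The gap between the objective and its envelope, a measure of non-stationarity. -/
def gap (P : Fin N → ℝ) (f : Fin N → Powers N → ℝ) (κ : ℝ) (x : Powers N) : ℝ :=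
  ∑ i, f i x - envelope P f κ x

/-- The minimum over `y` of `∑ i, f i y + κ ∑ i, ‖t i - y‖²`. -/
def potential (P : Fin N → ℝ) (f : Fin N → Powers N → ℝ) (κ : ℝ) (t : Fin N → Powers N) : ℝ :=
  envelope P f κ (average t) + κ * dispersion t

lemma envelope_le (hf0 : ∀ i x, 0 ≤ f i x) (hκ : 0 ≤ κ) (x : Powers N) {y : Powers N}
    (hy : y ∈ powerBox P) : envelope P f κ x ≤ ∑ i, f i y + κ * N * ‖x - y‖ ^ 2 := by
  refine csInf_le ⟨0, ?_⟩ ⟨⟨y, hy⟩, trivial, rfl⟩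
  rintro _ ⟨z, -, rfl⟩
  have := Finset.sum_nonneg fun i (_ : i ∈ Finset.univ) => hf0 i z
  dsimp only
  positivity

lemma exists_envelope_eq (hP : ∀ i, 0 ≤ P i) (hf : ∀ i, ContinuousOn (f i) (powerBox P))
    (x : Powers N) :
    ∃ y ∈ powerBox P, envelope P f κ x = ∑ i, f i y + κ * N * ‖x - y‖ ^ 2 := by
  have : CompactSpace (powerBox P) := isCompact_iff_compactSpace.mp (isCompact_powerBox P)
  have hne : Nonempty (powerBox P) := ⟨⟨0, fun i => ⟨le_rfl, hP i⟩⟩⟩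
  have hc : ∀ i, Continuous fun y : powerBox P => f i y := fun i =>
    continuousOn_iff_continuous_domRestrict.mp (hf i)
  obtain ⟨y, -, hy⟩ := (isCompact_univ (X := powerBox P)).exists_sInf_image_eq
    Set.univ_nonempty (f := fun y : powerBox P => ∑ i, f i y + κ * N * ‖x - y‖ ^ 2)
    ((continuous_finsetSum _ fun i _ => hc i).add (by fun_prop)).continuousOn
  exact ⟨y, y.2, hy⟩

lemma continuous_envelope (hf : ∀ i, ContinuousOn (f i) (powerBox P)) :
    Continuous (envelope P f κ) := by
  have : CompactSpace (powerBox P) := isCompact_iff_compactSpace.mp (isCompact_powerBox P)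
  have hc : ∀ i, Continuous fun y : powerBox P => f i y := fun i =>
    continuousOn_iff_continuous_domRestrict.mp (hf i)
  refine (isCompact_univ (X := powerBox P)).continuous_sInf
    (f := fun (x : Powers N) (y : powerBox P) => ∑ i, f i y + κ * N * ‖x - y‖ ^ 2) ?_
  have h1 : ∀ i, Continuous fun z : Powers N × powerBox P => f i z.2 := fun i =>
    (hc i).comp continuous_snd
  change Continuous fun z : Powers N × powerBox P => ∑ i, f i z.2 + κ * N * ‖z.1 - z.2‖ ^ 2
  exact (continuous_finsetSum _ fun i _ => h1 i).add (by fun_prop)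

lemma gap_nonneg (hf0 : ∀ i x, 0 ≤ f i x) (hκ : 0 ≤ κ) {x : Powers N} (hx : x ∈ powerBox P) :
    0 ≤ gap P f κ x := by
  have := envelope_le hf0 hκ x hx
  rw [sub_self, norm_zero] at this
  rw [gap]
  linarith

lemma envelope_nonneg (hf0 : ∀ i x, 0 ≤ f i x) (hκ : 0 ≤ κ) (x : Powers N) :
    0 ≤ envelope P f κ x := by
  refine Real.sInf_nonneg ?_
  rintro _ ⟨z, -, rfl⟩
  have := Finset.sum_nonneg fun i (_ : i ∈ Finset.univ) => hf0 i z
  dsimp only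
  positivity

lemma potential_nonneg (hf0 : ∀ i x, 0 ≤ f i x) (hκ : 0 ≤ κ) (t : Fin N → Powers N) :
    0 ≤ potential P f κ t :=
  add_nonneg (envelope_nonneg hf0 hκ _) (mul_nonneg hκ (dispersion_nonneg t))

lemma continuous_potential (hf : ∀ i, ContinuousOn (f i) (powerBox P)) :
    Continuous (potential P f κ) := by
  have := (continuous_envelope (κ := κ) hf).comp (continuous_average (N := N))
  exact this.add (continuous_const.mul continuous_dispersion)

lemma potential_le [NeZero N] (hf0 : ∀ i x, 0 ≤ f i x) (hκ : 0 ≤ κ) (t : Fin N → Powers N)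
    {y : Powers N} (hy : y ∈ powerBox P) :
    potential P f κ t ≤ ∑ i, f i y + κ * ∑ i, ‖t i - y‖ ^ 2 := by
  rw [sum_norm_sub_sq, potential]
  linarith [envelope_le (κ := κ) hf0 hκ (average t) hy]

/-- The minimisation problems behind the envelope at the average and behind the potential differ by
the constant `κ * dispersion t`, so one minimiser serves both. -/
lemma exists_potential_eq [NeZero N] (hP : ∀ i, 0 ≤ P i)
    (hf : ∀ i, ContinuousOn (f i) (powerBox P)) (t : Fin N → Powers N) :
    ∃ y ∈ powerBox P, potential P f κ t = ∑ i, f i y + κ * ∑ i, ‖t i - y‖ ^ 2 ∧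
      gap P f κ (average t) = ∑ i, f i (average t) - ∑ i, f i y - κ * N * ‖average t - y‖ ^ 2 := by
  obtain ⟨y, hy, he⟩ := exists_envelope_eq (κ := κ) hP hf (average t)
  refine ⟨y, hy, ?_, ?_⟩
  · rw [sum_norm_sub_sq, potential, he]
    ring
  · rw [gap, he]
    ring

lemma StepBounds.exists_gap_le (h : StepBounds P f step r M C L κ) :
    ∃ D, 0 ≤ D ∧ ∀ x ∈ powerBox P, gap P f κ x ≤ D := by
  have hc : ContinuousOn (gap P f κ) (powerBox P) :=
    (continuousOn_finsetSum _ fun i _ => h.f_cont i).sub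
      (continuous_envelope h.f_cont).continuousOn
  obtain ⟨D, hD⟩ := (isCompact_powerBox P).exists_bound_of_continuousOn hc
  exact ⟨|D|, abs_nonneg _, fun x hx => (le_abs_self _).trans ((hD x hx).trans (le_abs_self D))⟩

/-- The minimiser `y` for the old estimates is a competitor for the new ones, so it suffices to
compare squared distances to `y`. The quadratic loss in `descent` has the same constant `κ` as the
envelope, so the descent terms sum precisely to the gap at the average, up to disagreement. -/
lemma StepBounds.potential_step_le [NeZero N] (h : StepBounds P f step r M C L κ) :
    ∃ D, 0 ≤ D ∧ ∀ c t, 0 < c → c ≤ 1 → (∀ i, t i ∈ powerBox P) →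
      potential P f κ (stepAll step c t) ≤ potential P f κ t - 2 * κ * (c * gap P f κ (average t))
        + D * (c * √(dispersion t) + c ^ 2 + push step r c t) := by
  have hκ := h.κ_pos
  have hL := h.L_nonneg
  have hr := h.r_pos
  have hP : ∀ i, 0 ≤ P i := fun i => hr.le.trans (h.r_le i)
  obtain ⟨R, hR0, hR⟩ := exists_norm_sub_le_of_powerBox P
  obtain ⟨D₁, hD₁, hdisp⟩ := h.sum_norm_step_sub_le
  obtain ⟨D₂, hD₂, hbad⟩ := h.step_size_le_push
  obtain ⟨D₃, hD₃, hgap⟩ := h.exists_gap_le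
  set n : ℝ := (N : ℝ) with hn
  have hn0 : 0 < n := Nat.cast_pos.mpr (NeZero.pos N)
  set DA := κ * (2 * n * L + 2 * κ * (n * R) + n * L) with hDA
  set DB := κ * (2 * R * (D₁ * (D₂ + 1))) + 2 * κ * (D₂ * D₃) with hDB
  have hDA0 : 0 ≤ DA := by positivity
  have hDB0 : 0 ≤ DB := by positivity
  refine ⟨DA + DB, by positivity, fun c t hc hc1 ht => ?_⟩
  set s := stepAll step c t with hs
  set p := √(dispersion t) with hp
  have hp0 : 0 ≤ p := Real.sqrt_nonneg _
  have hz := h.push_nonneg hc ht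
  set z := push step r c t with hzdef
  obtain ⟨y, hy, hpot, hgapy⟩ := exists_potential_eq (κ := κ) hP h.f_cont t
  have hle := potential_le h.f_nonneg hκ.le s hy
  have hav := average_mem_powerBox ht
  have hcp : 0 ≤ c * p := by positivity
  have hsmem : ∀ i, s i ∈ powerBox P := fun i => h.mem c i (t i) (ht i)
  -- If some own coordinate is at most `r / 2`, no descent is claimed: the displacement and the
  -- bounded gap term are both dominated by the push. Otherwise `descent` holds for every agent.
  by_cases hb : ∃ i, t i i ≤ r / 2
  · have h1 : ∀ i, ‖s i - y‖ ^ 2 ≤ ‖t i - y‖ ^ 2 + 2 * R * ‖s i - t i‖ := by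
      intro i
      have e1 : ‖s i - y‖ ≤ ‖s i - t i‖ + ‖t i - y‖ := norm_sub_le_norm_sub_add_norm_sub _ _ _
      have e2 := hR _ (hsmem i) _ hy
      have e3 := hR _ (ht i) _ hy
      have e4 : (‖s i - y‖ - ‖t i - y‖) * (‖s i - y‖ + ‖t i - y‖)
          ≤ ‖s i - t i‖ * (‖s i - y‖ + ‖t i - y‖) := by
        gcongr
        linarith
      have e5 : ‖s i - t i‖ * (‖s i - y‖ + ‖t i - y‖) ≤ ‖s i - t i‖ * (2 * R) := by
        gcongr
        linarith
      nlinarith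
    have h2 : ∑ i, ‖s i - y‖ ^ 2 ≤ ∑ i, ‖t i - y‖ ^ 2 + 2 * R * (D₁ * (c + z)) := by
      refine (Finset.sum_le_sum fun i _ => h1 i).trans ?_
      rw [Finset.sum_add_distrib, ← Finset.mul_sum]
      gcongr
      exact hdisp c t hc ht
    have h3 : c ≤ D₂ * z := hbad c t hc hc1 ht hb
    have h4 : 2 * R * (D₁ * (c + z)) ≤ 2 * R * (D₁ * (D₂ + 1)) * z := by
      have : D₁ * (c + z) ≤ D₁ * ((D₂ + 1) * z) := by
        gcongr
        linarith
      have := mul_le_mul_of_nonneg_left this (by positivity : 0 ≤ 2 * R)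
      linarith
    have h5 : c * gap P f κ (average t) ≤ D₂ * D₃ * z := by
      have e1 := hgap _ hav
      have e0 : 0 ≤ gap P f κ (average t) := gap_nonneg h.f_nonneg hκ.le hav
      calc c * gap P f κ (average t) ≤ D₂ * z * D₃ := by gcongr
        _ = _ := by ring
    have h6 : potential P f κ s ≤ potential P f κ t - 2 * κ * (c * gap P f κ (average t))
        + DB * z := by
      rw [hpot]
      have e1 := mul_le_mul_of_nonneg_left (h2.trans (add_le_add_right h4 _)) hκ.le
      have e2 := mul_le_mul_of_nonneg_left h5 (by positivity : 0 ≤ 2 * κ)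
      rw [hDB]
      linarith
    have h7 : 0 ≤ DA * (c * p + c ^ 2 + z) := by positivity
    have h8 : 0 ≤ DB * (c * p + c ^ 2) := by positivity
    linarith
  · push Not at hb
    have hdes : ∀ i, ‖s i - y‖ ^ 2 ≤ ‖t i - y‖ ^ 2 - 2 * c * (f i (average t) - f i y)
        + 2 * c * κ * ‖t i - y‖ ^ 2 + c ^ 2 * L + 2 * c * (L * p) := by
      intro i
      have e1 := h.descent c i (t i) y hc (ht i) hy (hb i).le
      -- The other agents' values of coordinate `i` are non-negative, so averaging divides it by at
      -- most `N`; this is why `lipschitz` is required down to `r / (2 * N)`.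
      have e2 : r / (2 * N) ≤ average t i := by
        have e3 : average t i = n⁻¹ * ∑ j, t j i := by simp [average, hn]
        have e4 : t i i ≤ ∑ j, t j i := Finset.single_le_sum (f := fun j => t j i)
          (fun j _ => (ht j i).1) (Finset.mem_univ i)
        rw [e3, inv_mul_eq_div, div_le_div_iff₀ (by positivity) hn0, ← hn]
        nlinarith [hb i]
      have e3 := h.lipschitz i (t i) (average t) (ht i) hav (hb i).le e2
      have e4 : L * ‖t i - average t‖ ≤ L * p := by
        gcongr
        exact norm_sub_average_le t i
      have e5 : 2 * c * (f i (average t) - f i (t i)) ≤ 2 * c * (L * p) := by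
        gcongr
        linarith
      have : s i = step c i (t i) := rfl
      rw [this]
      linarith
    have hsum := Finset.sum_le_sum fun i (_ : i ∈ Finset.univ) => hdes i
    simp only [Finset.sum_add_distrib, Finset.sum_sub_distrib, Finset.sum_const, Finset.card_univ,
      Fintype.card_fin, nsmul_eq_mul, ← Finset.mul_sum] at hsum
    have hq : dispersion t ≤ n * R * p := by
      have e1 : dispersion t = p * p := (Real.mul_self_sqrt (dispersion_nonneg t)).symm
      have e2 : p ≤ n * R := by
        have e3 : p ≤ ∑ i, ‖t i - average t‖ :=
          sqrt_sum_sq_le_sum (fun i => ‖t i - average t‖) fun i => norm_nonneg _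
        refine e3.trans ?_
        calc ∑ i, ‖t i - average t‖ ≤ ∑ _i : Fin N, R :=
              Finset.sum_le_sum fun i _ => hR _ (ht i) _ hav
          _ = n * R := by simp [hn]
      rw [e1]
      gcongr
    have hsplit := sum_norm_sub_sq t y
    rw [← hn] at hsplit hsum hgapy
    have hmain : ∑ i, ‖s i - y‖ ^ 2 ≤ ∑ i, ‖t i - y‖ ^ 2 - 2 * (c * gap P f κ (average t))
        + 2 * c * κ * (n * R * p) + n * (c ^ 2 * L) + n * (2 * c * (L * p)) := by
      have e1 : 2 * c * κ * dispersion t ≤ 2 * c * κ * (n * R * p) := by gcongr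
      rw [hgapy]
      have e2 : 2 * c * κ * ∑ i, ‖t i - y‖ ^ 2
          = 2 * c * κ * (n * ‖average t - y‖ ^ 2) + 2 * c * κ * dispersion t := by
        rw [hsplit]
        ring
      linarith
    have h6 : potential P f κ s ≤ potential P f κ t - 2 * κ * (c * gap P f κ (average t))
        + DA * (c * p) + DA * c ^ 2 := by
      rw [hpot]
      have e1 := mul_le_mul_of_nonneg_left hmain hκ.le
      have e3 : κ * (2 * n * L + 2 * κ * (n * R)) * (c * p) ≤ DA * (c * p) := by
        rw [hDA]
        refine mul_le_mul_of_nonneg_right (mul_le_mul_of_nonneg_left ?_ hκ.le) hcp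
        linarith [mul_nonneg hn0.le hL]
      have e4 : κ * (n * L) * c ^ 2 ≤ DA * c ^ 2 := by
        rw [hDA]
        gcongr
        have : 0 ≤ 2 * n * L + 2 * κ * (n * R) := by positivity
        linarith
      linarith
    have h7 : 0 ≤ DA * z := by positivity
    have h8 : 0 ≤ DB * (c * p + c ^ 2 + z) := by positivity
    linarith

end

end

/-! ### Summability along recursive inequalities -/

/-- Deterministic form of the Robbins–Siegmund argument: telescoping from the index where the
inequality starts bounds the partial sums of `d`. Absolute values are taken since `e` may be signed.
-/
lemma summable_of_recursive_le {v d e : ℕ → ℝ} (hv : ∀ n, 0 ≤ v n) (hd : ∀ n, 0 ≤ d n)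
    (he : Summable e) (h : ∀ᶠ n in atTop, v (n + 1) + d n ≤ v n + e n) : Summable d := by
  obtain ⟨m, hm⟩ := eventually_atTop.mp h
  rw [← summable_nat_add_iff m]
  have he' : Summable fun n => |e (n + m)| := ((summable_nat_add_iff m).mpr he).abs
  refine summable_of_sum_range_le (c := v m + ∑' n, |e (n + m)|) (fun n => hd _) fun n => ?_
  have h1 : ∀ n, v (n + m) + ∑ k ∈ Finset.range n, d (k + m)
      ≤ v m + ∑ k ∈ Finset.range n, |e (k + m)| := by
    intro n
    induction n with
    | zero => simp
    | succ n ih =>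
      rw [Finset.sum_range_succ, Finset.sum_range_succ]
      have := hm (n + m) (by omega)
      rw [show n + 1 + m = n + m + 1 by ring]
      linarith [le_abs_self (e (n + m))]
  have h2 := h1 n
  have h3 := he'.sum_le_tsum (Finset.range n) fun k _ => abs_nonneg _
  linarith [hv (n + m)]

/-- The gossip error, weighted by the step sizes, and the pushes are summable. -/
lemma summable_of_barrier_recursion {γ ρ φ p z : ℕ → ℝ} {α a c₀ D D₁ : ℝ} (hα : 1 / 2 < α)
    (hγ : ∀ n, 1 ≤ n → 0 < γ n) (hγ0 : Tendsto (fun n : ℕ => (n : ℝ) ^ α * γ n) atTop (𝓝 0))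
    (ha : 0 < a) (hρ : ∀ᶠ n : ℕ in atTop, a * ((n : ℝ) ^ α * γ n) ≤ 1 - ρ n)
    (hφ : ∀ n, 0 ≤ φ n) (hp : ∀ n, 0 ≤ p n) (hz : ∀ n, 0 ≤ z n) (hc₀ : 0 < c₀) (hD : 0 ≤ D)
    (hD₁ : 0 ≤ D₁)
    (h1 : ∀ᶠ n in atTop, φ (n + 1) ≤ φ n - c₀ * z n + D * γ (n + 1) ^ 2 + D * (γ (n + 1) * p n))
    (h2 : ∀ᶠ n in atTop, p (n + 1) ≤ (1 + ρ (n + 1)) / 2 * (p n + D₁ * (γ (n + 1) + z n))) :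
    Summable (fun n => γ (n + 1) * p n) ∧ Summable z := by
  -- The contraction removes `K * a / 2` times `γ (n + 1) * p n` from the weighted disagreement.
  -- This `K` makes the coefficient `D + 1`: `D` absorbs the barrier's error and one unit is left
  -- over to be summed.
  set K := 2 * (D + 1) / a with hK
  have hK0 : 0 < K := by positivity
  have hrec : ∀ᶠ n : ℕ in atTop,
      (φ (n + 1) + K * ((n + 1 : ℕ) : ℝ) ^ (-α) * p (n + 1)) + (γ (n + 1) * p n + c₀ / 2 * z n)
        ≤ (φ n + K * (n : ℝ) ^ (-α) * p n)
          + (D + K * D₁) * ((n + 1 : ℕ) : ℝ) ^ (-(2 * α)) := by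
    -- The pushes feed back into the disagreement, but with the vanishing weight `n ^ (-α)`, so half
    -- of the barrier's gain eventually absorbs them.
    have hsmall : ∀ᶠ n : ℕ in atTop, K * D₁ * ((n + 1 : ℕ) : ℝ) ^ (-α) ≤ c₀ / 2 := by
      have t1 : Tendsto (fun n : ℕ => K * D₁ * ((n + 1 : ℕ) : ℝ) ^ (-α)) atTop (𝓝 (K * D₁ * 0)) :=
        ((tendsto_rpow_neg_atTop (by linarith : 0 < α)).comp
          (tendsto_natCast_atTop_atTop.comp (tendsto_add_atTop_nat 1))).const_mul _
      rw [mul_zero] at t1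
      exact t1.eventually_le_const (by positivity)
    have hγs : ∀ᶠ n : ℕ in atTop, ((n + 1 : ℕ) : ℝ) ^ α * γ (n + 1) ≤ 1 :=
      (tendsto_add_atTop_nat 1).eventually (hγ0.eventually_le_const zero_lt_one)
    have hρs := (tendsto_add_atTop_nat 1).eventually hρ
    filter_upwards [hsmall, hγs, hρs, h1, h2, eventually_ge_atTop 1] with n e1 e2 e3 e4 e5 hn
    have hn0 : (0 : ℝ) < n := by exact_mod_cast hn
    set x : ℝ := ((n + 1 : ℕ) : ℝ) with hx
    have hx0 : 0 < x := by
      rw [hx]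
      positivity
    set g := γ (n + 1)
    have hg : 0 < g := hγ (n + 1) (by omega)
    set y := x ^ (-α) with hy
    have hy0 : 0 < y := Real.rpow_pos_of_pos hx0 _
    have hxy : x ^ α * y = 1 := by
      rw [hy, ← Real.rpow_add hx0]
      simp
    have hyy : x ^ (-(2 * α)) = y * y := by
      rw [hy, ← Real.rpow_add hx0]
      ring_nf
    have hgy : g ≤ y := by
      have := mul_le_mul_of_nonneg_right e2 hy0.le
      rw [one_mul, mul_right_comm, hxy, one_mul] at this
      exact this
    have hyn : y ≤ (n : ℝ) ^ (-α) := by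
      refine Real.rpow_le_rpow_of_nonpos hn0 ?_ (by linarith)
      rw [hx]
      push_cast
      linarith
    have f1 : a * g ≤ (1 - ρ (n + 1)) * y := by
      have := mul_le_mul_of_nonneg_right e3 hy0.le
      have e : a * (x ^ α * g) * y = a * g * (x ^ α * y) := by ring
      rw [e, hxy, mul_one] at this
      exact this
    have hρ1 : (1 + ρ (n + 1)) / 2 ≤ 1 := by
      have : 0 ≤ a * (x ^ α * g) := by positivity
      linarith
    have f2 : y * p (n + 1) ≤ y * p n - a * g / 2 * p n + y * (D₁ * (g + z n)) := by
      have b1 := mul_le_mul_of_nonneg_left e5 hy0.le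
      have b2 : 0 ≤ D₁ * (g + z n) := mul_nonneg hD₁ (add_nonneg hg.le (hz n))
      have b3 := mul_le_mul_of_nonneg_left (mul_le_mul_of_nonneg_right hρ1 b2) hy0.le
      have b4 := mul_le_mul_of_nonneg_right f1 (hp n)
      linarith
    have f3 := mul_le_mul_of_nonneg_left f2 hK0.le
    have hKa : K * a = 2 * (D + 1) := by
      rw [hK]
      field_simp
    have f4 : K * (a * g / 2 * p n) = (D + 1) * (g * p n) := by
      linear_combination (g * p n / 2) * hKa
    have f5 : K * (y * p n) ≤ K * (n : ℝ) ^ (-α) * p n := by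
      rw [← mul_assoc]
      gcongr
      exact hp n
    have f6 : K * D₁ * y * z n ≤ c₀ / 2 * z n := mul_le_mul_of_nonneg_right e1 (hz n)
    have f7 : K * D₁ * y * g ≤ K * D₁ * y * y := by gcongr
    have f8 : D * g ^ 2 ≤ D * (y * y) := by
      rw [sq]
      gcongr
    rw [hyy]
    linarith
  have hsum : Summable fun n => γ (n + 1) * p n + c₀ / 2 * z n := by
    refine summable_of_recursive_le (v := fun n => φ n + K * (n : ℝ) ^ (-α) * p n)
      (e := fun n => (D + K * D₁) * ((n + 1 : ℕ) : ℝ) ^ (-(2 * α))) (fun n => ?_) (fun n => ?_) ?_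
      hrec
    · have := hφ n
      have := hp n
      positivity
    · have := (hγ (n + 1) (by omega)).le
      have := hp n
      have := hz n
      positivity
    · refine Summable.mul_left _ ?_
      exact (summable_nat_add_iff (f := fun n : ℕ => (n : ℝ) ^ (-(2 * α))) 1).mpr
        (Real.summable_nat_rpow.mpr (by linarith))
  have hA : ∀ n, 0 ≤ γ (n + 1) * p n := fun n =>
    mul_nonneg (hγ (n + 1) (by omega)).le (hp n)
  constructor
  · exact Summable.of_nonneg_of_le hA (fun n => le_add_of_nonneg_right
      (mul_nonneg (by positivity) (hz n))) hsum
  · have : Summable fun n => c₀ / 2 * z n := Summable.of_nonneg_of_le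
      (fun n => mul_nonneg (by positivity) (hz n)) (fun n => le_add_of_nonneg_left (hA n)) hsum
    exact (summable_mul_left_iff (by positivity)).mp this

lemma summable_sq_of_tendsto_rpow_mul {γ : ℕ → ℝ} {α : ℝ} (hα : 1 / 2 < α)
    (hγ0 : Tendsto (fun n : ℕ => (n : ℝ) ^ α * γ n) atTop (𝓝 0)) :
    Summable fun n => γ n ^ 2 := by
  have hs : Summable fun n : ℕ => (n : ℝ) ^ (-(2 * α)) :=
    Real.summable_nat_rpow.mpr (by linarith)
  refine Summable.of_norm_bounded_eventually_nat hs ?_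
  have h1 := (hγ0.abs.eventually_le_const (by simp : |(0 : ℝ)| < 1))
  filter_upwards [h1, eventually_ge_atTop 1] with n e1 hn
  have hx0 : (0 : ℝ) < n := by exact_mod_cast hn
  have hy : (n : ℝ) ^ (-(2 * α)) = (n : ℝ) ^ (-α) * (n : ℝ) ^ (-α) := by
    rw [← Real.rpow_add hx0]
    ring_nf
  have hγ : γ n = (n : ℝ) ^ α * γ n * (n : ℝ) ^ (-α) := by
    rw [mul_right_comm, ← Real.rpow_add hx0]
    simp
  have hpow : ((n : ℝ) ^ α * γ n) ^ 2 ≤ 1 := (sq_le_one_iff_abs_le_one _).mpr e1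
  rw [Real.norm_of_nonneg (sq_nonneg _), hy, hγ, mul_pow, sq ((n : ℝ) ^ (-α))]
  exact mul_le_of_le_one_left (by positivity) hpow

/-! ### The random process -/

section
variable {Ω : Type*} [mΩ : MeasurableSpace Ω] {N : ℕ}

/-- A process driven by local steps and by independent gossip matrices. -/
structure GossipDynamics (μ : Measure Ω) (ℱ : Filtration ℕ mΩ) (P : Fin N → ℝ)
    (step : ℝ → Fin N → Powers N → Powers N) (γ : ℕ → ℝ) (W : ℕ → Ω → Fin N → Fin N → ℝ)
    (θ : ℕ → Ω → Fin N → Powers N) : Prop where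
  law : ∀ n, 1 ≤ n → GossipLaw μ (W n)
  W_meas : ∀ n, 1 ≤ n → Measurable[ℱ n] (W n)
  θ_meas : ∀ n, Measurable[ℱ n] (θ n)
  step_meas : ∀ c i, Measurable (step c i)
  succ : ∀ n ω, θ (n + 1) ω = mix (W (n + 1) ω) (stepAll step (γ (n + 1)) (θ n ω))
  mem : ∀ n, ∀ᵐ ω ∂μ, ∀ i, θ n ω i ∈ powerBox P
  indep : ∀ n, 1 ≤ n → Indep (MeasurableSpace.comap (W (n + 1)) inferInstance) (ℱ n) μ

/-- A bound for frozen `Y` integrates to a bound for random `Y`: under independence the joint law is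
a product and Fubini applies. -/
lemma integral_le_of_indepFun {μ : Measure Ω} [IsProbabilityMeasure μ] {α β : Type*}
    [MeasurableSpace α] [MeasurableSpace β] {X : Ω → α} {Y : Ω → β} (hXY : IndepFun X Y μ)
    (hX : Measurable X) (hY : Measurable Y) {H : α × β → ℝ} (hH : Measurable H)
    (hint : Integrable (fun ω => H (X ω, Y ω)) μ) {k : β → ℝ}
    (hk : Integrable (fun ω => k (Y ω)) μ)
    (hle : ∀ᵐ ω' ∂μ, ∫ ω, H (X ω, Y ω') ∂μ ≤ k (Y ω')) :
    ∫ ω, H (X ω, Y ω) ∂μ ≤ ∫ ω, k (Y ω) ∂μ := by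
  have hmap : μ.map (fun ω => (X ω, Y ω)) = (μ.map X).prod (μ.map Y) :=
    (indepFun_iff_map_prod_eq_prod_map_map hX.aemeasurable hY.aemeasurable).mp hXY
  have : IsProbabilityMeasure (μ.map X) := Measure.isProbabilityMeasure_map hX.aemeasurable
  have : IsProbabilityMeasure (μ.map Y) := Measure.isProbabilityMeasure_map hY.aemeasurable
  have hXYm : Measurable fun ω => (X ω, Y ω) := hX.prodMk hY
  have hint' : Integrable H ((μ.map X).prod (μ.map Y)) := by
    rw [← hmap]
    exact (integrable_map_measure hH.aestronglyMeasurable hXYm.aemeasurable).mpr hint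
  have hinner : ∀ y, ∫ x, H (x, y) ∂(μ.map X) = ∫ ω, H (X ω, y) ∂μ := fun y =>
    integral_map hX.aemeasurable (hH.comp (measurable_id.prodMk measurable_const)).aestronglyMeasurable
  have h1 : ∫ ω, H (X ω, Y ω) ∂μ = ∫ ω', ∫ x, H (x, Y ω') ∂(μ.map X) ∂μ := by
    rw [← integral_map (f := fun y => ∫ x, H (x, y) ∂(μ.map X)) hY.aemeasurable
      hint'.integral_prod_right.aestronglyMeasurable, ← integral_prod_symm H hint', ← hmap,
      integral_map hXYm.aemeasurable hH.aestronglyMeasurable]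
  rw [h1]
  refine integral_mono_ae ?_ hk ?_
  · exact (integrable_map_measure hint'.integral_prod_right.aestronglyMeasurable
      hY.aemeasurable).mp hint'.integral_prod_right
  · filter_upwards [hle] with ω' hω'
    rw [hinner]
    exact hω'

lemma integrable_comp_of_isCompact {μ : Measure Ω} [IsFiniteMeasure μ] {X : Type*}
    [TopologicalSpace X] [MeasurableSpace X] {K : Set X} (hK : IsCompact K)
    {Z : Ω → X} (hZ : Measurable Z) (hmem : ∀ᵐ ω ∂μ, Z ω ∈ K) {h : X → ℝ} (hm : Measurable h)
    (hc : ContinuousOn h K) : Integrable (fun ω => h (Z ω)) μ := by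
  obtain ⟨B, hB⟩ := hK.exists_bound_of_continuousOn hc
  refine Integrable.of_bound (hm.comp hZ).aestronglyMeasurable B ?_
  filter_upwards [hmem] with ω hω using hB _ hω

lemma isCompact_pi_powerBox (P : Fin N → ℝ) :
    IsCompact (Set.univ.pi fun _ : Fin N => powerBox P) :=
  isCompact_univ_pi fun _ => isCompact_powerBox P

namespace GossipDynamics

variable {μ : Measure Ω} {ℱ : Filtration ℕ mΩ} {P : Fin N → ℝ}
  {step : ℝ → Fin N → Powers N → Powers N} {γ : ℕ → ℝ} {W : ℕ → Ω → Fin N → Fin N → ℝ}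
  {θ : ℕ → Ω → Fin N → Powers N}

lemma measurable_θ (h : GossipDynamics μ ℱ P step γ W θ) (n : ℕ) : Measurable (θ n) :=
  (h.θ_meas n).mono (ℱ.le n) le_rfl

lemma measurable_stepAll (h : GossipDynamics μ ℱ P step γ W θ) (c : ℝ) :
    Measurable (stepAll step c) :=
  measurable_pi_lambda _ fun i => (h.step_meas c i).comp (measurable_pi_apply i)

lemma stepAll_mem (h : GossipDynamics μ ℱ P step γ W θ)
    (hmem : ∀ c i x, x ∈ powerBox P → step c i x ∈ powerBox P) (n : ℕ) :
    ∀ᵐ ω ∂μ, ∀ i, stepAll step (γ (n + 1)) (θ n ω) i ∈ powerBox P := by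
  filter_upwards [h.mem n] with ω hω i using hmem _ _ _ (hω i)

variable [IsProbabilityMeasure μ]

lemma integrable_comp (h : GossipDynamics μ ℱ P step γ W θ) (n : ℕ)
    {g : (Fin N → Powers N) → ℝ} (hg : Continuous g) : Integrable (fun ω => g (θ n ω)) μ := by
  refine integrable_comp_of_isCompact (isCompact_pi_powerBox P) (h.measurable_θ n) ?_
    hg.measurable hg.continuousOn
  filter_upwards [h.mem n] with ω hω i _ using hω i

lemma integrable_comp_stepAll (h : GossipDynamics μ ℱ P step γ W θ)
    (hmem : ∀ c i x, x ∈ powerBox P → step c i x ∈ powerBox P) (n : ℕ)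
    {g : (Fin N → Powers N) → ℝ} (hg : Continuous g) :
    Integrable (fun ω => g (stepAll step (γ (n + 1)) (θ n ω))) μ := by
  refine integrable_comp_of_isCompact (isCompact_pi_powerBox P)
    ((h.measurable_stepAll _).comp (h.measurable_θ n)) ?_ hg.measurable hg.continuousOn
  filter_upwards [h.stepAll_mem hmem n] with ω hω i _ using hω i

/-- A bound on the mean of a function of the estimates before and after a gossip step follows from
the same bound for deterministic estimates before the step. -/
lemma integral_comp_le (h : GossipDynamics μ ℱ P step γ W θ)
    (hmem : ∀ c i x, x ∈ powerBox P → step c i x ∈ powerBox P) {n : ℕ} (hn : 1 ≤ n)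
    {g : (Fin N → Powers N) × (Fin N → Powers N) → ℝ} (hg : Continuous g)
    {k : (Fin N → Powers N) → ℝ} (hk : Continuous k)
    (hle : ∀ t, (∀ i, t i ∈ powerBox P) → ∫ ω, g (mix (W (n + 1) ω) t, t) ∂μ ≤ k t) :
    ∫ ω, g (θ (n + 1) ω, stepAll step (γ (n + 1)) (θ n ω)) ∂μ
      ≤ ∫ ω, k (stepAll step (γ (n + 1)) (θ n ω)) ∂μ := by
  have hYF : Measurable[ℱ n] fun ω => stepAll step (γ (n + 1)) (θ n ω) :=
    (h.measurable_stepAll _).comp (h.θ_meas n)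
  have hY : Measurable fun ω => stepAll step (γ (n + 1)) (θ n ω) := hYF.mono (ℱ.le n) le_rfl
  have hX : Measurable (W (n + 1)) := (h.law (n + 1) (by omega)).measurable
  have hind : IndepFun (W (n + 1)) (fun ω => stepAll step (γ (n + 1)) (θ n ω)) μ := by
    rw [IndepFun_iff_Indep]
    exact indep_of_indep_of_le_right (h.indep n hn) hYF.comap_le
  have hcont : Continuous fun x : (Fin N → Fin N → ℝ) × (Fin N → Powers N) =>
      g (mix x.1 x.2, x.2) := hg.comp (continuous_mix.prodMk continuous_snd)
  have hint : Integrable (fun ω => g (θ (n + 1) ω, stepAll step (γ (n + 1)) (θ n ω))) μ := by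
    refine integrable_comp_of_isCompact
      ((isCompact_pi_powerBox P).prod (isCompact_pi_powerBox P))
      ((h.measurable_θ (n + 1)).prodMk hY) ?_ hg.measurable hg.continuousOn
    filter_upwards [h.mem (n + 1), h.stepAll_mem hmem n] with ω h1 h2
    exact ⟨fun i _ => h1 i, fun i _ => h2 i⟩
  simp_rw [h.succ] at hint ⊢
  refine integral_le_of_indepFun hind hX hY hcont.measurable hint
    (h.integrable_comp_stepAll hmem n hk) ?_
  filter_upwards [h.stepAll_mem hmem n] with ω hω using hle _ hω

end GossipDynamics

end

/-! ### Mean inequalities along the process -/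

section
variable {Ω : Type*} [mΩ : MeasurableSpace Ω] {N : ℕ}

lemma convexOn_barrier_coord (r : ℝ) :
    ConvexOn ℝ Set.univ fun x : Powers N => ∑ i, max (r - x i) 0 ^ 2 := by
  have h : ∀ i : Fin N, ConvexOn ℝ Set.univ fun x : Powers N => max (r - x i) 0 ^ 2 := by
    intro i
    have h1 : ConvexOn ℝ Set.univ fun x : Powers N => r - x i := by
      refine ⟨convex_univ, fun x _ y _ a b ha hb hab => le_of_eq ?_⟩
      simp only [PiLp.add_apply, PiLp.smul_apply, smul_eq_mul]
      linear_combination -r * hab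
    have h2 : ConvexOn ℝ Set.univ fun x : Powers N => max (r - x i) 0 :=
      h1.sup (convexOn_const 0 convex_univ)
    exact h2.pow (fun x _ => le_max_right _ _) 2
  refine ⟨convex_univ, fun x _ y _ a b ha hb hab => ?_⟩
  simp only [smul_eq_mul, Finset.mul_sum, ← Finset.sum_add_distrib]
  exact Finset.sum_le_sum fun i _ => (h i).2 (Set.mem_univ x) (Set.mem_univ y) ha hb hab

lemma GossipLaw.integral_barrier_le {μ : Measure Ω} [IsProbabilityMeasure μ]
    {w : Ω → Fin N → Fin N → ℝ} (h : GossipLaw μ w) (r : ℝ) (t : Fin N → Powers N) :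
    ∫ ω, barrier r (mix (w ω) t) ∂μ ≤ barrier r t := by
  have e : ∀ s : Fin N → Powers N, barrier r s = ∑ j, ∑ i, max (r - s j i) 0 ^ 2 := fun s =>
    Finset.sum_comm
  simp only [e]
  exact h.integral_sum_convex_le (convexOn_barrier_coord r)
    (fun x => Finset.sum_nonneg fun i _ => sq_nonneg _) t

/-- The minimiser `y` for `t` is kept fixed while the matrix varies; the sum of squared distances to
it is a convex sum, which gossip does not increase in mean. -/
lemma GossipLaw.integral_potential_le [NeZero N] {μ : Measure Ω} [IsProbabilityMeasure μ]
    {w : Ω → Fin N → Fin N → ℝ} (h : GossipLaw μ w) {P : Fin N → ℝ} {f : Fin N → Powers N → ℝ}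
    {κ : ℝ} (hP : ∀ i, 0 ≤ P i) (hf0 : ∀ i x, 0 ≤ f i x)
    (hf : ∀ i, ContinuousOn (f i) (powerBox P)) (hκ : 0 ≤ κ) {t : Fin N → Powers N}
    (ht : ∀ i, t i ∈ powerBox P) :
    ∫ ω, potential P f κ (mix (w ω) t) ∂μ ≤ potential P f κ t := by
  obtain ⟨y, hy, hpot, -⟩ := exists_potential_eq (κ := κ) hP hf t
  have hint : Integrable (fun ω => ∑ i, ‖mix (w ω) t i - y‖ ^ 2) μ := by
    refine integrable_comp_of_isCompact (isCompact_pi_powerBox P) (Z := fun ω => mix (w ω) t)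
      (h := fun s => ∑ i, ‖s i - y‖ ^ 2) ?_ ?_ ?_ ?_
    · exact (continuous_mix (N := N)).measurable.comp (h.measurable.prodMk measurable_const)
    · filter_upwards [h.stochastic] with ω hω i _ using mix_mem_powerBox hω ht i
    · fun_prop
    · fun_prop
  calc ∫ ω, potential P f κ (mix (w ω) t) ∂μ
      ≤ ∫ ω, (∑ i, f i y + κ * ∑ i, ‖mix (w ω) t i - y‖ ^ 2) ∂μ :=
        integral_mono_of_nonneg (ae_of_all _ fun ω => potential_nonneg hf0 hκ _)
          ((integrable_const _).add (hint.const_mul κ))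
          (ae_of_all _ fun ω => potential_le hf0 hκ _ hy)
    _ = ∑ i, f i y + κ * ∫ ω, ∑ i, ‖mix (w ω) t i - y‖ ^ 2 ∂μ := by
        rw [integral_add (integrable_const _) (hint.const_mul κ), integral_const_mul]
        simp
    _ ≤ ∑ i, f i y + κ * ∑ i, ‖t i - y‖ ^ 2 := by
        gcongr
        exact h.integral_sum_convex_le (convexOn_norm_sub_sq y) (fun _ => sq_nonneg _) t
    _ = potential P f κ t := hpot.symm

namespace GossipDynamics

variable {μ : Measure Ω} {ℱ : Filtration ℕ mΩ} {P : Fin N → ℝ}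
  {step : ℝ → Fin N → Powers N → Powers N} {γ : ℕ → ℝ} {W : ℕ → Ω → Fin N → Fin N → ℝ}
  {θ : ℕ → Ω → Fin N → Powers N} {f : Fin N → Powers N → ℝ} {r M C L κ : ℝ}

lemma exists_push_le (hs : StepBounds P f step r M C L κ) :
    ∃ B, 0 ≤ B ∧ ∀ c t, 0 < c → (∀ i, t i ∈ powerBox P) → push step r c t ≤ B := by
  have hP : ∀ i, 0 ≤ P i := fun i => hs.r_pos.le.trans (hs.r_le i)
  refine ⟨∑ i, P i, Finset.sum_nonneg fun i _ => hP i, fun c t _ ht =>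
    Finset.sum_le_sum fun i _ => ?_⟩
  split_ifs
  · linarith [(hs.mem c i (t i) (ht i) i).2, (ht i i).1]
  · exact hP i

lemma measurable_push (h : GossipDynamics μ ℱ P step γ W θ) (r c : ℝ) :
    Measurable (push step r c) := by
  unfold push
  refine Finset.measurable_sum _ fun i _ => ?_
  have h1 : Measurable fun t : Fin N → Powers N => t i i := by fun_prop
  have h2 : Measurable fun t : Fin N → Powers N => step c i (t i) i := by
    have h3 : Measurable fun t : Fin N → Powers N => step c i (t i) :=
      (h.step_meas c i).comp (measurable_pi_apply i)
    have h4 : Measurable fun x : Powers N => x i := by fun_prop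
    exact h4.comp h3
  exact Measurable.ite (measurableSet_le h1 measurable_const) (h2.sub h1) measurable_const

variable [IsProbabilityMeasure μ]

lemma integrable_push (h : GossipDynamics μ ℱ P step γ W θ) (hs : StepBounds P f step r M C L κ)
    (hγ : ∀ n, 1 ≤ n → 0 < γ n) (n : ℕ) :
    Integrable (fun ω => push step r (γ (n + 1)) (θ n ω)) μ := by
  obtain ⟨B, -, hB⟩ := exists_push_le hs
  have hc := hγ (n + 1) (by omega)
  refine Integrable.of_bound ((h.measurable_push _ _).comp (h.measurable_θ n)).aestronglyMeasurable
    B ?_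
  filter_upwards [h.mem n] with ω hω
  rw [Real.norm_of_nonneg (hs.push_nonneg hc hω)]
  exact hB _ _ hc hω

lemma integrable_gap [NeZero N] (h : GossipDynamics μ ℱ P step γ W θ)
    (hs : StepBounds P f step r M C L κ) (hfm : ∀ i, Measurable (f i)) (n : ℕ) :
    Integrable (fun ω => gap P f κ (average (θ n ω))) μ := by
  refine integrable_comp_of_isCompact (isCompact_powerBox P)
    (continuous_average.measurable.comp (h.measurable_θ n)) ?_ ?_ ?_
  · filter_upwards [h.mem n] with ω hω using average_mem_powerBox hω
  · exact (Finset.measurable_sum _ fun i _ => hfm i).sub (continuous_envelope hs.f_cont).measurable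
  · exact (continuousOn_finsetSum _ fun i _ => hs.f_cont i).sub
      (continuous_envelope hs.f_cont).continuousOn

lemma integral_barrier_succ_le (h : GossipDynamics μ ℱ P step γ W θ)
    (hs : StepBounds P f step r M C L κ) (hγ : ∀ n, 1 ≤ n → 0 < γ n) :
    ∃ c₀ D, 0 < c₀ ∧ 0 ≤ D ∧ ∀ n, 1 ≤ n → ∫ ω, barrier r (θ (n + 1) ω) ∂μ
      ≤ ∫ ω, barrier r (θ n ω) ∂μ - c₀ * ∫ ω, push step r (γ (n + 1)) (θ n ω) ∂μ
        + D * γ (n + 1) ^ 2 + D * (γ (n + 1) * ∫ ω, √(dispersion (θ n ω)) ∂μ) := by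
  obtain ⟨c₀, D, hc₀, hD, hstep⟩ := hs.barrier_step_le
  refine ⟨c₀, D, hc₀, hD, fun n hn => ?_⟩
  have i1 := h.integrable_comp n (continuous_barrier r)
  have i2 := h.integrable_push hs hγ n
  have i3 := h.integrable_comp n (g := fun t => √(dispersion t)) continuous_dispersion.sqrt
  have h1 := h.integral_comp_le hs.mem hn (g := fun x => barrier r x.1)
    ((continuous_barrier r).comp continuous_fst) (continuous_barrier r)
    (fun t _ => (h.law (n + 1) (by omega)).integral_barrier_le r t)
  refine h1.trans ?_
  have i4 : Integrable (fun ω => barrier r (θ n ω) - c₀ * push step r (γ (n + 1)) (θ n ω)) μ :=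
    i1.sub (i2.const_mul c₀)
  have i5 : Integrable (fun ω => barrier r (θ n ω) - c₀ * push step r (γ (n + 1)) (θ n ω)
      + D * γ (n + 1) ^ 2) μ := i4.add (integrable_const _)
  have i6 : Integrable (fun ω => D * (γ (n + 1) * √(dispersion (θ n ω)))) μ :=
    (i3.const_mul _).const_mul _
  calc ∫ ω, barrier r (stepAll step (γ (n + 1)) (θ n ω)) ∂μ
      ≤ ∫ ω, (barrier r (θ n ω) - c₀ * push step r (γ (n + 1)) (θ n ω)
        + D * γ (n + 1) ^ 2 + D * (γ (n + 1) * √(dispersion (θ n ω)))) ∂μ := by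
        refine integral_mono_ae (h.integrable_comp_stepAll hs.mem n (continuous_barrier r))
          (i5.add i6) ?_
        filter_upwards [h.mem n] with ω hω
        exact hstep _ _ (hγ (n + 1) (by omega)) hω
    _ = _ := by
        rw [integral_add i5 i6, integral_add i4 (integrable_const _),
          integral_sub i1 (i2.const_mul c₀), integral_const_mul, integral_const_mul,
          integral_const_mul, integral_const_mul]
        simp

variable [NeZero N]

lemma integral_sqrt_dispersion_succ_le (h : GossipDynamics μ ℱ P step γ W θ)
    (hs : StepBounds P f step r M C L κ) (hγ : ∀ n, 1 ≤ n → 0 < γ n) :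
    ∃ D, 0 ≤ D ∧ ∀ n, 1 ≤ n → ∫ ω, √(dispersion (θ (n + 1) ω)) ∂μ
      ≤ (1 + gossipNorm μ (fun ω => Matrix.of (W (n + 1) ω))) / 2
        * (∫ ω, √(dispersion (θ n ω)) ∂μ
          + D * (γ (n + 1) + ∫ ω, push step r (γ (n + 1)) (θ n ω) ∂μ)) := by
  obtain ⟨D, hD, hdisp⟩ := hs.sum_norm_step_sub_le
  refine ⟨D, hD, fun n hn => ?_⟩
  set ρ := gossipNorm μ (fun ω => Matrix.of (W (n + 1) ω))
  have hρ0 : 0 ≤ ρ := gossipNorm_nonneg _ _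
  have hlaw := h.law (n + 1) (by omega)
  have cs : Continuous fun t : Fin N → Powers N => √(dispersion t) := continuous_dispersion.sqrt
  have i2 := h.integrable_push hs hγ n
  have i3 := h.integrable_comp n cs
  have h1 := h.integral_comp_le hs.mem hn (g := fun x => √(dispersion x.1))
    (cs.comp continuous_fst) (k := fun t => (1 + ρ) / 2 * √(dispersion t)) (cs.const_mul _)
    (fun t ht => by
      refine hlaw.integral_sqrt_dispersion_le t ?_
      refine integrable_comp_of_isCompact (isCompact_pi_powerBox P)
        (Z := fun ω => mix (W (n + 1) ω) t) ?_ ?_ continuous_dispersion.measurable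
        continuous_dispersion.continuousOn
      · exact (continuous_mix (N := N)).measurable.comp (hlaw.measurable.prodMk measurable_const)
      · filter_upwards [hlaw.stochastic] with ω hω i _ using mix_mem_powerBox hω ht i)
  refine h1.trans ?_
  rw [integral_const_mul]
  refine mul_le_mul_of_nonneg_left ?_ (by positivity)
  have i4 : Integrable (fun ω => γ (n + 1) + push step r (γ (n + 1)) (θ n ω)) μ :=
    (integrable_const _).add i2
  calc ∫ ω, √(dispersion (stepAll step (γ (n + 1)) (θ n ω))) ∂μ
      ≤ ∫ ω, (√(dispersion (θ n ω)) + D * (γ (n + 1) + push step r (γ (n + 1)) (θ n ω))) ∂μ := by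
        refine integral_mono_ae (h.integrable_comp_stepAll hs.mem n cs)
          (i3.add (i4.const_mul D)) ?_
        filter_upwards [h.mem n] with ω hω
        exact (sqrt_dispersion_le_add _ _).trans
          (add_le_add_right (hdisp _ _ (hγ (n + 1) (by omega)) hω) _)
    _ = _ := by
        rw [integral_add i3 (i4.const_mul D), integral_const_mul, integral_add (integrable_const _) i2]
        simp

lemma integral_potential_succ_le (h : GossipDynamics μ ℱ P step γ W θ)
    (hs : StepBounds P f step r M C L κ) (hfm : ∀ i, Measurable (f i))
    (hγ : ∀ n, 1 ≤ n → 0 < γ n) :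
    ∃ D, 0 ≤ D ∧ ∀ n, 1 ≤ n → γ (n + 1) ≤ 1 → ∫ ω, potential P f κ (θ (n + 1) ω) ∂μ
      ≤ ∫ ω, potential P f κ (θ n ω) ∂μ
        - 2 * κ * (γ (n + 1) * ∫ ω, gap P f κ (average (θ n ω)) ∂μ)
        + D * (γ (n + 1) * ∫ ω, √(dispersion (θ n ω)) ∂μ + γ (n + 1) ^ 2
          + ∫ ω, push step r (γ (n + 1)) (θ n ω) ∂μ) := by
  obtain ⟨D, hD, hstep⟩ := hs.potential_step_le
  refine ⟨D, hD, fun n hn hn1 => ?_⟩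
  have hP : ∀ i, 0 ≤ P i := fun i => hs.r_pos.le.trans (hs.r_le i)
  have cp := continuous_potential (κ := κ) hs.f_cont
  have i1 := h.integrable_comp n cp
  have i2 := h.integrable_push hs hγ n
  have i3 := h.integrable_comp n (g := fun t => √(dispersion t)) continuous_dispersion.sqrt
  have i4 := h.integrable_gap hs hfm n
  have h1 := h.integral_comp_le hs.mem hn (g := fun x => potential P f κ x.1)
    (cp.comp continuous_fst) cp
    (fun t ht => (h.law (n + 1) (by omega)).integral_potential_le hP hs.f_nonneg hs.f_cont
      hs.κ_pos.le ht)
  refine h1.trans ?_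
  have i5 : Integrable (fun ω => 2 * κ * (γ (n + 1) * gap P f κ (average (θ n ω)))) μ :=
    (i4.const_mul _).const_mul _
  have i6 : Integrable (fun ω => potential P f κ (θ n ω)
      - 2 * κ * (γ (n + 1) * gap P f κ (average (θ n ω)))) μ := i1.sub i5
  have i7 : Integrable (fun ω => γ (n + 1) * √(dispersion (θ n ω)) + γ (n + 1) ^ 2) μ :=
    (i3.const_mul _).add (integrable_const _)
  have i8 : Integrable (fun ω => γ (n + 1) * √(dispersion (θ n ω)) + γ (n + 1) ^ 2
      + push step r (γ (n + 1)) (θ n ω)) μ := i7.add i2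
  calc ∫ ω, potential P f κ (stepAll step (γ (n + 1)) (θ n ω)) ∂μ
      ≤ ∫ ω, (potential P f κ (θ n ω) - 2 * κ * (γ (n + 1) * gap P f κ (average (θ n ω)))
        + D * (γ (n + 1) * √(dispersion (θ n ω)) + γ (n + 1) ^ 2
          + push step r (γ (n + 1)) (θ n ω))) ∂μ := by
        refine integral_mono_ae (h.integrable_comp_stepAll hs.mem n cp)
          (i6.add (i8.const_mul D)) ?_
        filter_upwards [h.mem n] with ω hω
        exact hstep _ _ (hγ (n + 1) (by omega)) hn1 hω
    _ = _ := by
        rw [integral_add i6 (i8.const_mul D), integral_sub i1 i5, integral_const_mul,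
          integral_const_mul, integral_const_mul, integral_add i7 i2,
          integral_add (i3.const_mul _) (integrable_const _), integral_const_mul]
        simp

/-- Expanding the square of the bound on the root dispersion after the local steps, the disagreement
and the push are bounded on the box, so every term with a push is linear in it. All errors are then
of the types already known to be summable. -/
lemma integral_dispersion_succ_le (h : GossipDynamics μ ℱ P step γ W θ)
    (hs : StepBounds P f step r M C L κ) (hγ : ∀ n, 1 ≤ n → 0 < γ n) :
    ∃ D, 0 ≤ D ∧ ∀ n, 1 ≤ n →
      ∫ ω, dispersion (θ (n + 1) ω) ∂μ
        + N * ∫ ω, ‖average (θ (n + 1) ω) - average (stepAll step (γ (n + 1)) (θ n ω))‖ ^ 2 ∂μ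
      ≤ ∫ ω, dispersion (θ n ω) ∂μ
        + D * (γ (n + 1) * ∫ ω, √(dispersion (θ n ω)) ∂μ + γ (n + 1) ^ 2
          + ∫ ω, push step r (γ (n + 1)) (θ n ω) ∂μ) := by
  obtain ⟨D₁, hD₁, hdisp⟩ := hs.sum_norm_step_sub_le
  obtain ⟨B, hB0, hB⟩ := exists_push_le hs
  obtain ⟨B', hB'⟩ := (isCompact_pi_powerBox P).exists_bound_of_continuousOn
    (f := fun t : Fin N → Powers N => √(dispersion t)) continuous_dispersion.sqrt.continuousOn
  set D := 2 * D₁ + 2 * D₁ ^ 2 + 2 * D₁ * |B'| + 2 * D₁ ^ 2 * B with hDdef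
  refine ⟨D, by positivity, fun n hn => ?_⟩
  have cd := continuous_dispersion (N := N)
  have ca := continuous_average (N := N)
  have i1 := h.integrable_comp n cd
  have i2 := h.integrable_push hs hγ n
  have i3 := h.integrable_comp n (g := fun t => √(dispersion t)) cd.sqrt
  have h1 := h.integral_comp_le hs.mem hn
    (g := fun x => N * ‖average x.1 - average x.2‖ ^ 2 + dispersion x.1)
    (((((ca.comp continuous_fst).sub (ca.comp continuous_snd)).norm.pow 2).const_mul _).add
      (cd.comp continuous_fst)) cd
    (fun t _ => (h.law (n + 1) (by omega)).integral_dispersion_add_le t)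
  have i5 : Integrable (fun ω =>
      ‖average (θ (n + 1) ω) - average (stepAll step (γ (n + 1)) (θ n ω))‖ ^ 2) μ := by
    refine integrable_comp_of_isCompact
      ((isCompact_pi_powerBox P).prod (isCompact_pi_powerBox P))
      (Z := fun ω => (θ (n + 1) ω, stepAll step (γ (n + 1)) (θ n ω)))
      (h := fun x => ‖average x.1 - average x.2‖ ^ 2)
      ((h.measurable_θ (n + 1)).prodMk ((h.measurable_stepAll _).comp (h.measurable_θ n))) ?_
      (Continuous.measurable ?_) (Continuous.continuousOn ?_)
    · filter_upwards [h.mem (n + 1), h.stepAll_mem hs.mem n] with ω h1 h2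
      exact ⟨fun i _ => h1 i, fun i _ => h2 i⟩
    · exact ((ca.comp continuous_fst).sub (ca.comp continuous_snd)).norm.pow 2
    · exact ((ca.comp continuous_fst).sub (ca.comp continuous_snd)).norm.pow 2
  rw [integral_add (i5.const_mul _) (h.integrable_comp (n + 1) cd), integral_const_mul] at h1
  rw [add_comm]
  refine h1.trans ?_
  have i7 : Integrable (fun ω => γ (n + 1) * √(dispersion (θ n ω)) + γ (n + 1) ^ 2) μ :=
    (i3.const_mul _).add (integrable_const _)
  have i8 : Integrable (fun ω => γ (n + 1) * √(dispersion (θ n ω)) + γ (n + 1) ^ 2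
      + push step r (γ (n + 1)) (θ n ω)) μ := i7.add i2
  calc ∫ ω, dispersion (stepAll step (γ (n + 1)) (θ n ω)) ∂μ
      ≤ ∫ ω, (dispersion (θ n ω) + D * (γ (n + 1) * √(dispersion (θ n ω)) + γ (n + 1) ^ 2
          + push step r (γ (n + 1)) (θ n ω))) ∂μ := by
        refine integral_mono_ae (h.integrable_comp_stepAll hs.mem n cd) (i1.add (i8.const_mul D)) ?_
        filter_upwards [h.mem n] with ω hω
        have hc := hγ (n + 1) (by omega)
        set c := γ (n + 1)
        have e1 := (sqrt_dispersion_le_add (stepAll step c (θ n ω)) (θ n ω)).trans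
          (add_le_add_right (hdisp c _ hc hω) _)
        have hz := hs.push_nonneg hc hω
        have hzB := hB c _ hc hω
        set z := push step r c (θ n ω)
        have e2 := Real.sq_sqrt (dispersion_nonneg (stepAll step c (θ n ω)))
        have e3 := Real.sq_sqrt (dispersion_nonneg (θ n ω))
        have e4 : √(dispersion (θ n ω)) ≤ |B'| :=
          (le_abs_self _).trans ((hB' (θ n ω) fun i _ => hω i).trans (le_abs_self _))
        have hp := Real.sqrt_nonneg (dispersion (θ n ω))
        set p := √(dispersion (θ n ω))
        set p' := √(dispersion (stepAll step c (θ n ω)))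
        have hp' : 0 ≤ p' := Real.sqrt_nonneg _
        have e5 : p' ^ 2 ≤ (p + D₁ * (c + z)) ^ 2 := by gcongr
        rw [← e2, ← e3]
        refine e5.trans ?_
        have e6 : 2 * D₁ * (p * z) ≤ 2 * D₁ * (|B'| * z) := by gcongr
        have e7 : 2 * D₁ ^ 2 * (z * z) ≤ 2 * D₁ ^ 2 * (B * z) := by gcongr
        have e8 : D₁ ^ 2 * (c + z) ^ 2 ≤ 2 * D₁ ^ 2 * c ^ 2 + 2 * D₁ ^ 2 * (z * z) := by
          nlinarith [mul_nonneg (sq_nonneg D₁) (sq_nonneg (c - z))]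
        have hcp : 0 ≤ c * p := mul_nonneg hc.le hp
        have e9 : 2 * D₁ * (c * p) ≤ D * (c * p) := by
          refine mul_le_mul_of_nonneg_right ?_ hcp
          have : 0 ≤ 2 * D₁ ^ 2 + 2 * D₁ * |B'| + 2 * D₁ ^ 2 * B := by positivity
          linarith
        have e10 : 2 * D₁ ^ 2 * c ^ 2 ≤ D * c ^ 2 := by
          refine mul_le_mul_of_nonneg_right ?_ (sq_nonneg c)
          have : 0 ≤ 2 * D₁ + 2 * D₁ * |B'| + 2 * D₁ ^ 2 * B := by positivity
          linarith
        have e11 : (2 * D₁ * |B'| + 2 * D₁ ^ 2 * B) * z ≤ D * z := by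
          refine mul_le_mul_of_nonneg_right ?_ hz
          have : 0 ≤ 2 * D₁ + 2 * D₁ ^ 2 := by positivity
          linarith
        linarith
    _ = _ := by
        rw [integral_add i1 (i8.const_mul D), integral_const_mul, integral_add i7 i2,
          integral_add (i3.const_mul _) (integrable_const _), integral_const_mul]
        simp

/-- Along the process, the gap (weighted by the step sizes), the pushes and the squared gossip
noise are summable in mean. -/
theorem summable_means (h : GossipDynamics μ ℱ P step γ W θ) (hs : StepBounds P f step r M C L κ)
    (hfm : ∀ i, Measurable (f i))
    (hγ : StepAssumptions γ fun n => gossipNorm μ (fun ω => Matrix.of (W n ω))) :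
    Summable (fun n => γ (n + 1) * ∫ ω, gap P f κ (average (θ n ω)) ∂μ) ∧
    Summable (fun n => ∫ ω, push step r (γ (n + 1)) (θ n ω) ∂μ) ∧
    Summable (fun n => ∫ ω, ‖average (θ (n + 1) ω)
      - average (stepAll step (γ (n + 1)) (θ n ω))‖ ^ 2 ∂μ) := by
  obtain ⟨α, hα, hγ0, hlim⟩ := hγ.decay
  have hpos := hγ.pos
  obtain ⟨a, ha0, ha⟩ := EReal.lt_iff_exists_real_btwn.mp hlim
  have ha0' : 0 < a := by exact_mod_cast ha0
  have hρ : ∀ᶠ n : ℕ in atTop, a * ((n : ℝ) ^ α * γ n)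
      ≤ 1 - gossipNorm μ (fun ω => Matrix.of (W n ω)) := by
    filter_upwards [eventually_lt_of_lt_liminf ha, eventually_ge_atTop 1] with n h1 hn
    have h2 : a < (1 - gossipNorm μ (fun ω => Matrix.of (W n ω))) / ((n : ℝ) ^ α * γ n) := by
      exact_mod_cast h1
    have hn0 : (0 : ℝ) < n := by exact_mod_cast hn
    have : 0 < (n : ℝ) ^ α * γ n := mul_pos (Real.rpow_pos_of_pos hn0 _) (hpos n hn)
    rw [lt_div_iff₀ this] at h2
    exact h2.le
  have hγ2 : Summable fun n => γ (n + 1) ^ 2 :=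
    (summable_nat_add_iff (f := fun n => γ n ^ 2) 1).mpr (summable_sq_of_tendsto_rpow_mul hα hγ0)
  have hγ1 : ∀ᶠ n in atTop, γ (n + 1) ≤ 1 := by
    filter_upwards [hγ2.tendsto_atTop_zero.eventually_le_const zero_lt_one] with n hn
    exact (abs_le_one_iff_mul_self_le_one.mpr (by rwa [← sq]) |> abs_le.mp).2
  obtain ⟨c₀, D, hc₀, hD, hbar⟩ := h.integral_barrier_succ_le hs hpos
  obtain ⟨D₁, hD₁, hdis⟩ := h.integral_sqrt_dispersion_succ_le hs hpos
  have hz0 : ∀ n, 0 ≤ ∫ ω, push step r (γ (n + 1)) (θ n ω) ∂μ := by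
    intro n
    refine integral_nonneg_of_ae ?_
    filter_upwards [h.mem n] with ω hω using hs.push_nonneg (hpos (n + 1) (by omega)) hω
  have hg0 : ∀ n, 0 ≤ ∫ ω, gap P f κ (average (θ n ω)) ∂μ := by
    intro n
    refine integral_nonneg_of_ae ?_
    filter_upwards [h.mem n] with ω hω
    exact gap_nonneg hs.f_nonneg hs.κ_pos.le (average_mem_powerBox hω)
  obtain ⟨hsp, hsz⟩ := summable_of_barrier_recursion (γ := γ)
    (ρ := fun n => gossipNorm μ (fun ω => Matrix.of (W n ω)))
    (φ := fun n => ∫ ω, barrier r (θ n ω) ∂μ) (p := fun n => ∫ ω, √(dispersion (θ n ω)) ∂μ)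
    (z := fun n => ∫ ω, push step r (γ (n + 1)) (θ n ω) ∂μ) hα hpos hγ0 ha0' hρ
    (fun n => integral_nonneg fun ω => barrier_nonneg _ _)
    (fun n => integral_nonneg fun ω => Real.sqrt_nonneg _) hz0 hc₀ hD hD₁
    (eventually_atTop.mpr ⟨1, hbar⟩) (eventually_atTop.mpr ⟨1, hdis⟩)
  have hsum := (hsp.add hγ2).add hsz
  refine ⟨?_, hsz, ?_⟩
  · obtain ⟨D₂, -, hpot⟩ := h.integral_potential_succ_le hs hfm hpos
    have hκ := hs.κ_pos
    have := summable_of_recursive_le (v := fun n => ∫ ω, potential P f κ (θ n ω) ∂μ)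
      (d := fun n => 2 * κ * (γ (n + 1) * ∫ ω, gap P f κ (average (θ n ω)) ∂μ))
      (fun n => integral_nonneg fun ω => potential_nonneg hs.f_nonneg hκ.le _)
      (fun n => mul_nonneg (by positivity) (mul_nonneg (hpos _ (by omega)).le (hg0 n)))
      (hsum.mul_left D₂) (by
        filter_upwards [hγ1, eventually_ge_atTop 1] with n h1 h2
        have := hpot n h2 h1
        linarith)
    exact (summable_mul_left_iff (by positivity)).mp this
  · obtain ⟨D₂, -, hdisp⟩ := h.integral_dispersion_succ_le hs hpos
    have hN : (0 : ℝ) < N := Nat.cast_pos.mpr (NeZero.pos N)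
    have := summable_of_recursive_le (v := fun n => ∫ ω, dispersion (θ n ω) ∂μ)
      (d := fun n => N * ∫ ω, ‖average (θ (n + 1) ω)
        - average (stepAll step (γ (n + 1)) (θ n ω))‖ ^ 2 ∂μ)
      (fun n => integral_nonneg fun ω => dispersion_nonneg _)
      (fun n => mul_nonneg hN.le (integral_nonneg fun ω => sq_nonneg _))
      (hsum.mul_left D₂) (by
        filter_upwards [eventually_ge_atTop 1] with n h2
        exact hdisp n h2)
    exact (summable_mul_left_iff hN.ne').mp this

end GossipDynamics

end

/-! ### Almost sure convergence -/

section
variable {Ω : Type*} [mΩ : MeasurableSpace Ω]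

/-- By Tonelli the sum has finite expectation, hence is finite almost surely. -/
lemma ae_summable_of_summable_integral {μ : Measure Ω} {F : ℕ → Ω → ℝ}
    (hint : ∀ n, Integrable (F n) μ) (h0 : ∀ n, ∀ᵐ ω ∂μ, 0 ≤ F n ω)
    (hs : Summable fun n => ∫ ω, F n ω ∂μ) : ∀ᵐ ω ∂μ, Summable fun n => F n ω := by
  have h1 : ∫⁻ ω, ∑' n, ENNReal.ofReal (F n ω) ∂μ ≠ ⊤ := by
    rw [lintegral_tsum fun n => (hint n).aemeasurable.ennreal_ofReal]
    have : ∀ n, ∫⁻ ω, ENNReal.ofReal (F n ω) ∂μ = ENNReal.ofReal (∫ ω, F n ω ∂μ) := fun n =>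
      (ofReal_integral_eq_lintegral_ofReal (hint n) (h0 n)).symm
    simp_rw [this]
    exact hs.tsum_ofReal_ne_top
  have h2 := ae_lt_top' (AEMeasurable.tsum fun n =>
    (hint n).aemeasurable.ennreal_ofReal) h1
  filter_upwards [h2, ae_all_iff.mpr h0] with ω hω h0ω
  have h3 := ENNReal.summable_toReal hω.ne
  refine h3.congr fun n => ?_
  rw [ENNReal.toReal_ofReal (h0ω n)]

/-- A martingale with bounded increments that are square summable in mean converges. -/
lemma ae_exists_tendsto_of_martingale_diff {μ : Measure Ω} [IsProbabilityMeasure μ]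
    {ℱ : Filtration ℕ mΩ} {ξ : ℕ → Ω → ℝ} {B : ℝ}
    (hmeas : ∀ n, StronglyMeasurable[ℱ (n + 1)] (ξ n)) (hb : ∀ n, ∀ᵐ ω ∂μ, ‖ξ n ω‖ ≤ B)
    (h0 : ∀ n, μ[ξ n | ℱ n] =ᵐ[μ] 0) (hs : Summable fun n => ∫ ω, ξ n ω ^ 2 ∂μ) :
    ∀ᵐ ω ∂μ, ∃ l, Tendsto (fun n => ∑ k ∈ Finset.range n, ξ k ω) atTop (𝓝 l) := by
  set S : ℕ → Ω → ℝ := fun n ω => ∑ k ∈ Finset.range n, ξ k ω with hS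
  have hξm : ∀ n, AEStronglyMeasurable (ξ n) μ := fun n =>
    ((hmeas n).mono (ℱ.le _)).aestronglyMeasurable
  have hξi : ∀ n, Integrable (ξ n) μ := fun n => Integrable.of_bound (hξm n) B (hb n)
  have hSm : ∀ n, StronglyMeasurable[ℱ n] (S n) := fun n =>
    Finset.stronglyMeasurable_fun_sum _ fun k hk =>
      (hmeas k).mono (ℱ.mono (Finset.mem_range.mp hk))
  have hSb : ∀ n, ∀ᵐ ω ∂μ, ‖S n ω‖ ≤ n * B := by
    intro n
    filter_upwards [ae_all_iff.mpr hb] with ω hω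
    refine (norm_sum_le _ _).trans ?_
    calc ∑ k ∈ Finset.range n, ‖ξ k ω‖ ≤ ∑ _k ∈ Finset.range n, B :=
          Finset.sum_le_sum fun k _ => hω k
      _ = n * B := by simp
  have hSi : ∀ n, Integrable (S n) μ := fun n =>
    Integrable.of_bound ((hSm n).mono (ℱ.le _)).aestronglyMeasurable _ (hSb n)
  have hsucc : ∀ n, S (n + 1) = S n + ξ n := by
    intro n
    funext ω
    simp [hS, Finset.sum_range_succ]
  have hmart : Martingale S ℱ μ := by
    refine martingale_nat hSm hSi fun n => ?_
    rw [hsucc]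
    have h1 := condExp_add (hSi n) (hξi n) (ℱ n)
    have h2 := condExp_of_stronglyMeasurable (ℱ.le n) (hSm n) (hSi n)
    filter_upwards [h1, h0 n] with ω e1 e2
    rw [e1, Pi.add_apply, e2, h2]
    simp
  -- Orthogonality of the increments: the second moments of the partial sums add up, so they stay
  -- bounded. This gives the bound in `L¹` needed for martingale convergence.
  have hcross : ∀ n, ∫ ω, S n ω * ξ n ω ∂μ = 0 := by
    intro n
    have h1 := condExp_stronglyMeasurable_mul_of_bound (ℱ.le n) (hSm n) (hξi n) _ (hSb n)
    have h2 : ∫ ω, (S n * ξ n) ω ∂μ = 0 := by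
      rw [← integral_condExp (ℱ.le n)]
      have : μ[S n * ξ n | ℱ n] =ᵐ[μ] 0 := by
        filter_upwards [h1, h0 n] with ω e1 e2
        rw [e1, Pi.mul_apply, e2]
        simp
      rw [integral_congr_ae this]
      simp
    exact h2
  have hSsq : ∀ n, Integrable (fun ω => S n ω ^ 2) μ := by
    intro n
    simp_rw [sq]
    exact (hSi n).bdd_mul ((hSm n).mono (ℱ.le _)).aestronglyMeasurable (hSb n)
  have hξsq : ∀ n, Integrable (fun ω => ξ n ω ^ 2) μ := by
    intro n
    simp_rw [sq]
    exact (hξi n).bdd_mul (hξm n) (hb n)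
  have hSξ : ∀ n, Integrable (fun ω => S n ω * ξ n ω) μ := fun n =>
    (hξi n).bdd_mul ((hSm n).mono (ℱ.le _)).aestronglyMeasurable (hSb n)
  have hE : ∀ n, ∫ ω, S n ω ^ 2 ∂μ = ∑ k ∈ Finset.range n, ∫ ω, ξ k ω ^ 2 ∂μ := by
    intro n
    induction n with
    | zero => simp [hS]
    | succ n ih =>
      rw [Finset.sum_range_succ, ← ih, hsucc]
      have e : ∀ ω, (S n + ξ n) ω ^ 2 = S n ω ^ 2 + 2 * (S n ω * ξ n ω) + ξ n ω ^ 2 := by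
        intro ω
        simp only [Pi.add_apply]
        ring
      simp_rw [e]
      have i1 : Integrable (fun ω => S n ω ^ 2 + 2 * (S n ω * ξ n ω)) μ :=
        (hSsq n).add ((hSξ n).const_mul 2)
      rw [integral_add i1 (hξsq n), integral_add (hSsq n) ((hSξ n).const_mul 2),
        integral_const_mul, hcross]
      simp
  set T := ∑' k, ∫ ω, ξ k ω ^ 2 ∂μ with hT
  have hTb : ∀ n, ∫ ω, S n ω ^ 2 ∂μ ≤ T := fun n => by
    rw [hE]
    exact hs.sum_le_tsum _ fun k _ => integral_nonneg fun ω => sq_nonneg _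
  have hL1 : ∀ n, eLpNorm (S n) 1 μ ≤ (1 + T).toNNReal := by
    intro n
    rw [eLpNorm_one_eq_lintegral_enorm, ← ofReal_integral_norm_eq_lintegral_enorm (hSi n)]
    refine ENNReal.ofReal_le_ofReal ?_
    calc ∫ ω, ‖S n ω‖ ∂μ ≤ ∫ ω, (1 + S n ω ^ 2) ∂μ := by
          refine integral_mono (hSi n).norm ((integrable_const _).add (hSsq n)) fun ω => ?_
          dsimp only
          rw [Real.norm_eq_abs]
          nlinarith [sq_abs (S n ω), sq_nonneg (|S n ω| - 1)]
      _ = 1 + ∫ ω, S n ω ^ 2 ∂μ := by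
          rw [integral_add (integrable_const _) (hSsq n)]
          simp
      _ ≤ 1 + T := by linarith [hTb n]
  exact hmart.submartingale.exists_ae_tendsto_of_bdd hL1

end

/-! ### Deterministic arguments on cluster points. -/

/-- A sequence that moves at speed at most of the order of `γ`, up to summable and convergent
perturbations, can only accumulate at zeros of a function whose `γ`-weighted sum is finite. -/
lemma eq_zero_of_mapClusterPt {E : Type*} [NormedAddCommGroup E] {ψ ξ : ℕ → E} {γ z : ℕ → ℝ}
    {D : ℝ} (hγ : ∀ n, 0 ≤ γ n) (hγs : ¬ Summable γ) (hz : Summable z)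
    (hξ : ∃ l, Tendsto (fun n => ∑ k ∈ Finset.range n, ξ k) atTop (𝓝 l))
    (hstep : ∀ n, ‖ψ (n + 1) - ψ n - ξ n‖ ≤ D * (γ n + z n)) {G : Set E} (hψ : ∀ n, ψ n ∈ G)
    {Γ : E → ℝ} (hΓ0 : ∀ x ∈ G, 0 ≤ Γ x) (hΓ : ContinuousOn Γ G)
    (hsum : Summable fun n => γ n * Γ (ψ n)) {x : E} (hxG : x ∈ G)
    (hx : MapClusterPt x atTop ψ) : Γ x = 0 := by
  classical
  by_contra hne
  have hpos : 0 < Γ x := lt_of_le_of_ne (hΓ0 x hxG) (Ne.symm hne)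
  obtain ⟨η', hη', hball⟩ := Metric.continuousWithinAt_iff.mp (hΓ x hxG) (Γ x / 2) (by linarith)
  set η := η' / 2 with hη
  have hη0 : 0 < η := by linarith
  have hlow : ∀ n, dist (ψ n) x < 2 * η → Γ x / 2 ≤ Γ (ψ n) := by
    intro n hn
    have := hball (hψ n) (by linarith)
    rw [Real.dist_eq, abs_lt] at this
    linarith
  -- The step sizes spent near `x`. Their sum is finite because the gap is at least `Γ x / 2` there.
  set u : ℕ → ℝ := fun n => if dist (ψ n) x < 2 * η then γ n else 0 with hu
  have hus : Summable u := by
    refine Summable.of_nonneg_of_le (fun n => ?_) (fun n => ?_) (hsum.mul_left (2 / Γ x))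
    · simp only [hu]
      split_ifs
      · exact hγ n
      · exact le_rfl
    · simp only [hu]
      split_ifs with hn
      · have := mul_le_mul_of_nonneg_left (hlow n hn) (hγ n)
        rw [div_mul_eq_mul_div, le_div_iff₀ hpos]
        linarith
      · exact mul_nonneg (by positivity) (mul_nonneg (hγ n) (hΓ0 _ (hψ n)))
  have has : Summable fun n => D * (u n + z n) := (hus.add hz).mul_left D
  set T : ℕ → ℝ := fun m => ∑ k ∈ Finset.range m, D * (u k + z k) with hT
  set X : ℕ → E := fun m => ∑ k ∈ Finset.range m, ξ k with hX
  obtain ⟨l, hl⟩ := hξ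
  obtain ⟨n₁, hn₁⟩ := Metric.cauchySeq_iff.mp has.hasSum.tendsto_sum_nat.cauchySeq (η / 2)
    (by linarith)
  obtain ⟨n₂, hn₂⟩ := Metric.cauchySeq_iff.mp hl.cauchySeq (η / 2) (by linarith)
  obtain ⟨n₀, hn₀, hdist⟩ : ∃ n₀ ≥ max n₁ n₂, dist (ψ n₀) x < η := by
    have := (mapClusterPt_iff_frequently.mp hx) _ (Metric.ball_mem_nhds x hη0)
    obtain ⟨n₀, h1, h2⟩ := frequently_atTop.mp this (max n₁ n₂)
    exact ⟨n₀, h1, h2⟩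
  have hn01 : n₁ ≤ n₀ := (le_max_left _ _).trans hn₀
  have hn02 : n₂ ≤ n₀ := (le_max_right _ _).trans hn₀
  -- From `n₀` on, the tails of the perturbations and of the time spent near `x` are each below `η /
  -- 2`, so a path starting within `η` of `x` stays within `2 * η`.
  have hclose : ∀ m, n₀ ≤ m → ‖ψ m - ψ n₀ - (X m - X n₀)‖ ≤ T m - T n₀ →
      dist (ψ m) x < 2 * η := by
    intro m hm hle
    have e1 : T m - T n₀ < η / 2 := by
      have := hn₁ m (by omega) n₀ hn01
      rw [Real.dist_eq] at this
      exact (le_abs_self _).trans_lt this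
    have e2 : ‖X m - X n₀‖ < η / 2 := by
      have := hn₂ m (by omega) n₀ hn02
      rwa [dist_eq_norm] at this
    have e3 : ‖ψ m - ψ n₀‖ ≤ ‖ψ m - ψ n₀ - (X m - X n₀)‖ + ‖X m - X n₀‖ := by
      simpa using norm_add_le (ψ m - ψ n₀ - (X m - X n₀)) (X m - X n₀)
    have e4 := dist_triangle (ψ m) (ψ n₀) x
    rw [dist_eq_norm (ψ m) (ψ n₀)] at e4
    linarith
  -- The bound up to time `m` keeps the path near `x`, so the next step size is counted in `u` and
  -- the induction continues. The path never leaves, and all later step sizes would be summable.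
  have hstay : ∀ m, n₀ ≤ m → ‖ψ m - ψ n₀ - (X m - X n₀)‖ ≤ T m - T n₀ := by
    intro m hm
    induction m, hm using Nat.le_induction with
    | base => simp
    | succ m hm ih =>
      have hd := hclose m hm ih
      have e1 : T (m + 1) = T m + D * (γ m + z m) := by
        simp only [hT, Finset.sum_range_succ]
        congr 2
        simp [hu, hd]
      have e2 : X (m + 1) = X m + ξ m := by simp only [hX, Finset.sum_range_succ]
      rw [e1, e2]
      have e3 : ψ (m + 1) - ψ n₀ - (X m + ξ m - X n₀)
          = (ψ m - ψ n₀ - (X m - X n₀)) + (ψ (m + 1) - ψ m - ξ m) := by abel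
      rw [e3]
      refine (norm_add_le _ _).trans ?_
      linarith [hstep m]
  apply hγs
  rw [← summable_nat_add_iff n₀]
  refine ((summable_nat_add_iff n₀).mpr hus).congr fun n => ?_
  simp only [hu]
  rw [if_pos (hclose _ (by omega) (hstay _ (by omega)))]

/-- Otherwise the sequence returns infinitely often to a compact set at positive distance from `S`
and has a cluster point in it. The extended distance also covers an empty `S`, where it is infinite.
-/
lemma tendsto_infEDist_of_mapClusterPt {E : Type*} [PseudoEMetricSpace E] {ψ : ℕ → E} {G S : Set E}
    (hG : IsCompact G) (hψ : ∀ n, ψ n ∈ G) (h : ∀ x ∈ G, MapClusterPt x atTop ψ → x ∈ S) :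
    Tendsto (fun n => Metric.infEDist (ψ n) S) atTop (𝓝 0) := by
  rw [ENNReal.tendsto_nhds_zero]
  by_contra! hcon
  obtain ⟨ε, hε, hfreq⟩ := hcon
  have hK : IsCompact (G ∩ {y | ε ≤ Metric.infEDist y S}) :=
    hG.inter_right (isClosed_le continuous_const Metric.continuous_infEDist)
  obtain ⟨x, hx, hcl⟩ := hK.exists_mapClusterPt_of_frequently (f := ψ)
    (hfreq.mono fun n hn => ⟨hψ n, hn.le⟩)
  have h0 := Metric.infEDist_zero_of_mem (h x hx.1 hcl)
  have := hx.2
  simp only [Set.mem_ofPred_eq, h0, nonpos_iff_eq_zero] at this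
  exact hε.ne' this

/-! ### Convergence of the average along the random process. -/

section
variable {Ω : Type*} [mΩ : MeasurableSpace Ω] {N : ℕ}

namespace GossipDynamics

variable {μ : Measure Ω} [IsProbabilityMeasure μ] {ℱ : Filtration ℕ mΩ} {P : Fin N → ℝ}
  {step : ℝ → Fin N → Powers N → Powers N} {γ : ℕ → ℝ} {W : ℕ → Ω → Fin N → Fin N → ℝ}
  {θ : ℕ → Ω → Fin N → Powers N} {f : Fin N → Powers N → ℝ} {r M C L κ : ℝ}

/-- The displacement of the average in the `n`-th gossip step. -/
def noise (step : ℝ → Fin N → Powers N → Powers N) (γ : ℕ → ℝ) (θ : ℕ → Ω → Fin N → Powers N)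
    (n : ℕ) (ω : Ω) : Powers N :=
  average (θ (n + 1) ω) - average (stepAll step (γ (n + 1)) (θ n ω))

/-- Each coordinate of the noise is a sum of products of a quantity known at time `n` with a centred
column mean of the independent matrix `W (n + 1)`. -/
lemma condExp_noise_eq_zero [NeZero N] (h : GossipDynamics μ ℱ P step γ W θ)
    (hmem : ∀ c i x, x ∈ powerBox P → step c i x ∈ powerBox P) {n : ℕ} (hn : 1 ≤ n) (k : Fin N) :
    μ[fun ω => noise step γ θ n ω k | ℱ n] =ᵐ[μ] 0 := by
  set s : Ω → Fin N → Powers N := fun ω => stepAll step (γ (n + 1)) (θ n ω) with hs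
  set g : Fin N → Ω → ℝ := fun j ω => (N : ℝ)⁻¹ * ∑ i, W (n + 1) ω i j - (N : ℝ)⁻¹ with hg
  have hlaw := h.law (n + 1) (by omega)
  have hgi : ∀ j, Integrable (g j) μ := fun j =>
    ((integrable_finsetSum _ fun i _ => hlaw.integrable_entry i j).const_mul _).sub
      (integrable_const _)
  have hg0 : ∀ j, μ[g j | ℱ n] =ᵐ[μ] 0 := by
    intro j
    have h1 : StronglyMeasurable[MeasurableSpace.comap (W (n + 1)) inferInstance] (g j) := by
      have : Measurable fun w : Fin N → Fin N → ℝ => (N : ℝ)⁻¹ * ∑ i, w i j - (N : ℝ)⁻¹ := by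
        fun_prop
      exact (this.comp (comap_measurable (W (n + 1)))).stronglyMeasurable
    have h2 := condExp_indep_eq hlaw.measurable.comap_le (ℱ.le n) h1 (h.indep n hn)
    have h3 : ∫ ω, g j ω ∂μ = 0 := by
      simp only [hg]
      rw [integral_sub ((integrable_finsetSum _ fun i _ => hlaw.integrable_entry i j).const_mul _)
        (integrable_const _), integral_const_mul,
        integral_finsetSum _ fun i _ => hlaw.integrable_entry i j, hlaw.column]
      simp
    filter_upwards [h2] with ω hω
    rw [hω, h3]
    rfl
  have hsF : Measurable[ℱ n] s := (h.measurable_stepAll _).comp (h.θ_meas n)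
  have hsm : ∀ j, StronglyMeasurable[ℱ n] fun ω => s ω j k := by
    intro j
    have : Measurable fun t : Fin N → Powers N => t j k := by fun_prop
    exact (this.comp hsF).stronglyMeasurable
  obtain ⟨R, hR⟩ := (isCompact_powerBox P).isBounded.exists_norm_le
  have hsb : ∀ j, ∀ᵐ ω ∂μ, ‖s ω j k‖ ≤ R := by
    intro j
    filter_upwards [h.stepAll_mem hmem n] with ω hω
    exact (PiLp.norm_apply_le _ k).trans (hR _ (hω j))
  have hprod : ∀ j, μ[(fun ω => s ω j k) * g j | ℱ n] =ᵐ[μ] 0 := by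
    intro j
    have h1 := condExp_stronglyMeasurable_mul_of_bound (ℱ.le n) (hsm j) (hgi j) R (hsb j)
    filter_upwards [h1, hg0 j] with ω e1 e2
    rw [e1, Pi.mul_apply, e2]
    simp
  have hprodi : ∀ j, Integrable ((fun ω => s ω j k) * g j) μ := fun j =>
    (hgi j).bdd_mul ((hsm j).mono (ℱ.le n)).aestronglyMeasurable (hsb j)
  have he : (fun ω => noise step γ θ n ω k) = ∑ j, (fun ω => s ω j k) * g j := by
    funext ω
    simp only [noise, h.succ, average, mix, PiLp.sub_apply, PiLp.smul_apply, smul_eq_mul,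
      Finset.sum_apply, Pi.mul_apply, hg, WithLp.ofLp_sum]
    rw [Finset.sum_comm, ← mul_sub, ← Finset.sum_sub_distrib, Finset.mul_sum]
    refine Finset.sum_congr rfl fun j _ => ?_
    simp only [hs, ← Finset.sum_mul]
    ring
  rw [he]
  have h4 := condExp_finsetSum (s := Finset.univ) (fun j _ => hprodi j) (ℱ n)
  have h5 : ∀ᵐ ω ∂μ, ∀ j, (μ[(fun ω => s ω j k) * g j | ℱ n]) ω = 0 :=
    ae_all_iff.mpr fun j => hprod j
  filter_upwards [h4, h5] with ω e1 e2
  rw [e1, Finset.sum_apply]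
  simp [e2]

lemma ae_exists_tendsto_sum_noise [NeZero N] (h : GossipDynamics μ ℱ P step γ W θ)
    (hmem : ∀ c i x, x ∈ powerBox P → step c i x ∈ powerBox P)
    (hsum : Summable fun n => ∫ ω, ‖noise step γ θ n ω‖ ^ 2 ∂μ) :
    ∀ᵐ ω ∂μ, ∃ l, Tendsto (fun n => ∑ k ∈ Finset.range n, noise step γ θ (k + 1) ω) atTop
      (𝓝 l) := by
  obtain ⟨R, hR0, hR⟩ := exists_norm_sub_le_of_powerBox P
  have hb : ∀ n, ∀ᵐ ω ∂μ, ‖noise step γ θ n ω‖ ≤ R := by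
    intro n
    filter_upwards [h.mem (n + 1), h.stepAll_mem hmem n] with ω h1 h2
    exact hR _ (average_mem_powerBox h1) _ (average_mem_powerBox h2)
  have hmeasF : ∀ n, Measurable[ℱ (n + 1)] (noise step γ θ n) := by
    intro n
    have h1 : Measurable[ℱ (n + 1)] fun ω => stepAll step (γ (n + 1)) (θ n ω) :=
      (h.measurable_stepAll _).comp ((h.θ_meas n).mono (ℱ.mono n.le_succ) le_rfl)
    exact (continuous_average.measurable.comp (h.θ_meas (n + 1))).sub
      (continuous_average.measurable.comp h1)
  have hcoord : ∀ k : Fin N, ∀ᵐ ω ∂μ, ∃ l, Tendsto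
      (fun n => ∑ m ∈ Finset.range n, noise step γ θ (m + 1) ω k) atTop (𝓝 l) := by
    intro k
    -- The filtration is shifted by one because independence from the past is available only from `W
    -- 2` on.
    let 𝒢 : Filtration ℕ mΩ := ⟨fun n => ℱ (n + 1), fun i j hij => ℱ.mono (by omega),
      fun n => ℱ.le _⟩
    have mk : Measurable fun x : Powers N => x k := by fun_prop
    refine ae_exists_tendsto_of_martingale_diff (ℱ := 𝒢)
      (ξ := fun n ω => noise step γ θ (n + 1) ω k) (B := R) (fun n => ?_) (fun n => ?_)
      (fun n => h.condExp_noise_eq_zero hmem (by omega) k) ?_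
    · exact (mk.comp (hmeasF (n + 1))).stronglyMeasurable
    · filter_upwards [hb (n + 1)] with ω hω using (PiLp.norm_apply_le _ k).trans hω
    · have hsum' := (summable_nat_add_iff 1).mpr hsum
      refine Summable.of_nonneg_of_le (fun n => integral_nonneg fun ω => sq_nonneg _)
        (fun n => ?_) hsum'
      refine integral_mono_of_nonneg (ae_of_all _ fun ω => sq_nonneg _) ?_
        (ae_of_all _ fun ω => ?_)
      · have hm : Measurable (noise step γ θ (n + 1)) := (hmeasF (n + 1)).mono (ℱ.le _) le_rfl
        refine Integrable.of_bound (hm.norm.pow_const 2).aestronglyMeasurable (R ^ 2) ?_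
        filter_upwards [hb (n + 1)] with ω hω
        rw [Real.norm_of_nonneg (sq_nonneg _)]
        gcongr
      · have := PiLp.norm_apply_le (noise step γ θ (n + 1) ω) k
        rw [Real.norm_eq_abs] at this
        dsimp only
        rw [← sq_abs]
        gcongr
  filter_upwards [ae_all_iff.mpr hcoord] with ω hω
  choose l hl using hω
  refine ⟨WithLp.toLp 2 l, ?_⟩
  have h1 : Tendsto (fun n k => ∑ m ∈ Finset.range n, noise step γ θ (m + 1) ω k) atTop (𝓝 l) :=
    tendsto_pi_nhds.mpr hl
  have h2 := ((PiLp.continuous_toLp 2 (fun _ : Fin N => ℝ)).tendsto l).comp h1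
  refine h2.congr fun n => ?_
  ext k
  simp

/-- The average of the estimates accumulates only at points of zero gap. -/
theorem ae_gap_eq_zero_of_mapClusterPt [NeZero N] (h : GossipDynamics μ ℱ P step γ W θ)
    (hs : StepBounds P f step r M C L κ) (hfm : ∀ i, Measurable (f i))
    (hγ : StepAssumptions γ fun n => gossipNorm μ (fun ω => Matrix.of (W n ω))) :
    ∀ᵐ ω ∂μ, (∀ n, average (θ n ω) ∈ powerBox P) ∧
      ∀ x ∈ powerBox P, MapClusterPt x atTop (fun n => average (θ (n + 1) ω)) →
        gap P f κ x = 0 := by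
  obtain ⟨hs1, hs2, hs3⟩ := h.summable_means hs hfm hγ
  have hpos := hγ.pos
  obtain ⟨D, hD, hdisp⟩ := hs.sum_norm_step_sub_le
  have hnotsum : ¬ Summable fun n => γ (n + 2) := by
    intro hsm
    have h1 : Summable γ := (summable_nat_add_iff 2).mp hsm
    have h2 := h1.hasSum.tendsto_sum_nat
    have h3 : Tendsto (fun n => ∑ k ∈ Finset.range (n + 1), γ k) atTop atTop := by
      have h4 := tendsto_atTop_add_const_left atTop (γ 0) hγ.sum_infinite
      refine h4.congr fun n => ?_
      rw [Finset.sum_range_eq_add_Ico _ (by omega)]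
      congr 1
    exact not_tendsto_nhds_of_tendsto_atTop h3 _ (h2.comp (tendsto_add_atTop_nat 1))
  have a1 := ae_summable_of_summable_integral
    (F := fun n ω => γ (n + 1) * gap P f κ (average (θ n ω))) (μ := μ)
    (fun n => (h.integrable_gap hs hfm n).const_mul _) (fun n => by
      filter_upwards [h.mem n] with ω hω
      exact mul_nonneg (hpos _ (by omega)).le
        (gap_nonneg hs.f_nonneg hs.κ_pos.le (average_mem_powerBox hω)))
    (by simpa only [integral_const_mul] using hs1)
  have a2 := ae_summable_of_summable_integral
    (F := fun n ω => push step r (γ (n + 1)) (θ n ω)) (μ := μ)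
    (fun n => h.integrable_push hs hpos n) (fun n => by
      filter_upwards [h.mem n] with ω hω using hs.push_nonneg (hpos _ (by omega)) hω) hs2
  have a3 := h.ae_exists_tendsto_sum_noise hs.mem hs3
  filter_upwards [a1, a2, a3, ae_all_iff.mpr h.mem] with ω b1 b2 b3 b4
  refine ⟨fun n => average_mem_powerBox (b4 n), fun x hx hcl => ?_⟩
  have c1 : Summable fun n => γ (n + 2) * gap P f κ (average (θ (n + 1) ω)) :=
    (summable_nat_add_iff (f := fun n => γ (n + 1) * gap P f κ (average (θ n ω))) 1).mpr b1
  have c2 : Summable fun n => push step r (γ (n + 2)) (θ (n + 1) ω) :=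
    (summable_nat_add_iff (f := fun n => push step r (γ (n + 1)) (θ n ω)) 1).mpr b2
  have c3 : ∀ n, ‖average (θ (n + 1 + 1) ω) - average (θ (n + 1) ω) - noise step γ θ (n + 1) ω‖
      ≤ D * (γ (n + 2) + push step r (γ (n + 2)) (θ (n + 1) ω)) := by
    intro n
    have e : average (θ (n + 1 + 1) ω) - average (θ (n + 1) ω) - noise step γ θ (n + 1) ω
        = average (stepAll step (γ (n + 2)) (θ (n + 1) ω)) - average (θ (n + 1) ω) := by
      simp only [noise]
      abel
    rw [e]
    exact (norm_average_sub_le _ _).trans (hdisp _ _ (hpos _ (by omega)) (b4 _))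
  have c4 : ContinuousOn (gap P f κ) (powerBox P) :=
    (continuousOn_finsetSum _ fun i _ => hs.f_cont i).sub
      (continuous_envelope hs.f_cont).continuousOn
  have c5 : ∀ n, average (θ (n + 1) ω) ∈ powerBox P := fun n => average_mem_powerBox (b4 _)
  exact eq_zero_of_mapClusterPt (ψ := fun n => average (θ (n + 1) ω))
    (ξ := fun n => noise step γ θ (n + 1) ω) (γ := fun n => γ (n + 2))
    (z := fun n => push step r (γ (n + 2)) (θ (n + 1) ω)) (G := powerBox P) (Γ := gap P f κ)
    (fun n => (hpos _ (by omega)).le) hnotsum c2 b3 c3 c5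
    (fun y hy => gap_nonneg hs.f_nonneg hs.κ_pos.le hy) c4 c1 hx hcl

end GossipDynamics

end

/-! ### The Gaussian tail function -/

lemma integrable_exp_neg_sq_div_two : Integrable fun t : ℝ => Real.exp (-t ^ 2 / 2) := by
  have := integrable_exp_neg_mul_sq (b := 1 / 2) (by norm_num)
  refine this.congr (ae_of_all _ fun t => ?_)
  dsimp only
  congr 1
  ring

lemma hasDerivAt_gaussQ (x : ℝ) :
    HasDerivAt gaussQ (-((√(2 * Real.pi))⁻¹ * Real.exp (-x ^ 2 / 2))) x := by
  have hc : Continuous fun t : ℝ => Real.exp (-t ^ 2 / 2) := by fun_prop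
  have hint := integrable_exp_neg_sq_div_two
  -- Splitting the tail at zero leaves a constant minus an interval integral, to which the
  -- fundamental theorem of calculus applies.
  have h1 : gaussQ = fun x => (√(2 * Real.pi))⁻¹ * ((∫ t in Set.Ioi (0 : ℝ), Real.exp (-t ^ 2 / 2))
      - ∫ t in (0 : ℝ)..x, Real.exp (-t ^ 2 / 2)) := by
    funext x
    rw [gaussQ, ← intervalIntegral.integral_interval_add_Ioi (a := 0) (b := x)
      hint.integrableOn hint.integrableOn]
    ring
  have h2 := intervalIntegral.integral_hasDerivAt_right (a := 0) (b := x)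
    (hc.intervalIntegrable 0 x) (hc.stronglyMeasurableAtFilter _ _) hc.continuousAt
  rw [h1]
  simpa using (h2.const_sub (∫ t in Set.Ioi (0 : ℝ), Real.exp (-t ^ 2 / 2))).const_mul
    ((√(2 * Real.pi))⁻¹)

lemma deriv_gaussQ : deriv gaussQ = fun x => -((√(2 * Real.pi))⁻¹ * Real.exp (-x ^ 2 / 2)) :=
  funext fun x => (hasDerivAt_gaussQ x).deriv

lemma differentiable_gaussQ : Differentiable ℝ gaussQ := fun x =>
  (hasDerivAt_gaussQ x).differentiableAt

lemma contDiff_gaussQ : ContDiff ℝ 2 gaussQ := by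
  have h : ContDiff ℝ (1 + 1) gaussQ := by
    rw [contDiff_succ_iff_deriv]
    refine ⟨differentiable_gaussQ, by simp, ?_⟩
    rw [deriv_gaussQ]
    fun_prop
  exact h

lemma gaussQ_nonneg (x : ℝ) : 0 ≤ gaussQ x :=
  mul_nonneg (by positivity) (integral_nonneg fun t => (Real.exp_pos _).le)

lemma antitone_gaussQ : Antitone gaussQ := by
  refine antitone_of_deriv_nonpos differentiable_gaussQ fun x => ?_
  rw [deriv_gaussQ]
  have : 0 ≤ (√(2 * Real.pi))⁻¹ * Real.exp (-x ^ 2 / 2) := by positivity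
  dsimp only
  linarith

lemma gaussQ_sub_le {x y : ℝ} (h : x ≤ y) : gaussQ x - gaussQ y ≤ y - x := by
  have h1 := mul_sub_le_image_sub_of_le_deriv (C := -1) differentiable_gaussQ (fun x => ?_) h
  · linarith
  · rw [deriv_gaussQ]
    have e1 : Real.exp (-x ^ 2 / 2) ≤ 1 := by
      rw [Real.exp_le_one_iff]
      nlinarith [sq_nonneg x]
    have e2 : (√(2 * Real.pi))⁻¹ ≤ 1 := by
      refine inv_le_one_of_one_le₀ ?_
      rw [Real.one_le_sqrt]
      linarith [Real.pi_gt_three]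
    have : (√(2 * Real.pi))⁻¹ * Real.exp (-x ^ 2 / 2) ≤ 1 * 1 := by gcongr
    dsimp only
    linarith

lemma le_gaussQ_sub {x y s : ℝ} (hx : 0 ≤ x) (h : x ≤ y) (hy : y ≤ s) :
    (√(2 * Real.pi))⁻¹ * Real.exp (-s ^ 2 / 2) * (y - x) ≤ gaussQ x - gaussQ y := by
  have h1 := (convex_Icc x y).image_sub_le_mul_sub_of_deriv_le (f := gaussQ)
    (C := -((√(2 * Real.pi))⁻¹ * Real.exp (-s ^ 2 / 2)))
    differentiable_gaussQ.continuous.continuousOn differentiable_gaussQ.differentiableOn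
    (fun z hz => ?_) x (Set.left_mem_Icc.mpr h) y (Set.right_mem_Icc.mpr h) h
  · linarith
  · rw [interior_Icc] at hz
    rw [deriv_gaussQ]
    have hz0 : 0 ≤ z := hx.trans hz.1.le
    have hzs : z ≤ s := hz.2.le.trans hy
    dsimp only
    gcongr

/-! ### The error probability -/

section
variable {N : ℕ} {A : Fin N → Fin N → ℝ} {σ P : Fin N → ℝ}

/-- Interference plus noise at destination `i`. -/
def interference (A : Fin N → Fin N → ℝ) (σ : Fin N → ℝ) (i : Fin N) (p : Powers N) : ℝ :=
  σ i ^ 2 + ∑ j ∈ Finset.univ.erase i, A j i * p j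

lemma sinr_eq (i : Fin N) (p : Powers N) :
    sinr A σ i p = A i i * p i / interference A σ i p := rfl

lemma contDiff_interference (i : Fin N) : ContDiff ℝ 2 (interference A σ i) := by
  unfold interference
  fun_prop

lemma sq_le_interference (hA : ∀ j i, 0 < A j i) {p : Powers N} (hp : p ∈ powerBox P) (i : Fin N) :
    σ i ^ 2 ≤ interference A σ i p := by
  have : 0 ≤ ∑ j ∈ Finset.univ.erase i, A j i * p j :=
    Finset.sum_nonneg fun j _ => mul_nonneg (hA j i).le (hp j).1
  rw [interference]
  linarith

lemma interference_pos (hA : ∀ j i, 0 < A j i) (hσ : ∀ i, 0 < σ i) {p : Powers N}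
    (hp : p ∈ powerBox P) (i : Fin N) : 0 < interference A σ i p :=
  lt_of_lt_of_le (pow_pos (hσ i) 2) (sq_le_interference hA hp i)

lemma shift_same (x : Powers N) (k : Fin N) (t : ℝ) :
    (x + t • EuclideanSpace.single k (1 : ℝ)) k = x k + t := by simp

lemma shift_of_ne (x : Powers N) {k j : Fin N} (h : j ≠ k) (t : ℝ) :
    (x + t • EuclideanSpace.single k (1 : ℝ)) j = x j := by simp [h]

lemma interference_shift_same (x : Powers N) (i : Fin N) (t : ℝ) :
    interference A σ i (x + t • EuclideanSpace.single i (1 : ℝ)) = interference A σ i x := by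
  rw [interference, interference]
  congr 1
  refine Finset.sum_congr rfl fun j hj => ?_
  rw [shift_of_ne x (Finset.ne_of_mem_erase hj)]

lemma interference_shift_of_ne (x : Powers N) {i k : Fin N} (h : k ≠ i) (t : ℝ) :
    interference A σ i (x + t • EuclideanSpace.single k (1 : ℝ))
      = interference A σ i x + A k i * t := by
  have hk : k ∈ Finset.univ.erase i := Finset.mem_erase.mpr ⟨h, Finset.mem_univ k⟩
  rw [interference, interference, ← Finset.add_sum_erase _ _ hk,
    ← Finset.add_sum_erase (a := k) _ _ hk, shift_same]
  have : ∑ j ∈ (Finset.univ.erase i).erase k, A j i * (x + t • EuclideanSpace.single k (1 : ℝ)) j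
      = ∑ j ∈ (Finset.univ.erase i).erase k, A j i * x j :=
    Finset.sum_congr rfl fun j hj => by rw [shift_of_ne x (Finset.ne_of_mem_erase hj)]
  rw [this]
  ring

lemma errProb_le_shift (hA : ∀ j i, 0 < A j i) (hσ : ∀ i, 0 < σ i) {x : Powers N}
    (hx : x ∈ powerBox P) {i k : Fin N} (h : k ≠ i) {t : ℝ} (ht : 0 ≤ t) :
    errProb A σ i x ≤ errProb A σ i (x + t • EuclideanSpace.single k (1 : ℝ)) := by
  apply antitone_gaussQ
  apply Real.sqrt_le_sqrt
  rw [sinr_eq, sinr_eq, interference_shift_of_ne x h, shift_of_ne x h.symm]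
  have := interference_pos hA hσ hx i
  have := hA k i
  have := hA i i
  have := (hx i).1
  gcongr
  nlinarith

/-- Extra interference multiplies the ratio `u` by `q = D / (D + b)`. Since `q ≤ √q` on the unit
interval, the root drops by at most `√u * (1 - q)`, which is linear in `b`. The bound is uniform
even where the own power vanishes. -/
lemma exists_errProb_shift_le (hA : ∀ j i, 0 < A j i) (hσ : ∀ i, 0 < σ i) (hP : ∀ i, 0 < P i)
    (i : Fin N) :
    ∃ C, 0 ≤ C ∧ ∀ x ∈ powerBox P, ∀ k, k ≠ i → ∀ t, 0 ≤ t →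
      errProb A σ i (x + t • EuclideanSpace.single k (1 : ℝ)) ≤ errProb A σ i x + C * t := by
  have ha := hA i i
  have hs : 0 < σ i ^ 2 := pow_pos (hσ i) 2
  refine ⟨√(A i i * P i / σ i ^ 2) * ((∑ k, A k i) / σ i ^ 2), ?_, fun x hx k hk t ht => ?_⟩
  · have : 0 ≤ ∑ k, A k i := Finset.sum_nonneg fun k _ => (hA k i).le
    positivity
  set D := interference A σ i x with hD
  have hDs : σ i ^ 2 ≤ D := sq_le_interference hA hx i
  have hD0 : 0 < D := hs.trans_le hDs
  have hx0 := (hx i).1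
  set b := A k i * t with hb
  have hb0 : 0 ≤ b := mul_nonneg (hA k i).le ht
  set u := A i i * x i / D with hu
  have hu0 : 0 ≤ u := by positivity
  have hv : sinr A σ i (x + t • EuclideanSpace.single k (1 : ℝ)) = u * (D / (D + b)) := by
    rw [sinr_eq, interference_shift_of_ne x hk, shift_of_ne x hk.symm, hu, ← hD, ← hb]
    field_simp
  have hq0 : 0 ≤ D / (D + b) := by positivity
  have hq1 : D / (D + b) ≤ 1 := by
    rw [div_le_one (by positivity)]
    linarith
  have hsq : D / (D + b) ≤ √(D / (D + b)) := by
    apply Real.le_sqrt_of_sq_le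
    nlinarith
  have h1 : errProb A σ i (x + t • EuclideanSpace.single k (1 : ℝ)) - errProb A σ i x
      ≤ √u - √(u * (D / (D + b))) := by
    rw [errProb, errProb, hv]
    refine gaussQ_sub_le (Real.sqrt_le_sqrt ?_)
    rw [sinr_eq]
    exact mul_le_of_le_one_right hu0 hq1
  have h2 : √u - √(u * (D / (D + b))) ≤ √u * (b / σ i ^ 2) := by
    rw [Real.sqrt_mul hu0]
    have e1 : √u * (D / (D + b)) ≤ √u * √(D / (D + b)) := by gcongr
    have e2 : √u * (1 - D / (D + b)) ≤ √u * (b / σ i ^ 2) := by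
      gcongr
      have : 1 - D / (D + b) = b / (D + b) := by
        field_simp
        ring
      rw [this]
      gcongr
      linarith
    linarith
  have h3 : √u * (b / σ i ^ 2)
      ≤ √(A i i * P i / σ i ^ 2) * ((∑ k, A k i) / σ i ^ 2) * t := by
    have e1 : √u ≤ √(A i i * P i / σ i ^ 2) := by
      apply Real.sqrt_le_sqrt
      have := (hP i).le
      have := (hx i).2
      rw [hu]
      gcongr
    have e2 : b / σ i ^ 2 ≤ (∑ k, A k i) / σ i ^ 2 * t := by
      rw [hb, div_mul_eq_mul_div]
      gcongr
      exact Finset.single_le_sum (f := fun k => A k i) (fun j _ => (hA j i).le) (Finset.mem_univ k)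
    rw [mul_assoc]
    gcongr
  linarith

lemma exists_interference_le (hA : ∀ j i, 0 < A j i) (hσ : ∀ i, 0 < σ i) (hP : ∀ i, 0 < P i)
    (i : Fin N) : ∃ D, 0 < D ∧ ∀ x ∈ powerBox P, interference A σ i x ≤ D := by
  refine ⟨σ i ^ 2 + ∑ j ∈ Finset.univ.erase i, A j i * P j, ?_, fun x hx => ?_⟩
  · have := pow_pos (hσ i) 2
    have : 0 ≤ ∑ j ∈ Finset.univ.erase i, A j i * P j :=
      Finset.sum_nonneg fun j _ => mul_nonneg (hA j i).le (hP j).le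
    positivity
  · rw [interference]
    gcongr with j hj
    · exact (hA j i).le
    · exact (hx j).2

/-- The square of the argument of `gaussQ` grows linearly in the own power while the argument itself
is small, so the argument grows at an arbitrarily large rate; near zero `gaussQ` has slope bounded
away from zero. -/
lemma exists_errProb_own_shift_le (hA : ∀ j i, 0 < A j i) (hσ : ∀ i, 0 < σ i) (hP : ∀ i, 0 < P i)
    (i : Fin N) (M : ℝ) :
    ∃ r, 0 < r ∧ ∀ x ∈ powerBox P, ∀ t, 0 ≤ t → x i + t ≤ r →
      errProb A σ i (x + t • EuclideanSpace.single i (1 : ℝ)) ≤ errProb A σ i x - M * t := by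
  obtain ⟨B, hB, hBx⟩ := exists_interference_le hA hσ hP i
  have ha := hA i i
  have hs : 0 < σ i ^ 2 := pow_pos (hσ i) 2
  set a := A i i
  set q := √(a / σ i ^ 2) with hq
  have hq0 : 0 < q := Real.sqrt_pos.mpr (by positivity)
  set c := (√(2 * Real.pi))⁻¹ * Real.exp (-q ^ 2 / 2) with hc
  have hc0 : 0 < c := by
    have := Real.pi_pos
    positivity
  set m := |M| + 1 with hm
  have hm0 : 0 < m := by positivity
  -- Chosen so that `c * a / (2 * q * ε * B) = m`. In the radius below, the bound `1` keeps `v ≤ q`,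
  -- where the slope of `gaussQ` is at least `c` in absolute value, and `ε ^ 2` gives `u + v ≤ 2 * q
  -- * ε`.
  set ε := c * a / (2 * q * B * m) with hε
  have hε0 : 0 < ε := by positivity
  refine ⟨min 1 (ε ^ 2), by positivity, fun x hx t ht hxt => ?_⟩
  have hx0 := (hx i).1
  set D := interference A σ i x with hD
  have hD0 : 0 < D := interference_pos hA hσ hx i
  have hDs : σ i ^ 2 ≤ D := sq_le_interference hA hx i
  have hDB : D ≤ B := hBx x hx
  set u := √(a * x i / D) with hu
  set v := √(a * (x i + t) / D) with hv
  have hu0 : 0 ≤ u := Real.sqrt_nonneg _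
  have huv : u ≤ v := by
    apply Real.sqrt_le_sqrt
    gcongr
    linarith
  have hbound : ∀ s, 0 ≤ s → x i + t ≤ s ^ 2 → v ≤ q * s := by
    intro s hs0 hxs
    rw [hv, hq, ← Real.sqrt_sq hs0, ← Real.sqrt_mul (by positivity)]
    apply Real.sqrt_le_sqrt
    calc a * (x i + t) / D ≤ a * s ^ 2 / σ i ^ 2 := by gcongr
      _ = _ := by ring
  have hvq : v ≤ q := by
    have := hbound 1 zero_le_one (by simpa using hxt.trans (min_le_left _ _))
    simpa using this
  have hvε : v ≤ q * ε := hbound ε hε0.le (hxt.trans (min_le_right _ _))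
  have hdrop := le_gaussQ_sub hu0 huv hvq
  rw [← hc] at hdrop
  have hsq : (v - u) * (v + u) = a * t / D := by
    have e1 : v ^ 2 = a * (x i + t) / D := Real.sq_sqrt (by positivity)
    have e2 : u ^ 2 = a * x i / D := Real.sq_sqrt (by positivity)
    have : (v - u) * (v + u) = v ^ 2 - u ^ 2 := by ring
    rw [this, e1, e2]
    ring
  have h1 : a * t / B ≤ (v - u) * (2 * q * ε) := by
    calc a * t / B ≤ a * t / D := by gcongr
      _ = (v - u) * (v + u) := hsq.symm
      _ ≤ (v - u) * (2 * q * ε) := by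
        refine mul_le_mul_of_nonneg_left ?_ (by linarith)
        linarith
  have h2 : m * t ≤ c * (v - u) := by
    have e1 : (v - u) * (2 * q * ε) = (c * (v - u)) * (a / (B * m)) := by
      rw [hε]
      field_simp
    have e2 : a * t / B = (m * t) * (a / (B * m)) := by field_simp
    rw [e1, e2] at h1
    exact le_of_mul_le_mul_right h1 (by positivity)
  have h3 : M * t ≤ m * t := by
    gcongr
    rw [hm]
    linarith [le_abs_self M]
  have e1 : errProb A σ i (x + t • EuclideanSpace.single i (1 : ℝ)) = gaussQ v := by
    rw [errProb, sinr_eq, interference_shift_same, shift_same]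
  have e2 : errProb A σ i x = gaussQ u := rfl
  rw [e1, e2]
  linarith

lemma errProb_own_shift_le (hA : ∀ j i, 0 < A j i) (hσ : ∀ i, 0 < σ i) {x : Powers N}
    (hx : x ∈ powerBox P) (i : Fin N) {t : ℝ} (ht : 0 ≤ t) :
    errProb A σ i (x + t • EuclideanSpace.single i (1 : ℝ)) ≤ errProb A σ i x := by
  apply antitone_gaussQ
  apply Real.sqrt_le_sqrt
  rw [sinr_eq, sinr_eq, interference_shift_same, shift_same]
  have := interference_pos hA hσ hx i
  have := hA i i
  gcongr
  linarith

lemma measurable_errProb (i : Fin N) : Measurable (errProb A σ i) := by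
  have h1 : Measurable (sinr A σ i) := by
    unfold sinr
    fun_prop
  exact differentiable_gaussQ.continuous.measurable.comp h1.sqrt

lemma continuousOn_errProb (hA : ∀ j i, 0 < A j i) (hσ : ∀ i, 0 < σ i) (i : Fin N) :
    ContinuousOn (errProb A σ i) (powerBox P) := by
  have h1 : ContinuousOn (sinr A σ i) (powerBox P) := by
    have h2 : Continuous fun p : Powers N => A i i * p i := by fun_prop
    exact h2.continuousOn.div (contDiff_interference i).continuous.continuousOn
      fun x hx => (interference_pos hA hσ hx i).ne'
  exact differentiable_gaussQ.continuous.comp_continuousOn h1.sqrt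

lemma contDiffOn_errProb (hA : ∀ j i, 0 < A j i) (i : Fin N) :
    ContDiffOn ℝ 2 (errProb A σ i) {x | 0 < x i ∧ 0 < interference A σ i x} := by
  intro x hx
  obtain ⟨hx1, hx2⟩ := hx
  have h1 : ContDiffAt ℝ 2 (fun p : Powers N => A i i * p i) x := by fun_prop
  have h2 : ContDiffAt ℝ 2 (sinr A σ i) x := h1.div (contDiff_interference i).contDiffAt hx2.ne'
  have h3 : sinr A σ i x ≠ 0 := by
    rw [sinr_eq]
    have := hA i i
    positivity
  exact (contDiff_gaussQ.contDiffAt.comp x (h2.sqrt h3)).contDiffWithinAt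

lemma isOpen_errProb_domain (i : Fin N) :
    IsOpen {x : Powers N | 0 < x i ∧ 0 < interference A σ i x} := by
  have h1 : Continuous fun x : Powers N => x i := by fun_prop
  exact (isOpen_lt continuous_const h1).inter
    (isOpen_lt continuous_const (contDiff_interference i).continuous)

lemma differentiableAt_errProb (hA : ∀ j i, 0 < A j i) (hσ : ∀ i, 0 < σ i) {x : Powers N}
    (hx : x ∈ powerBox P) {i : Fin N} (hxi : 0 < x i) : DifferentiableAt ℝ (errProb A σ i) x :=
  ((contDiffOn_errProb hA i).differentiableOn (by norm_num)).differentiableAt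
    ((isOpen_errProb_domain i).mem_nhds ⟨hxi, interference_pos hA hσ hx i⟩)

end

/-! ### One-sided difference quotients and second-order bounds -/

section
variable {E : Type*} [NormedAddCommGroup E] [InnerProductSpace ℝ E] [CompleteSpace E]

lemma tendsto_slope_of_hasGradientAt {f : E → ℝ} {g x : E} (h : HasGradientAt f g x) (v : E) :
    Tendsto (fun t : ℝ => t⁻¹ * (f (x + t • v) - f x)) (𝓝[>] 0) (𝓝 (inner ℝ g v)) := by
  have h1 : HasDerivAt (fun t : ℝ => f (x + t • v)) (inner ℝ g v) 0 := by
    have h2 : HasDerivAt (fun t : ℝ => x + t • v) v 0 := by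
      simpa using ((hasDerivAt_id (0 : ℝ)).smul_const v).const_add x
    have h3 : HasFDerivAt f (InnerProductSpace.toDual ℝ E g) (x + (0 : ℝ) • v) := by
      simpa using h.hasFDerivAt
    have h4 := h3.comp_hasDerivAt 0 h2
    rw [InnerProductSpace.toDual_apply_apply] at h4
    exact h4
  simpa using h1.tendsto_slope_zero_right

lemma inner_le_of_hasGradientAt {f : E → ℝ} {g x v : E} (h : HasGradientAt f g x)
    {m δ : ℝ} (hδ : 0 < δ) (hle : ∀ t, 0 < t → t ≤ δ → f (x + t • v) ≤ f x + m * t) :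
    inner ℝ g v ≤ m := by
  refine le_of_tendsto (tendsto_slope_of_hasGradientAt h v) ?_
  filter_upwards [Ioc_mem_nhdsGT hδ] with t ht
  have := hle t ht.1 ht.2
  rw [inv_mul_le_iff₀ ht.1]
  linarith

lemma le_inner_of_hasGradientAt {f : E → ℝ} {g x v : E} (h : HasGradientAt f g x)
    {m δ K : ℝ} (hδ : 0 < δ)
    (hle : ∀ t, 0 < t → t ≤ δ → f x + m * t - K * t ^ 2 ≤ f (x + t • v)) : m ≤ inner ℝ g v := by
  have h1 : Tendsto (fun t : ℝ => m - K * t) (𝓝[>] 0) (𝓝 m) := by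
    have : Tendsto (fun t : ℝ => m - K * t) (𝓝 0) (𝓝 (m - K * 0)) :=
      Continuous.tendsto (by fun_prop) 0
    rw [mul_zero, sub_zero] at this
    exact this.mono_left nhdsWithin_le_nhds
  refine le_of_tendsto_of_tendsto h1 (tendsto_slope_of_hasGradientAt h v) ?_
  filter_upwards [Ioc_mem_nhdsGT hδ] with t ht
  have := hle t ht.1 ht.2
  rw [le_inv_mul_iff₀ ht.1]
  nlinarith

/-- A function of class `C²` near a compact convex set satisfies a quadratic bound on it. -/
lemma exists_quadratic_bound {f : E → ℝ} {O K : Set E} (hO : IsOpen O) (hf : ContDiffOn ℝ 2 f O)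
    (hK : IsCompact K) (hKc : Convex ℝ K) (hKO : K ⊆ O) :
    ∃ L κ, 0 ≤ L ∧ 0 ≤ κ ∧ (∀ x ∈ K, ‖gradient f x‖ ≤ L) ∧
      ∀ x ∈ K, ∀ y ∈ K, f x + inner ℝ (gradient f x) (y - x) - κ * ‖y - x‖ ^ 2 ≤ f y := by
  have hd : ∀ x ∈ K, DifferentiableAt ℝ f x := fun x hx =>
    (hf.differentiableOn (by norm_num)).differentiableAt (hO.mem_nhds (hKO hx))
  have hf1 : ContDiffOn ℝ 1 (fderiv ℝ f) O := hf.fderiv_of_isOpen hO (by norm_num)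
  have hd1 : ∀ x ∈ K, DifferentiableAt ℝ (fderiv ℝ f) x := fun x hx =>
    (hf1.differentiableOn (by norm_num)).differentiableAt (hO.mem_nhds (hKO hx))
  obtain ⟨L, hL⟩ := hK.exists_bound_of_continuousOn (hf1.continuousOn.mono hKO)
  obtain ⟨B, hB⟩ := hK.exists_bound_of_continuousOn
    ((hf1.continuousOn_fderiv_of_isOpen hO (by norm_num)).mono hKO)
  refine ⟨|L|, |B|, abs_nonneg _, abs_nonneg _, fun x hx => ?_, fun x hx y hy => ?_⟩
  · rw [gradient, LinearIsometryEquiv.norm_map]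
    exact (hL x hx).trans (le_abs_self L)
  · have hseg : segment ℝ x y ⊆ K := hKc.segment_subset hx hy
    have h1 : ∀ z ∈ segment ℝ x y, ‖fderiv ℝ f z - fderiv ℝ f x‖ ≤ |B| * ‖y - x‖ := by
      intro z hz
      have e1 := hKc.norm_image_sub_le_of_norm_fderiv_le (𝕜 := ℝ) hd1
        (fun w hw => (hB w hw).trans (le_abs_self B)) hx (hseg hz)
      refine e1.trans ?_
      gcongr
      obtain ⟨a, b, ha, hb, hab, rfl⟩ := hz
      have : a • x + b • y - x = b • (y - x) := by
        have : a = 1 - b := by linarith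
        rw [this, sub_smul, one_smul, smul_sub]
        abel
      rw [this, norm_smul, Real.norm_of_nonneg hb]
      exact mul_le_of_le_one_left (norm_nonneg _) (by linarith)
    have h2 := (convex_segment x y).norm_image_sub_le_of_norm_fderiv_le' (𝕜 := ℝ)
      (fun z hz => hd z (hseg hz)) h1 (left_mem_segment ℝ x y) (right_mem_segment ℝ x y)
    have h3 : inner ℝ (gradient f x) (y - x) = fderiv ℝ f x (y - x) := by
      rw [gradient, InnerProductSpace.toDual_symm_apply]
    rw [h3]
    rw [Real.norm_eq_abs, abs_le] at h2
    nlinarith [h2.1]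

end

/-! ### The projection onto the box -/

section
variable {N : ℕ} {A : Fin N → Fin N → ℝ} {σ β P : Fin N → ℝ}

/-- Coordinatewise truncation to the box. -/
def clampBox (P : Fin N → ℝ) (x : Powers N) : Powers N :=
  WithLp.toLp 2 fun k => max 0 (min (x k) (P k))

lemma clampBox_mem (hP : ∀ i, 0 ≤ P i) (x : Powers N) : clampBox P x ∈ powerBox P := fun i =>
  ⟨le_max_left _ _, max_le (hP i) (min_le_right _ _)⟩

/-- The obtuse angle property of the projection, coordinate by coordinate. It yields minimality and
uniqueness of the nearest point and also serves in `descent`. -/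
lemma norm_sub_clampBox_sq_add_le (hP : ∀ i, 0 ≤ P i) (x : Powers N) {z : Powers N}
    (hz : z ∈ powerBox P) :
    ‖x - clampBox P x‖ ^ 2 + ‖clampBox P x - z‖ ^ 2 ≤ ‖x - z‖ ^ 2 := by
  simp only [EuclideanSpace.norm_sq_eq, ← Finset.sum_add_distrib]
  refine Finset.sum_le_sum fun k _ => ?_
  simp only [PiLp.sub_apply, Real.norm_eq_abs, sq_abs, clampBox]
  have h0 := hP k
  obtain ⟨h1, h2⟩ := hz k
  rcases le_total (x k) (P k) with h | h
  · rw [min_eq_left h]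
    rcases le_total 0 (x k) with h' | h'
    · rw [max_eq_right h']
      nlinarith
    · rw [max_eq_left h']
      nlinarith
  · rw [min_eq_right h, max_eq_right h0]
    nlinarith

lemma proj_powerBox (hP : ∀ i, 0 ≤ P i) (x : Powers N) : proj (powerBox P) x = clampBox P x := by
  have hex : ∃ y, y ∈ powerBox P ∧ ∀ z ∈ powerBox P, ‖x - y‖ ≤ ‖x - z‖ := by
    refine ⟨clampBox P x, clampBox_mem hP x, fun z hz => ?_⟩
    have := norm_sub_clampBox_sq_add_le hP x hz
    exact abs_le_of_sq_le_sq' (by nlinarith [sq_nonneg ‖clampBox P x - z‖]) (norm_nonneg _) |>.2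
  obtain ⟨h1, h2⟩ := Classical.epsilon_spec hex
  have h3 := norm_sub_clampBox_sq_add_le hP x h1
  have h4 := h2 _ (clampBox_mem hP x)
  have h5 := pow_le_pow_left₀ (norm_nonneg _) h4 2
  have h6 : ‖clampBox P x - proj (powerBox P) x‖ ^ 2 ≤ 0 := by
    unfold proj
    linarith
  have h7 : ‖clampBox P x - proj (powerBox P) x‖ = 0 := by
    have := sq_nonneg ‖clampBox P x - proj (powerBox P) x‖
    exact pow_eq_zero_iff (two_ne_zero) |>.mp (le_antisymm h6 this)
  exact (sub_eq_zero.mp (norm_eq_zero.mp h7)).symm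

lemma continuous_clampBox : Continuous (clampBox P) := by
  refine (PiLp.continuous_toLp 2 (fun _ : Fin N => ℝ)).comp (continuous_pi fun k => ?_)
  fun_prop

/-! ### Bounds on the gradient of the error probability -/

lemma inner_single_one (v : Powers N) (k : Fin N) :
    inner ℝ v (EuclideanSpace.single k (1 : ℝ)) = v k := by
  simp [EuclideanSpace.inner_single_right]

lemma gradient_errProb_other_nonneg (hA : ∀ j i, 0 < A j i) (hσ : ∀ i, 0 < σ i) {x : Powers N}
    (hx : x ∈ powerBox P) {i k : Fin N} (hxi : 0 < x i) (hk : k ≠ i) :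
    0 ≤ gradient (errProb A σ i) x k := by
  rw [← inner_single_one]
  refine le_inner_of_hasGradientAt (differentiableAt_errProb hA hσ hx hxi).hasGradientAt
    (δ := 1) (K := 0) one_pos fun t ht _ => ?_
  have := errProb_le_shift hA hσ hx hk ht.le
  linarith

lemma gradient_errProb_other_le (hA : ∀ j i, 0 < A j i) (hσ : ∀ i, 0 < σ i) (hP : ∀ i, 0 < P i)
    (i : Fin N) :
    ∃ C, 0 ≤ C ∧ ∀ x ∈ powerBox P, 0 < x i → ∀ k, k ≠ i → gradient (errProb A σ i) x k ≤ C := by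
  obtain ⟨C, hC, h⟩ := exists_errProb_shift_le hA hσ hP i
  refine ⟨C, hC, fun x hx hxi k hk => ?_⟩
  rw [← inner_single_one]
  exact inner_le_of_hasGradientAt (differentiableAt_errProb hA hσ hx hxi).hasGradientAt
    (δ := 1) one_pos fun t ht _ => h x hx k hk t ht.le

lemma gradient_errProb_own_nonpos (hA : ∀ j i, 0 < A j i) (hσ : ∀ i, 0 < σ i) {x : Powers N}
    (hx : x ∈ powerBox P) {i : Fin N} (hxi : 0 < x i) : gradient (errProb A σ i) x i ≤ 0 := by
  rw [← inner_single_one]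
  refine inner_le_of_hasGradientAt (differentiableAt_errProb hA hσ hx hxi).hasGradientAt
    (δ := 1) one_pos fun t ht _ => ?_
  have := errProb_own_shift_le hA hσ hx i ht.le
  linarith

/-- Stated for any gradient and without positivity of `x i`, so that it can also refute
differentiability where `x i = 0`. -/
lemma gradient_errProb_own_le (hA : ∀ j i, 0 < A j i) (hσ : ∀ i, 0 < σ i) (hP : ∀ i, 0 < P i)
    (i : Fin N) (M : ℝ) :
    ∃ r, 0 < r ∧ ∀ x ∈ powerBox P, x i ≤ r → ∀ g, HasGradientAt (errProb A σ i) g x → g i ≤ -M := by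
  obtain ⟨r, hr, h⟩ := exists_errProb_own_shift_le hA hσ hP i M
  refine ⟨r / 2, by positivity, fun x hx hxi g hg => ?_⟩
  rw [← inner_single_one]
  refine inner_le_of_hasGradientAt hg (δ := r / 2) (by positivity) fun t ht htr => ?_
  have := h x hx t ht.le (by linarith)
  linarith

lemma own_ne_zero_of_differentiableAt (hA : ∀ j i, 0 < A j i) (hσ : ∀ i, 0 < σ i)
    (hP : ∀ i, 0 < P i) {x : Powers N} (hx : x ∈ powerBox P) {i : Fin N}
    (hd : DifferentiableAt ℝ (errProb A σ i) x) : x i ≠ 0 := by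
  intro h0
  -- With this `M`, the conclusion would say that the own derivative is at most itself minus one.
  obtain ⟨r, hr, h⟩ := gradient_errProb_own_le hA hσ hP i (1 - gradient (errProb A σ i) x i)
  have := h x hx (by rw [h0]; exact hr.le) _ hd.hasGradientAt
  linarith

/-- On the part of the box away from the singularity the function is of class `C²`. A point `y`
outside that part is at distance at least `δ / 2` from `x`, so a large multiple of the squared
distance dominates all the bounded terms, even though the gradient at `y` may blow up. -/
lemma exists_errProb_quadratic_bound (hA : ∀ j i, 0 < A j i) (hσ : ∀ i, 0 < σ i) (i : Fin N)
    {δ : ℝ} (hδ : 0 < δ) :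
    ∃ L κ, 0 ≤ L ∧ 0 ≤ κ ∧ ∀ x ∈ powerBox P, δ ≤ x i → ‖gradient (errProb A σ i) x‖ ≤ L ∧
      ∀ y ∈ powerBox P, errProb A σ i x + inner ℝ (gradient (errProb A σ i) x) (y - x)
        - κ * ‖y - x‖ ^ 2 ≤ errProb A σ i y := by
  have hci : Continuous fun x : Powers N => x i := by fun_prop
  set K := powerBox P ∩ {x : Powers N | δ / 2 ≤ x i} with hK
  have hKcpt : IsCompact K := (isCompact_powerBox P).inter_right (isClosed_le continuous_const hci)
  have hKconv : Convex ℝ K := by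
    refine (convex_powerBox P).inter fun x hx y hy a b ha hb hab => ?_
    have e : (a • x + b • y) i = a * x i + b * y i := by simp
    change δ / 2 ≤ (a • x + b • y) i
    rw [e]
    have h1 : a * (δ / 2) ≤ a * x i := mul_le_mul_of_nonneg_left hx ha
    have h2 : b * (δ / 2) ≤ b * y i := mul_le_mul_of_nonneg_left hy hb
    have h3 : a * (δ / 2) + b * (δ / 2) = δ / 2 := by rw [← add_mul, hab, one_mul]
    linarith
  have hKO : K ⊆ {x | 0 < x i ∧ 0 < interference A σ i x} := fun x hx =>
    ⟨lt_of_lt_of_le (by positivity) hx.2, interference_pos hA hσ hx.1 i⟩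
  obtain ⟨L, κ, hL, hκ, hgrad, hquad⟩ := exists_quadratic_bound (isOpen_errProb_domain i)
    (contDiffOn_errProb hA i) hKcpt hKconv hKO
  obtain ⟨B, hB⟩ := (isCompact_powerBox P).exists_bound_of_continuousOn
    (continuousOn_errProb (P := P) hA hσ i)
  obtain ⟨R, hR0, hR⟩ := exists_norm_sub_le_of_powerBox P
  set κ' := (2 * |B| + L * R) * (4 / δ ^ 2) with hκ'
  have hκ'0 : 0 ≤ κ' := by positivity
  refine ⟨L, κ + κ', hL, by positivity, fun x hx hxi => ?_⟩
  have hxK : x ∈ K := ⟨hx, by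
    change δ / 2 ≤ x i
    linarith⟩
  refine ⟨hgrad x hxK, fun y hy => ?_⟩
  by_cases hyi : δ / 2 ≤ y i
  · have h1 := hquad x hxK y ⟨hy, hyi⟩
    have h2 : 0 ≤ κ' * ‖y - x‖ ^ 2 := by positivity
    linarith
  · push Not at hyi
    have h1 : δ / 2 ≤ ‖y - x‖ := by
      have e1 := PiLp.norm_apply_le (y - x) i
      rw [PiLp.sub_apply, Real.norm_eq_abs] at e1
      have e2 := neg_abs_le (y i - x i)
      linarith
    have h2 : 1 ≤ 4 / δ ^ 2 * ‖y - x‖ ^ 2 := by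
      have e1 : (δ / 2) ^ 2 ≤ ‖y - x‖ ^ 2 := by gcongr
      calc (1 : ℝ) = 4 / δ ^ 2 * (δ / 2) ^ 2 := by
            field_simp
            norm_num
        _ ≤ _ := by gcongr
    have h3 : inner ℝ (gradient (errProb A σ i) x) (y - x) ≤ L * R := by
      refine (real_inner_le_norm _ _).trans ?_
      have := hgrad x hxK
      have := hR y hy x hx
      gcongr
    have h4 := (le_abs_self _).trans ((hB x hx).trans (le_abs_self B))
    have h5 := (neg_abs_le (errProb A σ i y))
    have h6 := ((hB y hy).trans (le_abs_self B))
    rw [Real.norm_eq_abs] at h6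
    have h7 : 0 ≤ 2 * |B| + L * R := by positivity
    have h8 := mul_le_mul_of_nonneg_left h2 h7
    have h9 : 0 ≤ κ * ‖y - x‖ ^ 2 := by positivity
    rw [mul_one, ← mul_assoc, ← hκ'] at h8
    linarith

/-! ### Local steps -/

/-- The local step, extended by its limit to the points at which the own coordinate vanishes. -/
def safeStep (A : Fin N → Fin N → ℝ) (σ β P : Fin N → ℝ) (c : ℝ) (i : Fin N) (x : Powers N) :
    Powers N :=
  if x i = 0 then WithLp.toLp 2 (Function.update x i (P i)) else localStep A σ β P c i x

lemma measurable_safeStep (hP : ∀ i, 0 ≤ P i) (c : ℝ) (i : Fin N) :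
    Measurable (safeStep A σ β P c i) := by
  have h1 : Measurable fun x : Powers N => x i := by fun_prop
  have hg : Measurable (gradient (errProb A σ i)) :=
    (InnerProductSpace.toDual ℝ (Powers N)).symm.continuous.measurable.comp
      (measurable_fderiv ℝ (errProb A σ i))
  refine Measurable.ite (h1 (measurableSet_singleton 0)) ?_ ?_
  · refine (PiLp.continuous_toLp 2 (fun _ : Fin N => ℝ)).measurable.comp ?_
    refine measurable_pi_lambda _ fun k => ?_
    by_cases hk : k = i
    · subst hk
      simp
    · simp only [Function.update_of_ne hk]
      fun_prop
  · unfold localStep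
    simp_rw [proj_powerBox hP]
    refine continuous_clampBox.measurable.comp ?_
    exact measurable_id.add ((hg.const_smul (β i)).neg.const_smul c)

lemma localStep_apply (hP : ∀ i, 0 ≤ P i) (c : ℝ) (i : Fin N) (x : Powers N) (k : Fin N) :
    localStep A σ β P c i x k
      = max 0 (min (x k - c * (β i * gradient (errProb A σ i) x k)) (P k)) := by
  rw [localStep, proj_powerBox hP]
  simp [clampBox, sub_eq_add_neg]

lemma exists_pos_le {ι : Type*} [Finite ι] (ρ : ι → ℝ) (hρ : ∀ i, 0 < ρ i) :
    ∃ r, 0 < r ∧ ∀ i, r ≤ ρ i := by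
  cases isEmpty_or_nonempty ι
  · exact ⟨1, one_pos, fun i => isEmptyElim i⟩
  · obtain ⟨i₀, hi₀⟩ := Finite.exists_min ρ
    exact ⟨ρ i₀, hρ i₀, hi₀⟩

lemma exists_nonneg_ge {ι : Type*} [Finite ι] (ρ : ι → ℝ) : ∃ r, 0 ≤ r ∧ ∀ i, ρ i ≤ r := by
  cases isEmpty_or_nonempty ι
  · exact ⟨0, le_rfl, fun i => isEmptyElim i⟩
  · obtain ⟨i₀, hi₀⟩ := Finite.exists_max ρ
    exact ⟨|ρ i₀|, abs_nonneg _, fun i => (hi₀ i).trans (le_abs_self _)⟩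

/-- The local steps of the power allocation algorithm satisfy `StepBounds`. -/
theorem exists_stepBounds [NeZero N] (hA : ∀ j i, 0 < A j i) (hσ : ∀ i, 0 < σ i)
    (hβ : ∀ i, 0 < β i) (hP : ∀ i, 0 < P i) :
    ∃ r M C L κ, StepBounds P (fun i x => β i * errProb A σ i x) (safeStep A σ β P) r M C L κ := by
  have hP0 : ∀ i, 0 ≤ P i := fun i => (hP i).le
  have hN : (0 : ℝ) < N := Nat.cast_pos.mpr (NeZero.pos N)
  have hN1 : (1 : ℝ) ≤ N := by exact_mod_cast NeZero.one_le
  choose C₁ hC₁ hgC using fun i => gradient_errProb_other_le (A := A) (σ := σ) hA hσ hP i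
  obtain ⟨C, hC, hCi⟩ := exists_nonneg_ge fun i => β i * C₁ i
  -- The order of choices matters: `C` bounds the interference derivatives, `M` dominates it, `r` is
  -- small enough for an own push at rate `M`, and only then are `L` and `κ` chosen for the region
  -- above `r / (2 * N)`.
  set M := 4 * N * C + 1 with hM
  choose r₁ hr₁ hgr using fun i => gradient_errProb_own_le (A := A) (σ := σ) hA hσ hP i (M / β i)
  obtain ⟨r, hr, hrle⟩ := exists_pos_le (fun i => min (r₁ i) (P i)) fun i => lt_min (hr₁ i) (hP i)
  have hδ : 0 < r / (2 * N) := by positivity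
  have hδr : r / (2 * N) ≤ r / 2 := by
    gcongr
    linarith
  choose L₁ κ₁ hL₁ hκ₁ hquad using fun i =>
    exists_errProb_quadratic_bound (P := P) (A := A) (σ := σ) hA hσ i hδ
  obtain ⟨κ₂, hκ₂, hκi⟩ := exists_nonneg_ge fun i => β i * κ₁ i
  obtain ⟨L₂, hL₂, hLi⟩ := exists_nonneg_ge fun i => β i * L₁ i
  obtain ⟨R, hR0, hR⟩ := exists_norm_sub_le_of_powerBox P
  set κ := κ₂ + 1 with hκ
  -- The three summands serve the own displacement, the squared gradient in `descent`, and the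
  -- quadratic error in `lipschitz`.
  set L := L₂ + L₂ ^ 2 + κ * R with hL
  have hκR : 0 ≤ κ * R := by positivity
  have hL2L : L₂ ≤ L := by
    have := sq_nonneg L₂
    linarith
  have hrP : ∀ i, r ≤ P i := fun i => (hrle i).trans (min_le_right _ _)
  have hnorm : ∀ i, ∀ x ∈ powerBox P, r / (2 * N) ≤ x i →
      ‖β i • gradient (errProb A σ i) x‖ ≤ L₂ := by
    intro i x hx hxi
    rw [norm_smul, Real.norm_of_nonneg (hβ i).le]
    exact (mul_le_mul_of_nonneg_left (hquad i x hx hxi).1 (hβ i).le).trans (hLi i)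
  have hweak : ∀ i, ∀ x ∈ powerBox P, r / (2 * N) ≤ x i → ∀ y ∈ powerBox P,
      β i * errProb A σ i x + inner ℝ (β i • gradient (errProb A σ i) x) (y - x)
        - κ * ‖y - x‖ ^ 2 ≤ β i * errProb A σ i y := by
    intro i x hx hxi y hy
    have h1 := mul_le_mul_of_nonneg_left ((hquad i x hx hxi).2 y hy) (hβ i).le
    have h2 : β i * κ₁ i * ‖y - x‖ ^ 2 ≤ κ * ‖y - x‖ ^ 2 := by
      refine mul_le_mul_of_nonneg_right ?_ (sq_nonneg _)
      linarith [hκi i]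
    rw [inner_smul_left, conj_trivial]
    linarith
  refine ⟨r, M, C, L, κ, ?_⟩
  refine
    { r_pos := hr
      r_le := hrP
      C_nonneg := hC
      M_pos := by positivity
      M_ge := by linarith
      L_nonneg := by positivity
      κ_pos := by positivity
      f_nonneg := fun i x => mul_nonneg (hβ i).le (gaussQ_nonneg _)
      f_cont := fun i => continuousOn_const.mul (continuousOn_errProb hA hσ i)
      mem := ?_
      other_ge := ?_
      other_le := ?_
      own_ge := ?_
      own_push := ?_
      own_le := ?_
      descent := ?_
      lipschitz := ?_ }
  · intro c i x hx
    unfold safeStep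
    split_ifs with h
    · intro k
      by_cases hk : k = i
      · subst hk
        simp [hP0 k]
      · simpa [Function.update_of_ne hk] using hx k
    · rw [localStep, proj_powerBox hP0]
      exact clampBox_mem hP0 _
  · intro c i x k hc hx hk
    unfold safeStep
    split_ifs with h
    · have : 0 ≤ c * C := by positivity
      simp only [Function.update_of_ne hk]
      linarith
    · have hxi : 0 < x i := lt_of_le_of_ne (hx i).1 (Ne.symm h)
      rw [localStep_apply hP0]
      have h1 : β i * gradient (errProb A σ i) x k ≤ C :=
        (mul_le_mul_of_nonneg_left (hgC i x hx hxi k hk) (hβ i).le).trans (hCi i)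
      have h2 := mul_le_mul_of_nonneg_left h1 hc.le
      have h3 : 0 ≤ c * C := by positivity
      refine le_trans (le_min ?_ ?_) (le_max_right _ _)
      · linarith
      · linarith [(hx k).2]
  · intro c i x k hc hx hk
    unfold safeStep
    split_ifs with h
    · simp only [Function.update_of_ne hk]
      exact le_rfl
    · have hxi : 0 < x i := lt_of_le_of_ne (hx i).1 (Ne.symm h)
      rw [localStep_apply hP0]
      have h1 := gradient_errProb_other_nonneg hA hσ hx hxi hk
      have h2 : 0 ≤ c * (β i * gradient (errProb A σ i) x k) :=
        mul_nonneg hc.le (mul_nonneg (hβ i).le h1)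
      refine max_le (hx k).1 ((min_le_left _ _).trans ?_)
      linarith
  · intro c i x hc hx
    unfold safeStep
    split_ifs with h
    · simpa using (hx i).2
    · have hxi : 0 < x i := lt_of_le_of_ne (hx i).1 (Ne.symm h)
      rw [localStep_apply hP0]
      have h1 := gradient_errProb_own_nonpos hA hσ hx hxi
      have h2 : c * (β i * gradient (errProb A σ i) x i) ≤ 0 :=
        mul_nonpos_of_nonneg_of_nonpos hc.le (mul_nonpos_of_nonneg_of_nonpos (hβ i).le h1)
      refine le_trans (le_min ?_ (hx i).2) (le_max_right _ _)
      linarith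
  · intro c i x hc hx hxr
    unfold safeStep
    split_ifs with h
    · simpa using Or.inl (hrP i)
    · have hxi : 0 < x i := lt_of_le_of_ne (hx i).1 (Ne.symm h)
      rw [localStep_apply hP0]
      have h1 := hgr i x hx (hxr.trans ((hrle i).trans (min_le_left _ _))) _
        (differentiableAt_errProb hA hσ hx hxi).hasGradientAt
      have h2 : β i * gradient (errProb A σ i) x i ≤ -M := by
        have := mul_le_mul_of_nonneg_left h1 (hβ i).le
        have e : β i * -(M / β i) = -M := by
          have := (hβ i).ne'
          field_simp
        linarith
      have h3 := mul_le_mul_of_nonneg_left h2 hc.le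
      refine le_trans (le_min ?_ ?_) (le_max_right _ _)
      · refine (min_le_right _ _).trans ?_
        linarith
      · exact (min_le_left _ _).trans (hrP i)
  · intro c i x hc hx hxr
    have hxi : 0 < x i := by linarith
    rw [safeStep, if_neg hxi.ne', localStep_apply hP0]
    have h1 := hnorm i x hx (hδr.trans hxr)
    have h2 := (PiLp.norm_apply_le (β i • gradient (errProb A σ i) x) i).trans h1
    rw [PiLp.smul_apply, smul_eq_mul, Real.norm_eq_abs] at h2
    have h3 : -(β i * gradient (errProb A σ i) x i) ≤ L := by
      linarith [neg_abs_le (β i * gradient (errProb A σ i) x i)]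
    have h4 := mul_le_mul_of_nonneg_left h3 hc.le
    have h5 : 0 ≤ c * L := by positivity
    refine max_le (by linarith) ((min_le_left _ _).trans ?_)
    linarith
  · intro c i x y hc hx hy hxr
    have hxi : 0 < x i := by linarith
    rw [safeStep, if_neg hxi.ne', localStep, proj_powerBox hP0]
    set G := β i • gradient (errProb A σ i) x with hG
    have h1 := norm_sub_clampBox_sq_add_le hP0 (x + c • -G) hy
    have h2 : ‖x + c • -G - y‖ ^ 2
        = ‖x - y‖ ^ 2 + 2 * c * inner ℝ G (y - x) + c ^ 2 * ‖G‖ ^ 2 := by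
      have e : x + c • -G - y = (x - y) - c • G := by
        rw [smul_neg]
        abel
      rw [e, norm_sub_sq_real, inner_smul_right, norm_smul, mul_pow, Real.norm_eq_abs, sq_abs,
        real_inner_comm, ← neg_sub y x, inner_neg_right]
      ring
    have h3 := hweak i x hx (hδr.trans hxr) y hy
    rw [← hG, norm_sub_rev y x] at h3
    have h4 : ‖G‖ ^ 2 ≤ L := by
      have e1 : ‖G‖ ^ 2 ≤ L₂ ^ 2 := by
        have := hnorm i x hx (hδr.trans hxr)
        gcongr
      linarith
    have h5 := mul_le_mul_of_nonneg_left h4 (sq_nonneg c)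
    have h6 := mul_le_mul_of_nonneg_left h3 (by positivity : 0 ≤ 2 * c)
    have h7 := sq_nonneg ‖x + c • -G - clampBox P (x + c • -G)‖
    linarith
  · intro i x y hx hy _ hyi
    have h1 := hweak i y hy hyi x hx
    have h2 : -(L₂ * ‖x - y‖) ≤ inner ℝ (β i • gradient (errProb A σ i) y) (x - y) := by
      have e1 := neg_abs_le (inner ℝ (β i • gradient (errProb A σ i) y) (x - y))
      have e2 := (abs_real_inner_le_norm (β i • gradient (errProb A σ i) y) (x - y)).trans
        (mul_le_mul_of_nonneg_right (hnorm i y hy hyi) (norm_nonneg _))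
      linarith
    have h3 : κ * ‖x - y‖ ^ 2 ≤ κ * R * ‖x - y‖ := by
      rw [sq, ← mul_assoc]
      refine mul_le_mul_of_nonneg_right ?_ (norm_nonneg _)
      exact mul_le_mul_of_nonneg_left (hR x hx y hy) (by positivity)
    have h4 : 0 ≤ L₂ ^ 2 * ‖x - y‖ := by positivity
    rw [hL]
    linarith

/-! ### Points of zero gap are KKT points -/

lemma objective_le_of_gap_eq_zero (hβ : ∀ i, 0 < β i) {κ : ℝ} (hκ : 0 ≤ κ) {x : Powers N}
    (h : gap P (fun i x => β i * errProb A σ i x) κ x = 0) {y : Powers N} (hy : y ∈ powerBox P) :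
    objective A σ β x ≤ objective A σ β y + κ * N * ‖x - y‖ ^ 2 := by
  have h1 := envelope_le (P := P) (f := fun i x => β i * errProb A σ i x) (κ := κ)
    (fun i x => mul_nonneg (hβ i).le (gaussQ_nonneg _)) hκ x hy
  have h2 : objective A σ β x = envelope P (fun i x => β i * errProb A σ i x) κ x :=
    sub_eq_zero.mp h
  rw [h2]
  exact h1

/-- Minimizers of a quadratic perturbation of the objective have positive coordinates. -/
lemma pos_of_objective_le (hA : ∀ j i, 0 < A j i) (hσ : ∀ i, 0 < σ i) (hβ : ∀ i, 0 < β i)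
    (hP : ∀ i, 0 < P i) {K : ℝ} (hK : 0 ≤ K) {x : Powers N} (hx : x ∈ powerBox P)
    (h : ∀ y ∈ powerBox P, objective A σ β x ≤ objective A σ β y + K * ‖x - y‖ ^ 2) (i : Fin N) :
    0 < x i := by
  by_contra hcon
  have hxi : x i = 0 := le_antisymm (not_lt.mp hcon) (hx i).1
  choose C hC hsh using fun j => exists_errProb_shift_le (A := A) (σ := σ) hA hσ hP j
  set B := ∑ j, β j * C j with hB
  have hB0 : 0 ≤ B := Finset.sum_nonneg fun j _ => mul_nonneg (hβ j).le (hC j)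
  -- Raising coordinate `i` from zero by `t` must gain more than the losses `B * t` of the other
  -- agents and the quadratic penalty, at most `K * t`.
  obtain ⟨r, hr, hown⟩ := exists_errProb_own_shift_le (A := A) (σ := σ) hA hσ hP i
    ((B + K + 1) / β i)
  set t := min (min r 1) (P i) with ht
  have ht0 : 0 < t := lt_min (lt_min hr one_pos) (hP i)
  have htr : t ≤ r := (min_le_left _ _).trans (min_le_left _ _)
  have ht1 : t ≤ 1 := (min_le_left _ _).trans (min_le_right _ _)
  have htP : t ≤ P i := min_le_right _ _
  set y := x + t • EuclideanSpace.single i (1 : ℝ) with hy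
  have hymem : y ∈ powerBox P := by
    intro k
    by_cases hk : k = i
    · subst hk
      rw [hy, shift_same, hxi, zero_add]
      exact ⟨ht0.le, htP⟩
    · rw [hy, shift_of_ne x hk]
      exact hx k
  have h1 := h y hymem
  have hxy : ‖x - y‖ ^ 2 = t ^ 2 := by
    have : x - y = -(t • EuclideanSpace.single i (1 : ℝ)) := by
      rw [hy]
      abel
    rw [this, norm_neg, norm_smul, PiLp.norm_single]
    simp
  have h2 : β i * errProb A σ i y ≤ β i * errProb A σ i x - (B + K + 1) * t := by
    have e1 := mul_le_mul_of_nonneg_left (hown x hx t ht0.le (by rw [hxi]; linarith)) (hβ i).le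
    have e2 : β i * ((B + K + 1) / β i * t) = (B + K + 1) * t := by
      have := (hβ i).ne'
      field_simp
    linarith
  have h3 : ∀ j ∈ Finset.univ.erase i, β j * errProb A σ j y
      ≤ β j * errProb A σ j x + β j * C j * t := by
    intro j hj
    have := mul_le_mul_of_nonneg_left (hsh j x hx i (Finset.ne_of_mem_erase hj).symm t ht0.le)
      (hβ j).le
    linarith
  have h4 : objective A σ β y ≤ objective A σ β x - (K + 1) * t := by
    rw [objective, objective, ← Finset.add_sum_erase _ _ (Finset.mem_univ i),
      ← Finset.add_sum_erase (a := i) _ (fun i => β i * errProb A σ i x) (Finset.mem_univ i)]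
    have e1 := Finset.sum_le_sum h3
    rw [Finset.sum_add_distrib, ← Finset.sum_mul] at e1
    have e2 : ∑ j ∈ Finset.univ.erase i, β j * C j ≤ B :=
      Finset.sum_le_sum_of_subset_of_nonneg (Finset.erase_subset _ _)
        fun j _ _ => mul_nonneg (hβ j).le (hC j)
    have e3 := mul_le_mul_of_nonneg_right e2 ht0.le
    linarith
  rw [hxy] at h1
  have h5 : K * t ^ 2 ≤ K * t := by
    refine mul_le_mul_of_nonneg_left ?_ hK
    nlinarith
  linarith

/-- A quadratic perturbation centred at the minimiser has zero derivative there, so the first-order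
condition is that of the objective itself. -/
theorem mem_kktSet_of_gap_eq_zero (hA : ∀ j i, 0 < A j i) (hσ : ∀ i, 0 < σ i)
    (hβ : ∀ i, 0 < β i) (hP : ∀ i, 0 < P i) {κ : ℝ} (hκ : 0 ≤ κ) {x : Powers N}
    (hx : x ∈ powerBox P) (h : gap P (fun i x => β i * errProb A σ i x) κ x = 0) :
    x ∈ kktSet (powerBox P) (objective A σ β) := by
  have hmin : ∀ y ∈ powerBox P, objective A σ β x ≤ objective A σ β y + κ * N * ‖x - y‖ ^ 2 :=
    fun y hy => objective_le_of_gap_eq_zero hβ hκ h hy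
  have hpos := pos_of_objective_le hA hσ hβ hP (by positivity : 0 ≤ κ * N) hx hmin
  have hd : DifferentiableAt ℝ (objective A σ β) x := by
    unfold objective
    exact DifferentiableAt.fun_sum fun i _ =>
      (differentiableAt_errProb hA hσ hx (hpos i)).const_mul (β i)
  refine ⟨hx, gradient (objective A σ β) x, hd.hasGradientAt, fun y hy => ?_⟩
  have h1 : 0 ≤ inner ℝ (gradient (objective A σ β) x) (y - x) := by
    -- Along a segment of the box the penalty is of order `t ^ 2`, which does not affect the
    -- one-sided derivative.
    refine le_inner_of_hasGradientAt hd.hasGradientAt (δ := 1) (K := κ * N * ‖y - x‖ ^ 2) one_pos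
      fun t ht ht1 => ?_
    have hmem : x + t • (y - x) ∈ powerBox P :=
      (convex_powerBox P).add_smul_sub_mem hx hy ⟨ht.le, ht1⟩
    have h2 := hmin _ hmem
    have e : ‖x - (x + t • (y - x))‖ ^ 2 = t ^ 2 * ‖y - x‖ ^ 2 := by
      rw [sub_add_cancel_left, norm_neg, norm_smul, mul_pow, Real.norm_eq_abs, sq_abs]
    rw [e] at h2
    linarith
  rw [inner_neg_left, ← inner_neg_right, neg_sub]
  exact h1

end

/-! ### The algorithm -/

section
variable {Ω : Type*} [mΩ : MeasurableSpace Ω] {N : ℕ}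

/-- The process driven by the local steps `step` and the gossip matrices `W`. -/
def trajectory (step : ℝ → Fin N → Powers N → Powers N) (γ : ℕ → ℝ)
    (W : ℕ → Ω → Fin N → Fin N → ℝ) (θ₀ : Ω → Fin N → Powers N) : ℕ → Ω → Fin N → Powers N
  | 0 => θ₀
  | n + 1 => fun ω => mix (W (n + 1) ω) (stepAll step (γ (n + 1)) (trajectory step γ W θ₀ n ω))

/-- The filtration generated by the initial estimates and the gossip matrices. -/
def pastFiltration {μ : Measure Ω} {W : ℕ → Ω → Matrix (Fin N) (Fin N) ℝ}
    {θ₀ : Ω → Fin N → Powers N} (hθ₀ : Measurable θ₀) (hW : GossipAssumptions μ W θ₀) :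
    Filtration ℕ mΩ where
  seq := past W θ₀
  mono' := by
    intro m n hmn
    refine sup_le_sup_left (iSup₂_le fun k hk => ?_) _
    rw [Finset.mem_Icc] at hk
    exact le_iSup₂_of_le k (Finset.mem_Icc.mpr ⟨hk.1, hk.2.trans hmn⟩) le_rfl
  le' := by
    intro n
    refine sup_le hθ₀.comap_le (iSup₂_le fun k hk => ?_)
    rw [Finset.mem_Icc] at hk
    exact Measurable.comap_le (measurable_pi_lambda _ fun i => measurable_pi_lambda _ fun j =>
      hW.measurable k hk.1 i j)

lemma GossipAssumptions.gossipLaw {μ : Measure Ω} {W : ℕ → Ω → Matrix (Fin N) (Fin N) ℝ}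
    {θ₀ : Ω → Fin N → Powers N} (hW : GossipAssumptions μ W θ₀) {n : ℕ} (hn : 1 ≤ n) :
    GossipLaw μ fun ω i j => W n ω i j where
  measurable := measurable_pi_lambda _ fun i => measurable_pi_lambda _ fun j =>
    hW.measurable n hn i j
  stochastic := by
    filter_upwards [hW.nonneg n hn, hW.row_stochastic n hn] with ω h1 h2 using ⟨h1, h2⟩
  column := hW.column_stochastic_mean n hn

lemma gossipDynamics_trajectory {μ : Measure Ω} {P : Fin N → ℝ}
    {W : ℕ → Ω → Matrix (Fin N) (Fin N) ℝ} {θ₀ : Ω → Fin N → Powers N} (hθ₀ : Measurable θ₀)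
    (hmem : ∀ᵐ ω ∂μ, ∀ i, θ₀ ω i ∈ powerBox P) (hW : GossipAssumptions μ W θ₀)
    {step : ℝ → Fin N → Powers N → Powers N} (hstep : ∀ c i, Measurable (step c i))
    (hstep_mem : ∀ c i x, x ∈ powerBox P → step c i x ∈ powerBox P) (γ : ℕ → ℝ) :
    GossipDynamics μ (pastFiltration hθ₀ hW) P step γ (fun n ω i j => W n ω i j)
      (trajectory step γ (fun n ω i j => W n ω i j) θ₀) := by
  have hWm : ∀ n, 1 ≤ n →
      Measurable[pastFiltration hθ₀ hW n] fun ω (i j : Fin N) => W n ω i j := by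
    intro n hn
    have : MeasurableSpace.comap (fun ω (i j : Fin N) => W n ω i j) inferInstance
        ≤ past W θ₀ n := by
      refine le_sup_of_le_right ?_
      exact le_iSup₂_of_le n (Finset.mem_Icc.mpr ⟨hn, le_rfl⟩) le_rfl
    exact (comap_measurable _).mono this le_rfl
  have hall : ∀ c, Measurable (stepAll step c) := fun c =>
    measurable_pi_lambda _ fun i => (hstep c i).comp (measurable_pi_apply i)
  refine ⟨fun n hn => hW.gossipLaw hn, hWm, fun n => ?_, hstep, fun n ω => rfl, fun n => ?_,
    fun n hn => hW.indep n hn⟩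
  · induction n with
    | zero =>
      have : MeasurableSpace.comap θ₀ inferInstance ≤ past W θ₀ 0 := le_sup_left
      exact (comap_measurable _).mono this le_rfl
    | succ n ih =>
      have h1 := ih.mono ((pastFiltration hθ₀ hW).mono n.le_succ) le_rfl
      exact continuous_mix.measurable.comp
        ((hWm (n + 1) (by omega)).prodMk ((hall (γ (n + 1))).comp h1))
  · induction n with
    | zero => exact hmem
    | succ n ih =>
      filter_upwards [ih, (hW.gossipLaw (n := n + 1) (by omega)).stochastic] with ω h1 h2 i
      exact mix_mem_powerBox h2 (fun j => hstep_mem _ _ _ (h1 j)) i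

end

/-- `safeStep` departs from the true step only where the own coordinate vanishes, and there the
required gradient does not exist. The estimates for the everywhere defined process therefore
transfer to well-defined realizations. -/
lemma iterates_eq_trajectory {Ω : Type*} {N : ℕ} {A : Fin N → Fin N → ℝ}
    {σ β P : Fin N → ℝ} (hA : ∀ j i, 0 < A j i) (hσ : ∀ i, 0 < σ i) (hP : ∀ i, 0 < P i)
    {γ : ℕ → ℝ} {W : ℕ → Ω → Fin N → Fin N → ℝ}
    {θ₀ : Ω → Fin N → Powers N} {ω : Ω}
    (hmem : ∀ n i, trajectory (safeStep A σ β P) γ W θ₀ n ω i ∈ powerBox P)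
    (hd : ∀ n i, DifferentiableAt ℝ (errProb A σ i)
      (iterates A σ β P γ (fun k => W k ω) (θ₀ ω) n i)) (n : ℕ) :
    iterates A σ β P γ (fun k => W k ω) (θ₀ ω) n = trajectory (safeStep A σ β P) γ W θ₀ n ω := by
  induction n with
  | zero => rfl
  | succ n ih =>
    funext i
    simp only [iterates, trajectory, mix, stepAll, ih]
    refine Finset.sum_congr rfl fun j _ => ?_
    have h1 := hd n j
    rw [ih] at h1
    rw [safeStep, if_neg (own_ne_zero_of_differentiableAt hA hσ hP (hmem n j) h1)]

/-- Settles the degenerate case of no agents, where the space of power vectors is a point. -/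
lemma mem_kktSet_of_subsingleton {N : ℕ} [Subsingleton (Powers N)] {P : Fin N → ℝ}
    {f : Powers N → ℝ} {x : Powers N} (hx : x ∈ powerBox P) : x ∈ kktSet (powerBox P) f := by
  refine ⟨hx, 0, ?_, fun y _ => ?_⟩
  · rw [hasGradientAt_iff_hasFDerivAt]
    exact hasFDerivAt_of_subsingleton f x |>.congr_fderiv (by simp)
  · rw [Subsingleton.elim (x - y) 0, inner_zero_right]

end PowerAllocation

end

theorem mainTheorem5 {Ω : Type*} [MeasurableSpace Ω] (μ : Measure Ω) [IsProbabilityMeasure μ]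
    {N : ℕ} (A : Fin N → Fin N → ℝ) (σ β P : Fin N → ℝ)
    (hA : ∀ j i, 0 < A j i) (hσ : ∀ i, 0 < σ i) (hβ : ∀ i, 0 < β i) (hP : ∀ i, 0 < P i)
    (γ : ℕ → ℝ) (W : ℕ → Ω → Matrix (Fin N) (Fin N) ℝ)
    (θ₀ : Ω → Fin N → PowerAllocation.Powers N) (hθ₀ : Measurable θ₀)
    (hθ₀_mem : ∀ᵐ ω ∂μ, ∀ i, θ₀ ω i ∈ PowerAllocation.powerBox P)
    (hW : PowerAllocation.GossipAssumptions μ W θ₀)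
    (hγ : PowerAllocation.StepAssumptions γ fun n => PowerAllocation.gossipNorm μ (W n)) :
    ∀ᵐ ω ∂μ,
      -- the gradients that the algorithm evaluates exist along the realization
      (∀ n i, DifferentiableAt ℝ (PowerAllocation.errProb A σ i)
        (PowerAllocation.iterates A σ β P γ (fun k => W k ω) (θ₀ ω) n i)) →
      Tendsto
        (fun n => Metric.infEDist
          (PowerAllocation.average
            (PowerAllocation.iterates A σ β P γ (fun k => W k ω) (θ₀ ω) n))
          (PowerAllocation.kktSet (PowerAllocation.powerBox P)
            (PowerAllocation.objective A σ β)))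
        atTop (𝓝 0) := by
  rcases Nat.eq_zero_or_pos N with rfl | hN
  · filter_upwards with ω _
    have h0 : ∀ x : PowerAllocation.Powers 0, Metric.infEDist x
        (PowerAllocation.kktSet (PowerAllocation.powerBox P)
          (PowerAllocation.objective A σ β)) = 0 := fun x =>
      Metric.infEDist_zero_of_mem (PowerAllocation.mem_kktSet_of_subsingleton fun i => i.elim0)
    simp only [h0]
    exact tendsto_const_nhds
  have : NeZero N := ⟨hN.ne'⟩
  obtain ⟨r, M, C, L, κ, hs⟩ := PowerAllocation.exists_stepBounds (A := A) (σ := σ) hA hσ hβ hP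
  have hproc := PowerAllocation.gossipDynamics_trajectory hθ₀ hθ₀_mem hW
    (PowerAllocation.measurable_safeStep (A := A) (σ := σ) (β := β) fun i => (hP i).le) hs.mem γ
  have hmain := hproc.ae_gap_eq_zero_of_mapClusterPt hs
    (fun i => (PowerAllocation.measurable_errProb i).const_mul (β i)) hγ
  filter_upwards [hmain, ae_all_iff.mpr hproc.mem] with ω ⟨hbox, hcl⟩ hmem hd
  have heq := PowerAllocation.iterates_eq_trajectory hA hσ hP hmem hd
  -- The cluster point result concerns the sequence started at time one, from which the independence
  -- assumption is in force.
  rw [← tendsto_add_atTop_iff_nat 1]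
  refine PowerAllocation.tendsto_infEDist_of_mapClusterPt
    (PowerAllocation.isCompact_powerBox P) (fun n => ?_) fun x hx hx' => ?_
  · rw [heq]
    exact hbox (n + 1)
  · simp only [heq] at hx'
    exact PowerAllocation.mem_kktSet_of_gap_eq_zero hA hσ hβ hP hs.κ_pos.le hx (hcl x hx hx')
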